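/- Let $(\Omega,\mu)$ be a measure space, $L_2(\mu)=L_2(\mu;\mathbb{C})$, and let $T$ be a $C_0$-semigroup on $L_2(\mu)$ with generator $A$ that is positive (each $T(t)$ maps a.e. nonnegative functions to a.e. nonnegative functions) and self-adjoint (each $T(t)$ is self-adjoint). For a bounded measurable $V\colon\Omega\to\mathbb{R}$ let $T_V$ be the $C_0$-semigroup generated by $A-V$. A measurable $V\colon\Omega\to\mathbb{R}$ with $V\ge 0$ or $V\le 0$ is called $T$-admissible if $T_V(t):=\lim_{n\to\infty}T_{(V\wedge n)\vee(-n)}(t)$ exists in the strong operator topology for all $t\ge 0$ and $T_V$ is a $C_0$-semigroup on $L_2(\mu)$. A measurable $V\colon\Omega\to\mathbb{R}$ is called $T$-admissible if $V^+=\max(V,0)$ and $-V^-=-\max(-V,0)$ are $T$-admissible; in this case the strong limits $T_V(t):=\lim_{n\to\infty}T_{(V\wedge n)\vee(-n)}(t)$ exist and form a $C_0$-semigroup $T_V$. For a bounded operator $B$ on $L_2(\mu)$, a measurable $w\colon\Omega\to(0,\infty)$ and $q,r\in[1,\infty]$ put \[ \|w^{-1}Bw\|_{q\to r}:=\sup\bigl\{\|w^{-1}B(wf)\|_{L_r(\mu)}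 : f\in L_q(\mu),\ \|f\|_{L_q(\mu)}\le 1,\ wf\in L_2(\mu)\bigr\}\in[0,\infty]. \] Let $\rho\colon\Omega\to(0,\infty)$ be measurable, and assume that for some $c,\nu>0$ \[ \|\rho^{-\alpha}T(t)\rho^{\alpha}\|_{1\to\infty}\le c\,t^{-\nu}e^{\alpha^2t}\qquad(t>0,\ \alpha\in\mathbb{R}). \] Let $V\colon\Omega\to\mathbb{R}$ be measurable, and assume that there exist $p>1$ and $M\ge 1$ such that $pV$ is $T$-admissible and \[ \|T_{pV}(t)\|_{2\to2}\le 1,\qquad \|\rho^{-\alpha}T_V(t)\rho^{\alpha}\|_{1\to1}\le M e^{\alpha^2t}\qquad(t>0,\ \alpha\in\mathbb{R}). \] Then $V$ is $T$-admissible (so that $T_V$ is indeed well defined), and there exists $\tilde c>0$ such that \[ \|\rho^{-\alpha}T_V(t)\rho^{\alpha}\|_{1\to\infty}\le \tilde c\,t^{-\nu}e^{\alpha^2t}\qquad(t>0,\ \alpha\in\mathbb{R}). \] -/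

import Mathlib

open MeasureTheory Filter Topology
open scoped NNReal ENNReal

noncomputable section

/-- `C₀`-semigroups of bounded linear operators on a complex normed space. -/
structure IsC0Semigroup {X : Type*} [NormedAddCommGroup X] [NormedSpace ℂ X]
    (T : ℝ≥0 → X →L[ℂ] X) : Prop where
  map_zero : T 0 = ContinuousLinearMap.id ℂ X
  map_add : ∀ s t : ℝ≥0, T (s + t) = (T s).comp (T t)
  strongly_continuous : ∀ f : X, Continuous fun t : ℝ≥0 => T t f

/-- `(f, g)` lies in the graph of the generator `A` of `T`, i.e. `f ∈ dom A` and `A f = g`,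
where `A f = lim_{t → 0+} t⁻¹ (T t f - f)`. -/
def InGeneratorGraph {X : Type*} [NormedAddCommGroup X] [NormedSpace ℂ X]
    (T : ℝ≥0 → X →L[ℂ] X) (f g : X) : Prop :=
  Tendsto (fun t : ℝ≥0 => ((t : ℝ) : ℂ)⁻¹ • (T t f - f)) (𝓝[>] 0) (𝓝 g)

section Potentials

variable {Ω : Type*} [MeasurableSpace Ω] {μ : Measure Ω}

/-- The operator `A` on `L₂(μ)` maps functions that are `≥ 0` a.e. to functions that are
`≥ 0` a.e. -/
def IsPositiveOperator (A : Lp ℂ 2 μ →L[ℂ] Lp ℂ 2 μ) : Prop :=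
  ∀ f : Lp ℂ 2 μ, (∀ᵐ x ∂μ, 0 ≤ (f x).re ∧ (f x).im = 0) →
    ∀ᵐ x ∂μ, 0 ≤ (A f x).re ∧ (A f x).im = 0

/-- `S` is the `C₀`-semigroup generated by `A - V`, where `A` is the generator of `T`, and the
bounded function `V` acts by multiplication, so that `dom (A - V) = dom A`. -/
def IsBoundedPerturbation (T : ℝ≥0 → Lp ℂ 2 μ →L[ℂ] Lp ℂ 2 μ) (V : Ω → ℝ)
    (S : ℝ≥0 → Lp ℂ 2 μ →L[ℂ] Lp ℂ 2 μ) : Prop :=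
  IsC0Semigroup S ∧
    ∀ f g : Lp ℂ 2 μ, InGeneratorGraph S f g ↔
      ∃ h : Lp ℂ 2 μ, InGeneratorGraph T f h ∧ ∀ᵐ x ∂μ, g x = h x - (V x : ℂ) * f x

open Classical in
/-- The semigroup `T_V` for a `C₀`-semigroup `T` and a bounded measurable `V`; it exists and is
unique in that case. (The value for other `V` is never used.) -/
def boundedPerturbation (T : ℝ≥0 → Lp ℂ 2 μ →L[ℂ] Lp ℂ 2 μ) (V : Ω → ℝ) :
    ℝ≥0 → Lp ℂ 2 μ →L[ℂ] Lp ℂ 2 μ :=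
  if h : ∃ S, IsBoundedPerturbation T V S then h.choose else 0

/-- The truncation `(V ∧ n) ∨ (-n)`. It is `V ∧ n` for `V ≥ 0` and `V ∨ (-n)` for `V ≤ 0`. -/
def truncation (V : Ω → ℝ) (n : ℕ) : Ω → ℝ := fun x => max (min (V x) n) (-n)

/-- The operator `B` is the strong limit of `T_{(V ∧ n) ∨ (-n)}(t)` as `n → ∞`. -/
def IsAbsorptionLimit (T : ℝ≥0 → Lp ℂ 2 μ →L[ℂ] Lp ℂ 2 μ) (V : Ω → ℝ) (t : ℝ≥0)
    (B : Lp ℂ 2 μ →L[ℂ] Lp ℂ 2 μ) : Prop :=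
  ∀ f : Lp ℂ 2 μ,
    Tendsto (fun n : ℕ => boundedPerturbation T (truncation V n) t f) atTop (𝓝 (B f))

/-- Admissibility of a potential of one sign: the strong limits `T_V(t)` exist for all `t ≥ 0`
and form a `C₀`-semigroup. -/
def IsAdmissibleOneSigned (T : ℝ≥0 → Lp ℂ 2 μ →L[ℂ] Lp ℂ 2 μ) (V : Ω → ℝ) : Prop :=
  ∃ S : ℝ≥0 → Lp ℂ 2 μ →L[ℂ] Lp ℂ 2 μ,
    IsC0Semigroup S ∧ ∀ t : ℝ≥0, IsAbsorptionLimit T V t (S t)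

/-- The measurable function `V` is `T`-admissible: `V⁺` and `-V⁻` are `T`-admissible. -/
def IsAdmissible (T : ℝ≥0 → Lp ℂ 2 μ →L[ℂ] Lp ℂ 2 μ) (V : Ω → ℝ) : Prop :=
  IsAdmissibleOneSigned T (fun x => max (V x) 0) ∧
    IsAdmissibleOneSigned T (fun x => -max (-V x) 0)

open Classical in
/-- The operators `T_V(t)`, the strong limits of `T_{(V ∧ n) ∨ (-n)}(t)` as `n → ∞`. (The limits
exist for every `T`-admissible `V`; where there is no limit the value is `0`.) -/
def absorptionSemigroup (T : ℝ≥0 → Lp ℂ 2 μ →L[ℂ] Lp ℂ 2 μ) (V : Ω → ℝ) (t : ℝ≥0) :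
    Lp ℂ 2 μ →L[ℂ] Lp ℂ 2 μ :=
  if h : ∃ B, IsAbsorptionLimit T V t B then h.choose else 0

/-- The weighted norm `‖w⁻¹ A w‖_{q → r}` in `[0, ∞]`: the supremum of `‖w⁻¹ A (w f)‖_r` over all
`f ∈ L_q(μ)` with `‖f‖_q ≤ 1` and `w f ∈ L₂(μ)`. -/
def weightedOpNorm (A : Lp ℂ 2 μ →L[ℂ] Lp ℂ 2 μ) (w : Ω → ℝ) (q r : ℝ≥0∞) : ℝ≥0∞ :=
  ⨆ (f : Ω → ℂ) (_ : MemLp f q μ) (_ : eLpNorm f q μ ≤ 1)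
    (hw : MemLp (fun x => (w x : ℂ) * f x) 2 μ),
    eLpNorm (fun x => (w x : ℂ)⁻¹ * A (hw.toLp (fun x => (w x : ℂ) * f x)) x) r μ

end Potentials

end

noncomputable section

/-! ### Growth, density of the domain, and uniqueness of a semigroup with given generator -/

section SemigroupTheory

variable {X : Type*} [NormedAddCommGroup X] [NormedSpace ℂ X] {T S : ℝ≥0 → X →L[ℂ] X}

/-! Put θ = 1/p and write ‖g‖_q for the L_q norm of ρ^(-α) g. The core is a pointwise Hölder
inequality. Since V = θ (pV) + (1 - θ) 0, the symmetric Trotter formula gives T_V(t) g ≤ (T_{pV}(t)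
u)^θ (T(t) v)^(1-θ) whenever g, u, v ≥ 0 and g ≤ u^θ v^(1-θ) (`absorption_geomMean`). Positive
operators preserve such inequalities because a geometric mean is an infimum of positive linear
combinations of its two entries (`le_geom_mean_iff`), and multiplication by exp(-sV) preserves them
by linearity in the exponent.

Take for u and v suitable powers of g / ρ^α. The weighted 1→1 bound for T_V, a weighted 2→2 bound
for T_{pV} and the weighted 1→∞ bound for T then combine, with σ = θ/(2-θ) < 1, to ‖T_V(t) g‖₂² ≤ (c
M t^(-ν) e^(2α²t) ‖g‖₁²)^(1-σ) (e^(2α²t) ‖g‖₂²)^σ (`weightedNorm_two_interpolation`). Replacing g by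
T_V(t) g bounds the weighted L₂ norm at time 2t by a power σ < 1 of the one at time t. After
rescaling by t^ν e^(-2α²t) this inequality closes up (`le_rpow_of_doubling`) and gives a 1→2 bound
with a constant independent of α. Self-adjointness and the same bound with -α in place of α turn it
into the 1→∞ bound (`weightedNorm_one_top_le`).

The missing ingredient is the weighted estimate ‖T_{pV}(t) g‖₂ ≤ e^(α²t) ‖g‖₂, where only the
unweighted contraction property is assumed. It comes from a Phragmén–Lindelöf argument
(`norm_inner_twisted_le`). A self-adjoint contraction semigroup extends to a contractive holomorphic
family on the right half-plane; once its twisted matrix coefficients are at most a power of 1/t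
times e^(α²t) for small t, the inversion s = 1/t turns that power into polynomial growth at
infinity, and the constant and the power both disappear. This is applied to the bounded truncations,
where the crude bound follows from that of T, and, after passing to the limit, once more to T_{pV}
itself to remove a factor e^(ωt).

Admissibility of V and existence of the limits rest on order: T_W decreases as W increases, monotone
families of nonnegative functions dominated in L₂ converge, and a limit squeezed between two
C₀-semigroups is strongly continuous. -/

theorem tendsto_coe_nhdsGT_zero :
    Tendsto (fun t : ℝ≥0 => (t : ℝ)) (𝓝[>] 0) (𝓝[>] 0) := by
  refine tendsto_nhdsWithin_iff.2 ⟨?_, ?_⟩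
  · exact (NNReal.continuous_coe.tendsto' 0 0 rfl).mono_left nhdsWithin_le_nhds
  · filter_upwards [self_mem_nhdsWithin] with t ht
    exact NNReal.coe_pos.2 ht

theorem complex_inv_smul (t : ℝ≥0) (x : X) : ((t : ℝ) : ℂ)⁻¹ • x = (t : ℝ)⁻¹ • x := by
  rw [← Complex.ofReal_inv, Complex.coe_smul]

namespace IsC0Semigroup

theorem exists_bound_Icc [CompleteSpace X] (hT : IsC0Semigroup T) (τ : ℝ≥0) :
    ∃ C : ℝ, 1 ≤ C ∧ ∀ t ≤ τ, ‖T t‖ ≤ C := by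
  obtain ⟨C, hC⟩ := banach_steinhaus (g := fun t : Set.Icc (0 : ℝ≥0) τ => T t) (by
    intro x
    obtain ⟨C, hC⟩ := (isCompact_Icc (a := (0 : ℝ≥0)) (b := τ)).exists_bound_of_continuousOn
      (hT.strongly_continuous x).continuousOn
    exact ⟨C, fun t => hC t t.2⟩)
  exact ⟨max C 1, le_max_right _ _, fun t ht => (hC ⟨t, zero_le, ht⟩).trans (le_max_left _ _)⟩

theorem continuous_uncurry [CompleteSpace X] (hT : IsC0Semigroup T) :
    Continuous fun p : ℝ≥0 × X => T p.1 p.2 := by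
  rw [continuous_iff_continuousAt]
  rintro ⟨t₀, x₀⟩
  obtain ⟨C, hC1, hC⟩ := hT.exists_bound_Icc (t₀ + 1)
  rw [ContinuousAt, tendsto_iff_norm_sub_tendsto_zero]
  have h1 : Tendsto (fun p : ℝ≥0 × X => C * ‖p.2 - x₀‖ + ‖T p.1 x₀ - T t₀ x₀‖)
      (𝓝 (t₀, x₀)) (𝓝 0) := by
    have : Continuous fun p : ℝ≥0 × X => C * ‖p.2 - x₀‖ + ‖T p.1 x₀ - T t₀ x₀‖ := by
      have := (hT.strongly_continuous x₀).comp (continuous_fst (X := ℝ≥0) (Y := X))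
      simp only [Function.comp_def] at this
      exact (continuous_const.mul (continuous_snd.sub continuous_const).norm).add
        (this.sub continuous_const).norm
    exact this.tendsto' _ _ (by simp)
  refine squeeze_zero' (Eventually.of_forall fun _ => norm_nonneg _) ?_ h1
  have h2 : ∀ᶠ p : ℝ≥0 × X in 𝓝 (t₀, x₀), p.1 < t₀ + 1 :=
    (continuous_fst.tendsto (t₀, x₀)).eventually (gt_mem_nhds (by simp))
  filter_upwards [h2] with p hp
  calc ‖T p.1 p.2 - T t₀ x₀‖ = ‖T p.1 (p.2 - x₀) + (T p.1 x₀ - T t₀ x₀)‖ := by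
        rw [map_sub]; congr 1; abel
    _ ≤ _ := (norm_add_le _ _).trans
        (add_le_add_left (((T p.1).le_opNorm _).trans
          (mul_le_mul_of_nonneg_right (hC _ hp.le) (norm_nonneg _))) _)

theorem exists_exponential_bound [CompleteSpace X] (hT : IsC0Semigroup T) :
    ∃ C ω : ℝ, 1 ≤ C ∧ 0 ≤ ω ∧ ∀ t : ℝ≥0, ‖T t‖ ≤ C * Real.exp (ω * t) := by
  obtain ⟨C, hC1, hC⟩ := hT.exists_bound_Icc 1
  have h0 : 0 < C := by linarith
  -- With C a bound on [0, 1], the semigroup law gives ‖T t‖ ≤ C · C^⌊t⌋, and C^⌊t⌋ ≤ exp (t log C)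
  -- because C ≥ 1.
  refine ⟨C, Real.log C, hC1, Real.log_nonneg hC1, fun t => ?_⟩
  have key : ∀ n : ℕ, ∀ t : ℝ≥0, t ≤ n + 1 → ‖T t‖ ≤ C * C ^ n := by
    intro n
    induction n with
    | zero => intro t ht; simpa using hC t (by simpa using ht)
    | succ n ih =>
      intro t ht
      rcases le_total t 1 with h | h
      · refine (hC t h).trans (le_mul_of_one_le_right h0.le (one_le_pow₀ hC1))
      · have e : t = 1 + (t - 1) := (add_tsub_cancel_of_le h).symm
        have hle : t - 1 ≤ n + 1 := by
          rw [tsub_le_iff_right]; simpa using ht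
        rw [e, hT.map_add, pow_succ']
        calc _ ≤ ‖T 1‖ * ‖T (t - 1)‖ := ContinuousLinearMap.opNorm_comp_le _ _
          _ ≤ C * (C * C ^ n) := mul_le_mul (hC 1 le_rfl) (ih _ hle) (norm_nonneg _) h0.le
  refine (key ⌊t⌋₊ t (Nat.lt_floor_add_one t).le).trans ?_
  refine mul_le_mul_of_nonneg_left ?_ h0.le
  rw [← Real.rpow_natCast, Real.rpow_def_of_pos h0]
  refine Real.exp_le_exp.2 (mul_le_mul_of_nonneg_left ?_ (Real.log_nonneg hC1))
  exact_mod_cast Nat.floor_le (zero_le (a := t))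

theorem map_add_apply (hT : IsC0Semigroup T) (s t : ℝ≥0) (f : X) : T (s + t) f = T s (T t f) := by
  rw [hT.map_add]; rfl

theorem map_nsmul_eq_pow (hT : IsC0Semigroup T) (n : ℕ) (t : ℝ≥0) : T (n * t) = T t ^ n := by
  induction n with
  | zero => simp [hT.map_zero]; rfl
  | succ n ih =>
    rw [Nat.cast_succ, add_mul, one_mul, hT.map_add, ih, pow_succ]; rfl

theorem inGeneratorGraph_apply (hT : IsC0Semigroup T) {f g : X} (h : InGeneratorGraph T f g)
    (s : ℝ≥0) : InGeneratorGraph T (T s f) (T s g) := by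
  have := ((T s).continuous.tendsto g).comp h
  refine this.congr fun t => ?_
  simp only [Function.comp_apply, map_smul, map_sub]
  rw [← hT.map_add_apply, ← hT.map_add_apply, add_comm]

/-- The averages h⁻¹ ∫₀ʰ T(s) f ds lie in the domain of the generator and tend to f as h → 0. -/
theorem exists_inGeneratorGraph_near [CompleteSpace X] (hT : IsC0Semigroup T) (f : X) {ε : ℝ}
    (hε : 0 < ε) : ∃ f' g', InGeneratorGraph T f' g' ∧ ‖f' - f‖ < ε := by
  set u : ℝ → X := fun s => T s.toNNReal f with hu
  have huc : Continuous u := (hT.strongly_continuous f).comp continuous_real_toNNReal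
  set U : ℝ → X := fun x => ∫ s in (0 : ℝ)..x, u s with hU
  have hd : ∀ x, HasDerivAt U (u x) x := fun x =>
    intervalIntegral.integral_hasDerivAt_right (huc.intervalIntegrable _ _)
      (huc.stronglyMeasurableAtFilter _ _) huc.continuousAt
  have hslope : ∀ x, Tendsto (fun t : ℝ≥0 => (t : ℝ)⁻¹ • (U (x + t) - U x)) (𝓝[>] 0)
      (𝓝 (u x)) := fun x =>
    ((hasDerivAt_iff_tendsto_slope_zero.1 (hd x)).mono_left
      (nhdsWithin_mono _ fun y hy => ne_of_gt hy)).comp tendsto_coe_nhdsGT_zero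
  have hU0 : U 0 = 0 := by simp [hU]
  have hu0 : u 0 = f := by simp [hu, hT.map_zero]
  have hshift : ∀ r h : ℝ≥0, T r (U h) = U (h + r) - U r := by
    intro r h
    rw [hU]
    simp only
    rw [← ContinuousLinearMap.intervalIntegral_comp_comm _ (huc.intervalIntegrable _ _),
      intervalIntegral.integral_interval_sub_left (huc.intervalIntegrable _ _)
        (huc.intervalIntegrable _ _)]
    have : ∀ s ∈ Set.uIcc (0 : ℝ) (h : ℝ), T r (u s) = u (s + r) := by
      intro s hs
      rw [Set.uIcc_of_le h.coe_nonneg] at hs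
      simp only [hu]
      rw [Real.toNNReal_add hs.1 r.coe_nonneg, Real.toNNReal_coe, add_comm, hT.map_add_apply]
    rw [intervalIntegral.integral_congr this, intervalIntegral.integral_comp_add_right]
    simp
  have hnear : Tendsto (fun t : ℝ≥0 => (t : ℝ)⁻¹ • U t) (𝓝[>] 0) (𝓝 f) := by
    simpa [hU0, hu0] using hslope 0
  obtain ⟨h, hh1, hh2⟩ := ((Metric.tendsto_nhds.1 hnear ε hε).and self_mem_nhdsWithin).exists
  refine ⟨(h : ℝ)⁻¹ • U h, (h : ℝ)⁻¹ • (u h - u 0), ?_, by simpa [dist_eq_norm] using hh1⟩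
  have := ((hslope h).sub (hslope 0)).const_smul ((h : ℝ)⁻¹)
  refine this.congr fun t => ?_
  rw [complex_inv_smul, hU0]
  have e : T t ((h : ℝ)⁻¹ • U h) = (h : ℝ)⁻¹ • T t (U h) := by
    rw [← Complex.coe_smul, map_smul, Complex.coe_smul]
  rw [e, hshift, zero_add, sub_zero, ← smul_sub, ← smul_sub, smul_comm]
  congr 2
  abel

/-- For f in the domain, the path s ↦ S(t - s) T(s) f joins S(t) f to T(t) f and has derivative
zero. Density of the domain does the rest, so one inclusion of generators already forces equality.
-/
theorem eq_of_inGeneratorGraph [CompleteSpace X] (hT : IsC0Semigroup T) (hS : IsC0Semigroup S)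
    (h : ∀ f g, InGeneratorGraph T f g → InGeneratorGraph S f g) : T = S := by
  funext t
  have hdom : ∀ f g, InGeneratorGraph T f g → T t f = S t f := by
    intro f g hfg
    set φ : ℝ → X := fun s => S ((t : ℝ) - s).toNNReal (T s.toNNReal f) with hφ
    have hφc : Continuous φ := by
      have h1 : Continuous fun s : ℝ => (((t : ℝ) - s).toNNReal, T s.toNNReal f) := by
        have := (hT.strongly_continuous f).comp continuous_real_toNNReal
        simp only [Function.comp_def] at this
        refine Continuous.prodMk ?_ this
        exact continuous_real_toNNReal.comp (by fun_prop)
      exact hS.continuous_uncurry.comp h1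
    -- The generator is a one-sided limit, so only right derivatives are at hand; for a continuous
    -- path they suffice.
    have := constant_of_has_deriv_right_zero (f := φ) (a := 0) (b := t) hφc.continuousOn ?_ t
      ⟨t.2, le_rfl⟩
    · simpa [hφ, hT.map_zero, hS.map_zero] using this
    · intro s hs
      lift s to ℝ≥0 using hs.1
      have hst : s < t := by exact_mod_cast hs.2
      rw [← hasDerivWithinAt_Ioi_iff_Ici, hasDerivWithinAt_iff_tendsto_slope' (by simp)]
      have hcoe : Tendsto (fun y : ℝ => (y - s).toNNReal) (𝓝[>] (s : ℝ)) (𝓝[>] 0) := by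
        refine tendsto_nhdsWithin_iff.2 ⟨?_, ?_⟩
        · have : Continuous fun y : ℝ => (y - s).toNNReal :=
            continuous_real_toNNReal.comp (by fun_prop)
          exact (this.tendsto' (s : ℝ) 0 (by simp)).mono_left nhdsWithin_le_nhds
        · filter_upwards [self_mem_nhdsWithin] with y hy
          exact Real.toNNReal_pos.2 (sub_pos.2 hy)
      have hy := hT.inGeneratorGraph_apply hfg s
      have hlim := ((hy.comp hcoe).sub ((h _ _ hy).comp hcoe))
      rw [sub_self] at hlim
      have hc : Tendsto (fun y : ℝ => ((t : ℝ) - y).toNNReal) (𝓝[>] (s : ℝ))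
          (𝓝 ((t : ℝ) - s).toNNReal) := by
        have : Continuous fun y : ℝ => ((t : ℝ) - y).toNNReal :=
          continuous_real_toNNReal.comp (by fun_prop)
        exact (this.tendsto _).mono_left nhdsWithin_le_nhds
      have h2 := ((hS.continuous_uncurry.tendsto' (((t : ℝ) - s).toNNReal, 0) 0
        (_root_.map_zero (S _))).comp (hc.prodMk_nhds hlim))
      refine h2.congr' ?_
      filter_upwards [Ioo_mem_nhdsGT hs.2] with y hy
      simp only [Function.comp_apply]
      rw [slope_def_module, complex_inv_smul, complex_inv_smul,
        Real.coe_toNNReal _ (sub_nonneg.2 hy.1.le), ← smul_sub, sub_sub_sub_cancel_right,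
        ← Complex.coe_smul, map_smul, Complex.coe_smul, map_sub, hφ]
      simp only
      rw [← hT.map_add_apply, ← hS.map_add_apply, Real.toNNReal_coe,
        ← Real.toNNReal_add (sub_nonneg.2 hy.2.le) (sub_nonneg.2 hy.1.le)]
      congr 4
      · rw [← Real.toNNReal_coe (r := s), ← Real.toNNReal_add (by simpa using sub_nonneg.2 hy.1.le)
          s.coe_nonneg]
        simp
      · simp
  ext f
  refine eq_of_forall_dist_le fun ε hε => ?_
  obtain ⟨f', g', hfg, hf⟩ := hT.exists_inGeneratorGraph_near f
    (show 0 < ε / (‖T t‖ + ‖S t‖ + 1) by positivity)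
  have e : T t f - S t f = S t (f' - f) - T t (f' - f) := by
    rw [map_sub, map_sub, hdom f' g' hfg]; abel
  rw [dist_eq_norm, e]
  rw [lt_div_iff₀ (by positivity)] at hf
  calc _ ≤ ‖S t (f' - f)‖ + ‖T t (f' - f)‖ := norm_sub_le _ _
    _ ≤ ‖S t‖ * ‖f' - f‖ + ‖T t‖ * ‖f' - f‖ :=
      add_le_add ((S t).le_opNorm _) ((T t).le_opNorm _)
    _ ≤ _ := by nlinarith [norm_nonneg (f' - f)]

end IsC0Semigroup
end SemigroupTheory

/-! ### Bounded perturbations by Duhamel's formula, and Chernoff's product formula -/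

section SemigroupTheory
open scoped BoundedContinuousFunction

variable {X : Type*} [NormedAddCommGroup X] [NormedSpace ℂ X] [CompleteSpace X]
  {T S : ℝ≥0 → X →L[ℂ] X}

namespace IsC0Semigroup

theorem continuous_duhamel_integrand (hT : IsC0Semigroup T) (B : X →L[ℂ] X) {v : ℝ≥0 → X}
    (hv : Continuous v) :
    Continuous fun p : ℝ × ℝ => T (p.1 - p.2).toNNReal (B (v p.2.toNNReal)) := by
  have h1 : Continuous fun p : ℝ × ℝ => ((p.1 - p.2).toNNReal, B (v p.2.toNNReal)) :=
    (continuous_real_toNNReal.comp (by fun_prop)).prodMk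
      (B.continuous.comp (hv.comp (continuous_real_toNNReal.comp continuous_snd)))
  exact hT.continuous_uncurry.comp h1

omit [CompleteSpace X] in
-- The decay of T makes ∫₀ᵗ exp(κ(s - t)) ds ≤ 1/κ uniform in t, so the Duhamel integral acts on
-- bounded functions on the whole half-line, with norm at most C‖B‖/κ.
theorem norm_duhamel_le {C κ : ℝ} (hC : 0 ≤ C) (hκ : 0 < κ)
    (hd : ∀ t : ℝ≥0, ‖T t‖ ≤ C * Real.exp (-(κ * t))) (B : X →L[ℂ] X) {v : ℝ≥0 → X} {K : ℝ}
    (hv : ∀ t, ‖v t‖ ≤ K) (t : ℝ≥0) :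
    ‖∫ s in (0 : ℝ)..t, T ((t : ℝ) - s).toNNReal (B (v s.toNNReal))‖ ≤ C * ‖B‖ / κ * K := by
  have hK : 0 ≤ K := (norm_nonneg _).trans (hv 0)
  have h1 : ∀ s ∈ Set.Ioc (0 : ℝ) t, ‖T ((t : ℝ) - s).toNNReal (B (v s.toNNReal))‖ ≤
      C * ‖B‖ * K * Real.exp (κ * (s - t)) := by
    intro s hs
    calc _ ≤ ‖T ((t : ℝ) - s).toNNReal‖ * (‖B‖ * ‖v s.toNNReal‖) :=
          ((T _).le_opNorm _).trans (mul_le_mul_of_nonneg_left (B.le_opNorm _) (norm_nonneg _))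
      _ ≤ (C * Real.exp (-(κ * (t - s)))) * (‖B‖ * K) := by
          refine mul_le_mul ?_ (mul_le_mul_of_nonneg_left (hv _) (norm_nonneg _))
            (by positivity) (by positivity)
          have := hd ((t : ℝ) - s).toNNReal
          rwa [Real.coe_toNNReal _ (sub_nonneg.2 hs.2)] at this
      _ = _ := by
          rw [show -(κ * (t - s)) = κ * (s - t) by ring]; ring
  have hi : IntervalIntegrable (fun s : ℝ => C * ‖B‖ * K * Real.exp (κ * (s - t))) volume 0 t :=
    Continuous.intervalIntegrable (by fun_prop) _ _
  refine (intervalIntegral.norm_integral_le_of_norm_le t.coe_nonneg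
    (Eventually.of_forall h1) hi).trans ?_
  have hder : ∀ s ∈ Set.uIcc (0 : ℝ) (t : ℝ), HasDerivAt
      (fun s : ℝ => C * ‖B‖ * K / κ * Real.exp (κ * (s - t)))
      (C * ‖B‖ * K * Real.exp (κ * (s - t))) s := by
    intro s _
    have h2 : HasDerivAt (fun s : ℝ => κ * (s - t)) κ s := by
      simpa using ((hasDerivAt_id s).sub_const (t : ℝ)).const_mul κ
    have := (h2.exp).const_mul (C * ‖B‖ * K / κ)
    rwa [show C * ‖B‖ * K / κ * (Real.exp (κ * (s - t)) * κ) =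
      C * ‖B‖ * K * Real.exp (κ * (s - t)) by field_simp] at this
  rw [intervalIntegral.integral_eq_sub_of_hasDerivAt hder hi]
  have : 0 ≤ C * ‖B‖ * K / κ * Real.exp (κ * (0 - t)) := by positivity
  simp only [sub_self, mul_zero, Real.exp_zero, mul_one]
  calc _ ≤ C * ‖B‖ * K / κ := by linarith
    _ = _ := by ring

/-- The Duhamel operator `v ↦ ∫₀ᵗ T (t - s) B v(s) ds` on bounded continuous functions. -/
def duhamel (hT : IsC0Semigroup T) {C κ : ℝ} (hC : 0 ≤ C) (hκ : 0 < κ)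
    (hd : ∀ t : ℝ≥0, ‖T t‖ ≤ C * Real.exp (-(κ * t))) (B : X →L[ℂ] X) :
    (ℝ≥0 →ᵇ X) →L[ℂ] (ℝ≥0 →ᵇ X) :=
  LinearMap.mkContinuous
    { toFun := fun v => BoundedContinuousFunction.ofNormedAddCommGroup
        (fun t : ℝ≥0 => ∫ s in (0 : ℝ)..t, T ((t : ℝ) - s).toNNReal (B (v s.toNNReal)))
        ((intervalIntegral.continuous_parametric_intervalIntegral_of_continuous
          (f := fun t s : ℝ => T (t - s).toNNReal (B (v s.toNNReal)))
          (hT.continuous_duhamel_integrand B v.continuous) continuous_id).comp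
          NNReal.continuous_coe)
        (C * ‖B‖ / κ * ‖v‖) (norm_duhamel_le hC hκ hd B v.norm_coe_le_norm)
      map_add' := by
        intro v w
        ext t
        have hi : ∀ v : ℝ≥0 →ᵇ X, IntervalIntegrable
            (fun s : ℝ => T ((t : ℝ) - s).toNNReal (B (v s.toNNReal))) volume 0 t := fun v =>
          ((hT.continuous_duhamel_integrand B v.continuous).comp
            (continuous_const.prodMk continuous_id)).intervalIntegrable _ _
        simp [intervalIntegral.integral_add (hi v) (hi w)]
        rfl
      map_smul' := by
        intro c v
        ext t
        simp [intervalIntegral.integral_smul]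
        rfl }
    (C * ‖B‖ / κ) fun v =>
      BoundedContinuousFunction.norm_ofNormedAddCommGroup_le _
        (by positivity) (norm_duhamel_le hC hκ hd B v.norm_coe_le_norm)

/-- The orbit map `f ↦ T (·) f` of a bounded semigroup. -/
def orbit (hT : IsC0Semigroup T) {C : ℝ} (hC : ∀ t, ‖T t‖ ≤ C) : X →L[ℂ] (ℝ≥0 →ᵇ X) :=
  LinearMap.mkContinuous
    { toFun := fun f => BoundedContinuousFunction.ofNormedAddCommGroup (fun t : ℝ≥0 => T t f)
        (hT.strongly_continuous f) (C * ‖f‖) fun t => (T t).le_of_opNorm_le (hC t) f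
      map_add' := by intro f g; ext t; simp
      map_smul' := by intro c f; ext t; simp }
    C fun f => BoundedContinuousFunction.norm_ofNormedAddCommGroup_le _
      (mul_nonneg ((norm_nonneg _).trans (hC 0)) (norm_nonneg _))
      fun t => (T t).le_of_opNorm_le (hC t) f

theorem tendsto_duhamel_div (hT : IsC0Semigroup T) (B : X →L[ℂ] X) {v : ℝ≥0 → X}
    (hv : Continuous v) :
    Tendsto (fun t : ℝ≥0 => (t : ℝ)⁻¹ •
      ∫ s in (0 : ℝ)..t, T ((t : ℝ) - s).toNNReal (B (v s.toNNReal))) (𝓝[>] 0) (𝓝 (B (v 0))) := by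
  have hc := hT.continuous_duhamel_integrand B hv
  rw [Metric.tendsto_nhdsWithin_nhds]
  intro ε hε
  obtain ⟨δ, hδ, h⟩ := Metric.tendsto_nhds_nhds.1 (hc.tendsto (0, 0)) (ε / 2) (by positivity)
  refine ⟨δ, hδ, fun t ht htδ => ?_⟩
  have ht0 : 0 < (t : ℝ) := NNReal.coe_pos.2 ht
  have htd : (t : ℝ) < δ := by
    simpa [NNReal.dist_eq] using htδ
  have hi : IntervalIntegrable (fun s : ℝ => T ((t : ℝ) - s).toNNReal (B (v s.toNNReal)))
      volume 0 t := (hc.comp (continuous_const.prodMk continuous_id)).intervalIntegrable _ _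
  have e : (t : ℝ)⁻¹ • (∫ s in (0 : ℝ)..t, T ((t : ℝ) - s).toNNReal (B (v s.toNNReal))) - B (v 0)
      = (t : ℝ)⁻¹ • ∫ s in (0 : ℝ)..t, (T ((t : ℝ) - s).toNNReal (B (v s.toNNReal)) - B (v 0)) := by
    rw [intervalIntegral.integral_sub hi (by simp), intervalIntegral.integral_const, smul_sub,
      smul_smul, sub_zero, inv_mul_cancel₀ ht0.ne', one_smul]
  rw [dist_eq_norm, e, norm_smul, norm_inv, Real.norm_of_nonneg ht0.le]
  have h1 := intervalIntegral.norm_integral_le_of_norm_le_const (a := 0) (b := (t : ℝ))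
    (C := ε / 2) (f := fun s => T ((t : ℝ) - s).toNNReal (B (v s.toNNReal)) - B (v 0)) (by
      intro s hs
      rw [Set.uIoc_of_le t.coe_nonneg] at hs
      have := h (x := ((t : ℝ), s)) (by
        rw [Prod.dist_eq, max_lt_iff, dist_zero_right, dist_zero_right,
          Real.norm_of_nonneg ht0.le, Real.norm_of_nonneg hs.1.le]
        exact ⟨htd, hs.2.trans_lt htd⟩)
      rw [dist_eq_norm] at this
      simpa [hT.map_zero] using this.le)
  rw [sub_zero, abs_of_pos ht0] at h1
  calc _ ≤ (t : ℝ)⁻¹ * (ε / 2 * t) := mul_le_mul_of_nonneg_left h1 (by positivity)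
    _ = ε / 2 := by field_simp
    _ < ε := by linarith

/-- The perturbed orbit v of f solves the Volterra equation v + K v = T(·) f, where the Duhamel
operator K has norm less than 1, so 1 + K is invertible. -/
theorem exists_perturbation_of_decay (hT : IsC0Semigroup T) {C κ : ℝ} (hC : 0 ≤ C) (hκ : 0 < κ)
    (hd : ∀ t : ℝ≥0, ‖T t‖ ≤ C * Real.exp (-(κ * t))) (B : X →L[ℂ] X) (hB : C * ‖B‖ / κ < 1) :
    ∃ S : ℝ≥0 → X →L[ℂ] X, IsC0Semigroup S ∧
      ∀ f, Tendsto (fun t : ℝ≥0 => (t : ℝ)⁻¹ • (S t f - T t f)) (𝓝[>] 0) (𝓝 (-B f)) := by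
  have hCb : ∀ t, ‖T t‖ ≤ C := fun t => (hd t).trans
    (mul_le_of_le_one_right hC (Real.exp_le_one_iff.2 (neg_nonpos.2 (by positivity))))
  set K := hT.duhamel hC hκ hd B with hK
  have hKn : ‖-K‖ < 1 := by
    rw [norm_neg]
    exact (LinearMap.mkContinuous_norm_le _ (by positivity) _).trans_lt hB
  obtain ⟨u, hu⟩ := isUnit_one_sub_of_norm_lt_one hKn
  rw [sub_neg_eq_add] at hu
  have hu1 : ∀ w, w + K w = (u : (ℝ≥0 →ᵇ X) →L[ℂ] (ℝ≥0 →ᵇ X)) w := by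
    intro w; rw [hu]; rfl
  set R : (ℝ≥0 →ᵇ X) →L[ℂ] (ℝ≥0 →ᵇ X) := ↑u⁻¹ with hR
  have hRu : ∀ w, R (w + K w) = w := by
    intro w
    rw [hu1, hR, ← mul_apply_eq_comp, Units.inv_mul]; rfl
  have huR : ∀ w, R w + K (R w) = w := by
    intro w
    rw [hu1, hR, ← mul_apply_eq_comp, Units.mul_inv]; rfl
  set E := hT.orbit hCb with hE
  have heq : ∀ f (t : ℝ≥0), R (E f) t +
      ∫ s in (0 : ℝ)..t, T ((t : ℝ) - s).toNNReal (B (R (E f) s.toNNReal)) = T t f := by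
    intro f t
    exact DFunLike.congr_fun (huR (E f)) t
  set S : ℝ≥0 → X →L[ℂ] X := fun t =>
    (BoundedContinuousFunction.evalCLM ℂ t).comp (R.comp E) with hS
  have hSa : ∀ t f, S t f = R (E f) t := fun t f => rfl
  have hS0 : ∀ f, R (E f) 0 = f := by
    intro f
    have := heq f 0
    simpa [hT.map_zero] using this
  refine ⟨S, ⟨?_, ?_, fun f => (R (E f)).continuous⟩, ?_⟩
  · ext f; exact hS0 f
  · intro s t
    ext f
    change R (E f) (s + t) = R (E (R (E f) t)) s
    set v := R (E f) with hv
    set w : ℝ≥0 →ᵇ X := v.compContinuous ⟨fun r => r + t, by fun_prop⟩ with hw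
    have hwa : ∀ r, w r = v (r + t) := fun r => rfl
    -- Semigroup law by uniqueness: the shifted orbit v(· + t) solves the same equation with initial
    -- datum v(t).
    suffices h : w + K w = E (v t) by
      rw [← hwa, ← h, hRu]
    ext r
    change v (r + t) + (∫ s in (0 : ℝ)..r, T ((r : ℝ) - s).toNNReal (B (w s.toNNReal))) = T r (v t)
    have h1 := heq f (r + t)
    have h2 := heq f t
    rw [← hv] at h1 h2
    have hi : ∀ a b c : ℝ, IntervalIntegrable
        (fun s : ℝ => T (a - s).toNNReal (B (v s.toNNReal))) volume b c := fun a b c =>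
      ((hT.continuous_duhamel_integrand B v.continuous).comp
        (continuous_const.prodMk continuous_id)).intervalIntegrable _ _
    have h3 : T r (v t) = T (r + t) f -
        ∫ s in (0 : ℝ)..t, T (((r + t : ℝ≥0) : ℝ) - s).toNNReal (B (v s.toNNReal)) := by
      rw [hT.map_add_apply, ← h2, _root_.map_add, ← ContinuousLinearMap.intervalIntegral_comp_comm _
        (hi _ _ _)]
      rw [eq_sub_iff_add_eq, add_left_cancel_iff]
      refine intervalIntegral.integral_congr fun s hs => ?_
      rw [Set.uIcc_of_le t.coe_nonneg] at hs
      rw [← hT.map_add_apply, NNReal.coe_add, add_sub_assoc,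
        Real.toNNReal_add r.coe_nonneg (sub_nonneg.2 hs.2), Real.toNNReal_coe]
    have h4 : (∫ s in (0 : ℝ)..r, T ((r : ℝ) - s).toNNReal (B (w s.toNNReal))) =
        ∫ s in (t : ℝ)..(r + t : ℝ≥0),
          T (((r + t : ℝ≥0) : ℝ) - s).toNNReal (B (v s.toNNReal)) := by
      have := intervalIntegral.integral_comp_add_right (a := 0) (b := (r : ℝ))
        (fun s : ℝ => T (((r + t : ℝ≥0) : ℝ) - s).toNNReal (B (v s.toNNReal))) (t : ℝ)
      rw [zero_add, ← NNReal.coe_add] at this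
      rw [← this]
      refine intervalIntegral.integral_congr fun s hs => ?_
      rw [Set.uIcc_of_le r.coe_nonneg] at hs
      rw [hwa, Real.toNNReal_add hs.1 t.coe_nonneg, Real.toNNReal_coe, NNReal.coe_add,
        add_sub_add_right_eq_sub]
    rw [h3, h4, ← h1, ← intervalIntegral.integral_add_adjacent_intervals (hi _ 0 t) (hi _ t _)]
    abel
  · intro f
    have := (hT.tendsto_duhamel_div B (R (E f)).continuous).neg
    rw [hS0] at this
    refine this.congr fun t => ?_
    rw [hSa, ← heq f t, ← smul_neg]
    congr 1
    abel

omit [CompleteSpace X] in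
theorem exp_smul (hT : IsC0Semigroup T) (a : ℝ) :
    IsC0Semigroup fun t : ℝ≥0 => ((Real.exp (a * t) : ℝ) : ℂ) • T t where
  map_zero := by simp [hT.map_zero]
  map_add s t := by
    ext f
    simp only [_root_.smul_apply, ContinuousLinearMap.comp_apply, map_smul,
      hT.map_add_apply, smul_smul, NNReal.coe_add, mul_add, Real.exp_add, Complex.ofReal_mul]
    rw [mul_comm]
  strongly_continuous f := by
    have := hT.strongly_continuous f
    simp only [_root_.smul_apply]
    refine Continuous.smul ?_ this
    fun_prop

/-- The difference S - T is differentiable at 0 on every vector, not only on the domain. This form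
is what makes the Trotter steps tangent to S on the whole space. -/
theorem exists_perturbation (hT : IsC0Semigroup T) (B : X →L[ℂ] X) :
    ∃ S : ℝ≥0 → X →L[ℂ] X, IsC0Semigroup S ∧
      ∀ f, Tendsto (fun t : ℝ≥0 => ((t : ℝ) : ℂ)⁻¹ • (S t f - T t f)) (𝓝[>] 0) (𝓝 (-B f)) := by
  simp only [complex_inv_smul]
  obtain ⟨C, ω, hC1, hω, hb⟩ := hT.exists_exponential_bound
  -- After rescaling by exp(-(ω + κ)t) the semigroup decays at rate κ, and this κ gives C‖B‖/κ < 1.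
  -- The rescaling is undone at the end.
  set κ := C * ‖B‖ + 1 with hκ
  have hκ0 : 0 < κ := by positivity
  have hT' := hT.exp_smul (-(ω + κ))
  obtain ⟨S, hS, hlim⟩ := hT'.exists_perturbation_of_decay (C := C) (κ := κ) (by linarith) hκ0 (by
    intro t
    rw [norm_smul, Complex.norm_real, Real.norm_of_nonneg (Real.exp_pos _).le]
    calc _ ≤ Real.exp (-(ω + κ) * t) * (C * Real.exp (ω * t)) :=
          mul_le_mul_of_nonneg_left (hb t) (Real.exp_pos _).le
      _ = C * (Real.exp (-(ω + κ) * t) * Real.exp (ω * t)) := by ring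
      _ = _ := by rw [← Real.exp_add]; congr 2; ring) B
    (by rw [div_lt_one hκ0]; linarith)
  refine ⟨_, hS.exp_smul (ω + κ), fun f => ?_⟩
  have hexp : Tendsto (fun t : ℝ≥0 => ((Real.exp ((ω + κ) * t) : ℝ) : ℂ)) (𝓝[>] 0) (𝓝 1) := by
    have : Continuous fun t : ℝ≥0 => ((Real.exp ((ω + κ) * t) : ℝ) : ℂ) := by fun_prop
    exact (this.tendsto' 0 1 (by simp)).mono_left nhdsWithin_le_nhds
  have := hexp.smul (hlim f)
  rw [one_smul] at this
  refine this.congr fun t => ?_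
  rw [smul_comm, smul_sub]
  congr 1
  simp only [_root_.smul_apply]
  rw [smul_smul, ← Complex.ofReal_mul, ← Real.exp_add]
  congr 1
  rw [show (ω + κ) * (t : ℝ) + -(ω + κ) * t = 0 by ring]
  simp

theorem tendsto_uniformly_on_compact {G : ℕ → X →L[ℂ] X}
    (hG : ∀ x, Tendsto (fun n => G n x) atTop (𝓝 0)) {K : Set X} (hK : IsCompact K) {ε : ℝ}
    (hε : 0 < ε) : ∀ᶠ n in atTop, ∀ x ∈ K, ‖G n x‖ ≤ ε := by
  obtain ⟨C, hC⟩ := banach_steinhaus (g := G) fun x => by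
    obtain ⟨C, hC⟩ := (hG x).norm.bddAbove_range
    exact ⟨C, fun n => hC ⟨n, rfl⟩⟩
  have hC0 : 0 ≤ C := (norm_nonneg _).trans (hC 0)
  obtain ⟨s, -, hs⟩ := hK.elim_nhds_subcover (fun x => Metric.ball x (ε / (2 * (C + 1))))
    fun x _ => Metric.ball_mem_nhds x (by positivity)
  have h1 : ∀ᶠ n in atTop, ∀ x ∈ s, ‖G n x‖ < ε / 2 :=
    (eventually_all_finset s).2 fun x _ => by
      have := (hG x).norm
      rw [norm_zero] at this
      exact this.eventually (gt_mem_nhds (by positivity))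
  filter_upwards [h1] with n hn x hx
  obtain ⟨y, hy, hxy⟩ := Set.mem_iUnion₂.1 (hs hx)
  rw [Metric.mem_ball, dist_eq_norm, lt_div_iff₀ (by positivity)] at hxy
  calc ‖G n x‖ = ‖G n (x - y) + G n y‖ := by rw [map_sub]; congr 1; abel
    _ ≤ C * ‖x - y‖ + ε / 2 := (norm_add_le _ _).trans
        (add_le_add ((G n).le_of_opNorm_le (hC n) _) (hn y hy).le)
    _ ≤ ε := by nlinarith [norm_nonneg (x - y)]

/-- Chernoff's product formula for families that are tangent to the semigroup on all of `X`. -/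
theorem tendsto_pow_of_tangent (hS : IsC0Semigroup S) {F : ℝ≥0 → X →L[ℂ] X} {a : ℝ} (ha : 0 ≤ a)
    (hF0 : F 0 = 1) (hF : ∀ t, ‖F t‖ ≤ Real.exp (a * t))
    (htan : ∀ f, Tendsto (fun t : ℝ≥0 => ((t : ℝ) : ℂ)⁻¹ • (F t f - S t f)) (𝓝[>] 0) (𝓝 0))
    (t : ℝ≥0) (f : X) :
    Tendsto (fun n : ℕ => (F (t / n) ^ n) f) atTop (𝓝 (S t f)) := by
  simp only [complex_inv_smul] at htan
  rcases eq_or_ne t 0 with rfl | ht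
  · simp [hF0, hS.map_zero]
  have ht0 : 0 < t := pos_iff_ne_zero.2 ht
  have hseq : Tendsto (fun n : ℕ => t / (n : ℝ≥0)) atTop (𝓝[>] 0) := by
    refine tendsto_nhdsWithin_iff.2 ⟨?_, ?_⟩
    · rw [← NNReal.tendsto_coe]
      simpa using tendsto_const_div_atTop_nhds_zero_nat (t : ℝ)
    · filter_upwards [eventually_gt_atTop 0] with n hn
      exact div_pos ht0 (by exact_mod_cast hn)
  set G : ℕ → X →L[ℂ] X := fun n => ((t / n : ℝ≥0) : ℝ)⁻¹ • (F (t / n) - S (t / n)) with hG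
  have hGlim : ∀ x, Tendsto (fun n => G n x) atTop (𝓝 0) := fun x => (htan x).comp hseq
  rw [Metric.tendsto_atTop']
  intro ε hε
  -- The tangency error must be small at all intermediate points S(kh) f at once. They lie on a
  -- compact orbit, where strong convergence is uniform.
  have hK : IsCompact ((fun s => S s f) '' Set.Icc 0 t) :=
    isCompact_Icc.image (hS.strongly_continuous f)
  set δ := ε / (2 * (t * Real.exp (a * t))) with hδ
  have ht0' : 0 < (t : ℝ) := NNReal.coe_pos.2 ht0
  have hδ0 : 0 < δ := by positivity
  obtain ⟨N, hN⟩ := eventually_atTop.1 (tendsto_uniformly_on_compact hGlim hK hδ0)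
  refine ⟨N, fun n hn => ?_⟩
  have hn0 : 0 < (n : ℝ) := Nat.cast_pos.2 (Nat.zero_lt_of_lt hn)
  set h := t / (n : ℝ≥0) with hh
  have hh' : (h : ℝ) = t / n := by simp [hh]
  have hh0 : 0 < (h : ℝ) := by rw [hh']; positivity
  have hnh : (n : ℝ) * h = t := by rw [hh']; field_simp
  -- Telescoping: each step adds a tangency error at most hδ and multiplies the previous error by at
  -- most exp(ah).
  have key : ∀ k : ℕ, k ≤ n →
      ‖(F h ^ k) f - S (k * h) f‖ ≤ k * Real.exp (a * (k * h)) * (h * δ) := by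
    intro k
    induction k with
    | zero => intro _; simp [hS.map_zero]
    | succ k ih =>
      intro hk
      have h1 := ih (by lia)
      have hmem : S (k * h) f ∈ (fun s => S s f) '' Set.Icc 0 t := by
        refine ⟨k * h, ⟨zero_le, ?_⟩, rfl⟩
        rw [← NNReal.coe_le_coe, ← hnh]
        push_cast
        exact mul_le_mul_of_nonneg_right (by exact_mod_cast (by lia : k ≤ n)) hh0.le
      have h2 := hN n hn.le _ hmem
      have h3 : ‖F h (S (k * h) f) - S h (S (k * h) f)‖ ≤ h * δ := by
        simp only [hG, _root_.smul_apply, norm_smul, norm_inv,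
          _root_.sub_apply] at h2
        rw [Real.norm_of_nonneg hh0.le, inv_mul_le_iff₀ hh0] at h2
        exact h2
      have e : (F h ^ (k + 1)) f - S ((k + 1 : ℕ) * h) f =
          F h ((F h ^ k) f - S (k * h) f) + (F h (S (k * h) f) - S h (S (k * h) f)) := by
        rw [pow_succ', Nat.cast_succ, add_comm (k : ℝ≥0), add_mul, one_mul, hS.map_add_apply,
          map_sub, mul_apply_eq_comp]
        abel
      rw [e]
      have e2 : Real.exp (a * ((k + 1 : ℕ) * h)) = Real.exp (a * h) * Real.exp (a * (k * h)) := by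
        rw [← Real.exp_add]; congr 1; push_cast; ring
      have h4 : 1 ≤ Real.exp (a * ((k + 1 : ℕ) * h)) := Real.one_le_exp (by positivity)
      calc _ ≤ Real.exp (a * h) * (k * Real.exp (a * (k * h)) * (h * δ)) + h * δ :=
            (norm_add_le _ _).trans (add_le_add (((F h).le_opNorm _).trans
              (mul_le_mul (hF h) h1 (norm_nonneg _) (Real.exp_pos _).le)) h3)
        _ = k * Real.exp (a * ((k + 1 : ℕ) * h)) * (h * δ) + 1 * (h * δ) := by rw [e2]; ring
        _ ≤ k * Real.exp (a * ((k + 1 : ℕ) * h)) * (h * δ) +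
            Real.exp (a * ((k + 1 : ℕ) * h)) * (h * δ) := by gcongr
        _ = _ := by push_cast; ring
  have h5 := key n le_rfl
  have h6 : (n : ℝ≥0) * h = t := by rw [← NNReal.coe_inj]; push_cast; exact hnh
  rw [h6, hnh] at h5
  rw [dist_eq_norm]
  calc _ ≤ _ := h5
    _ = (n * h) * Real.exp (a * t) * δ := by ring
    _ = ε / 2 := by rw [hnh, hδ]; field_simp
    _ < ε := by linarith

end IsC0Semigroup
end SemigroupTheory

/-- Self-adjointness gives ‖T(2ᵏt)‖ = ‖T(t)‖^(2ᵏ), so taking 2ᵏ-th roots removes the constant from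
the exponential bound. Powers of Trotter steps would not be controlled with a constant larger than
1. -/
theorem IsC0Semigroup.exists_norm_le_exp {H : Type*} [NormedAddCommGroup H]
    [InnerProductSpace ℂ H] [CompleteSpace H] {T : ℝ≥0 → H →L[ℂ] H} (hT : IsC0Semigroup T)
    (hsa : ∀ t, IsSelfAdjoint (T t)) : ∃ ω : ℝ, 0 ≤ ω ∧ ∀ t : ℝ≥0, ‖T t‖ ≤ Real.exp (ω * t) := by
  obtain ⟨C, ω, hC, hω, hb⟩ := hT.exists_exponential_bound
  refine ⟨ω, hω, fun t => ?_⟩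
  have h1 : ∀ k : ℕ, (‖T t‖ * Real.exp (-(ω * t))) ^ (2 ^ k) ≤ C := by
    intro k
    have e : ‖T t‖ ^ (2 ^ k) = ‖T ((2 ^ k : ℕ) * t)‖ := by
      rw [hT.map_nsmul_eq_pow]
      have := (hsa t).nnnorm_pow_two_pow k
      simpa using (congrArg NNReal.toReal this).symm
    rw [mul_pow, e, ← Real.exp_nat_mul]
    have := hb ((2 ^ k : ℕ) * t)
    calc _ ≤ C * Real.exp (ω * ((2 ^ k : ℕ) * t : ℝ≥0)) * Real.exp ((2 ^ k : ℕ) * -(ω * t)) :=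
          mul_le_mul_of_nonneg_right this (Real.exp_pos _).le
      _ = C := by
          rw [mul_assoc, ← Real.exp_add]
          push_cast
          rw [show ω * (2 ^ k * (t : ℝ)) + 2 ^ k * -(ω * t) = 0 by ring]; simp
  have h2 : ‖T t‖ * Real.exp (-(ω * t)) ≤ 1 := by
    by_contra! h
    obtain ⟨n, hn⟩ := pow_unbounded_of_one_lt C h
    have := (pow_le_pow_right₀ h.le (Nat.lt_two_pow_self (n := n)).le).trans (h1 n)
    linarith
  rwa [Real.exp_neg, ← div_eq_mul_inv, div_le_one (Real.exp_pos _)] at h2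

/-! ### Multiplication operators and the half steps of the Trotter product -/

section Multiplication

variable {Ω : Type*} [MeasurableSpace Ω] {μ : Measure Ω}

open Classical in
/-- Multiplication by an essentially bounded function on `L₂(μ)` (and `0` for other functions). -/
def mulOp (μ : Measure Ω) (m : Ω → ℂ) : Lp ℂ 2 μ →L[ℂ] Lp ℂ 2 μ :=
  if h : MemLp m ∞ μ then (ContinuousLinearMap.mul ℂ ℂ).holderL μ ∞ 2 2 h.toLp else 0

theorem mulOp_ae {m : Ω → ℂ} (h : MemLp m ∞ μ) (f : Lp ℂ 2 μ) :
    mulOp μ m f =ᵐ[μ] fun x => m x * f x := by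
  rw [mulOp, dif_pos h]
  have h1 := (ContinuousLinearMap.mul ℂ ℂ).coeFn_holder (r := 2) h.toLp f
  rw [ContinuousLinearMap.holderL_apply_apply]
  filter_upwards [h1, h.coeFn_toLp] with x hx1 hx2
  rw [hx1, hx2]; rfl

theorem mulOp_apply_norm_le {m : Ω → ℂ} (hm : AEStronglyMeasurable m μ) {C : ℝ}
    (hC : ∀ x, ‖m x‖ ≤ C) (f : Lp ℂ 2 μ) : ‖mulOp μ m f‖ ≤ C * ‖f‖ := by
  refine Lp.norm_le_mul_norm_of_ae_le_mul ?_
  filter_upwards [mulOp_ae (memLp_top_of_bound hm C (Eventually.of_forall hC)) f] with x hx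
  rw [hx, norm_mul]
  exact mul_le_mul_of_nonneg_right (hC x) (norm_nonneg _)

theorem mulOp_norm_le {m : Ω → ℂ} (hm : AEStronglyMeasurable m μ) {C : ℝ} (h0 : 0 ≤ C)
    (hC : ∀ x, ‖m x‖ ≤ C) : ‖mulOp μ m‖ ≤ C :=
  ContinuousLinearMap.opNorm_le_bound _ h0 (mulOp_apply_norm_le hm hC)

theorem mulOp_const (c : ℂ) : mulOp μ (fun _ => c) = c • (1 : Lp ℂ 2 μ →L[ℂ] Lp ℂ 2 μ) := by
  ext1 f
  apply Lp.ext
  filter_upwards [mulOp_ae (μ := μ) (memLp_top_const c) f, Lp.coeFn_smul c f] with x h1 h2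
  rw [h1]
  exact h2.symm

theorem inner_mulOp_left {m : Ω → ℂ} (hm : MemLp m ∞ μ) (f g : Lp ℂ 2 μ) :
    inner ℂ (mulOp μ m f) g = inner ℂ f (mulOp μ (fun x => star (m x)) g) := by
  rw [L2.inner_def, L2.inner_def]
  have hm' : MemLp (fun x => star (m x)) ∞ μ := hm.star
  refine integral_congr_ae ?_
  filter_upwards [mulOp_ae hm f, mulOp_ae hm' g] with x h1 h2
  rw [h1, h2]
  simp only [RCLike.inner_apply, map_mul]
  simp
  ring

theorem isSelfAdjoint_mulOp_ofReal {m : Ω → ℝ} (hm : MemLp (fun x => (m x : ℂ)) ∞ μ) :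
    IsSelfAdjoint (mulOp μ fun x => (m x : ℂ)) := by
  rw [ContinuousLinearMap.isSelfAdjoint_iff_isSymmetric]
  intro f g
  have := inner_mulOp_left hm f g
  simpa using this

/-- Bounded measurable real functions. -/
structure IsBddMeasurable (V : Ω → ℝ) : Prop where
  measurable : Measurable V
  bounded : ∃ C, 0 ≤ C ∧ ∀ x, |V x| ≤ C

theorem IsBddMeasurable.memLp {V : Ω → ℝ} (h : IsBddMeasurable V) :
    MemLp (fun x => (V x : ℂ)) ∞ μ := by
  obtain ⟨C, -, hC⟩ := h.bounded
  exact memLp_top_of_bound (Complex.measurable_ofReal.comp h.measurable).aestronglyMeasurable C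
    (Eventually.of_forall fun x => by simpa using hC x)

theorem IsBddMeasurable.const_mul {V : Ω → ℝ} (h : IsBddMeasurable V) (a : ℝ) :
    IsBddMeasurable fun x => a * V x := by
  obtain ⟨C, hC0, hC⟩ := h.bounded
  exact ⟨h.measurable.const_mul a, |a| * C, by positivity, fun x => by
    rw [abs_mul]; exact mul_le_mul_of_nonneg_left (hC x) (abs_nonneg a)⟩

theorem IsBddMeasurable.exp {V : Ω → ℝ} (h : IsBddMeasurable V) :
    IsBddMeasurable fun x => Real.exp (V x) := by
  obtain ⟨C, hC0, hC⟩ := h.bounded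
  refine ⟨h.measurable.exp, Real.exp C, (Real.exp_pos _).le, fun x => ?_⟩
  rw [abs_of_pos (Real.exp_pos _)]
  exact Real.exp_le_exp.2 ((le_abs_self _).trans (hC x))

theorem IsBddMeasurable.const (a : ℝ) : IsBddMeasurable fun _ : Ω => a :=
  ⟨measurable_const, |a|, abs_nonneg a, fun _ => le_rfl⟩

/-- Multiplication by `exp (-(t / 2) V)`. -/
def halfStep (μ : Measure Ω) (V : Ω → ℝ) (t : ℝ≥0) : Lp ℂ 2 μ →L[ℂ] Lp ℂ 2 μ :=
  mulOp μ fun x => (Real.exp (-(t / 2) * V x) : ℂ)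

theorem halfStep_ae {V : Ω → ℝ} (hV : IsBddMeasurable V) (t : ℝ≥0) (f : Lp ℂ 2 μ) :
    halfStep μ V t f =ᵐ[μ] fun x => (Real.exp (-(t / 2) * V x) : ℂ) * f x :=
  mulOp_ae (hV.const_mul _).exp.memLp f

theorem norm_halfStep_le {V : Ω → ℝ} (hV : IsBddMeasurable V) {C : ℝ}
    (hC : ∀ x, |V x| ≤ C) (t : ℝ≥0) : ‖halfStep μ V t‖ ≤ Real.exp (C / 2 * t) := by
  refine mulOp_norm_le (Complex.measurable_ofReal.comp
    (hV.const_mul _).exp.measurable).aestronglyMeasurable (Real.exp_pos _).le fun x => ?_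
  rw [Function.comp_apply, Complex.norm_real, Real.norm_of_nonneg (Real.exp_pos _).le]
  refine Real.exp_le_exp.2 ?_
  have := neg_abs_le (V x)
  nlinarith [hC x, t.coe_nonneg]

theorem isSelfAdjoint_halfStep {V : Ω → ℝ} (hV : IsBddMeasurable V) (t : ℝ≥0) :
    IsSelfAdjoint (halfStep μ V t) :=
  isSelfAdjoint_mulOp_ofReal (hV.const_mul _).exp.memLp

theorem halfStep_zero (V : Ω → ℝ) : halfStep μ V 0 = 1 := by
  simp [halfStep, mulOp_const]

/-- The derivative of exp(-(t/2)V) at t = 0 is -V/2, with remainder |eʸ - 1 - y| ≤ y². The vector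
may vary with t because the left half step acts on T(t) applied to the right one. -/
theorem tendsto_halfStep_div {V : Ω → ℝ} (hV : IsBddMeasurable V) {g : ℝ≥0 → Lp ℂ 2 μ}
    {g₀ : Lp ℂ 2 μ} (hg : Tendsto g (𝓝[>] 0) (𝓝 g₀)) :
    Tendsto (fun t : ℝ≥0 => ((t : ℝ) : ℂ)⁻¹ • (halfStep μ V t (g t) - g t)) (𝓝[>] 0)
      (𝓝 (-((1 / 2 : ℂ) • mulOp μ (fun x => (V x : ℂ)) g₀))) := by
  obtain ⟨C, hC0, hC⟩ := hV.bounded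
  have hmain : Tendsto (fun t : ℝ≥0 => -((1 / 2 : ℂ) • mulOp μ (fun x => (V x : ℂ)) (g t)))
      (𝓝[>] 0) (𝓝 (-((1 / 2 : ℂ) • mulOp μ (fun x => (V x : ℂ)) g₀))) :=
    ((((mulOp μ _).continuous.tendsto _).comp hg).const_smul _).neg
  have hbd : Tendsto (fun t : ℝ≥0 => (t : ℝ) * C ^ 2 * ‖g t‖) (𝓝[>] 0) (𝓝 0) := by
    have h1 : Tendsto (fun t : ℝ≥0 => (t : ℝ)) (𝓝[>] 0) (𝓝 0) :=
      tendsto_coe_nhdsGT_zero.mono_right nhdsWithin_le_nhds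
    simpa using (h1.mul_const (C ^ 2)).mul hg.norm
  have hdiff : Tendsto (fun t : ℝ≥0 => ((t : ℝ) : ℂ)⁻¹ • (halfStep μ V t (g t) - g t) -
      -((1 / 2 : ℂ) • mulOp μ (fun x => (V x : ℂ)) (g t))) (𝓝[>] 0) (𝓝 0) := by
    refine squeeze_zero_norm' ?_ hbd
    have hsmall : ∀ᶠ t : ℝ≥0 in 𝓝[>] 0, (t : ℝ) * C < 1 := by
      have h1 : Tendsto (fun t : ℝ≥0 => (t : ℝ) * C) (𝓝[>] 0) (𝓝 (0 * C)) :=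
        (tendsto_coe_nhdsGT_zero.mono_right nhdsWithin_le_nhds).mul_const C
      rw [zero_mul] at h1
      exact h1.eventually (gt_mem_nhds one_pos)
    filter_upwards [hsmall, self_mem_nhdsWithin] with t ht ht0
    have ht0' : 0 < (t : ℝ) := NNReal.coe_pos.2 ht0
    refine Lp.norm_le_mul_norm_of_ae_le_mul ?_
    filter_upwards [Lp.coeFn_sub (((t : ℝ) : ℂ)⁻¹ • (halfStep μ V t (g t) - g t))
      (-((1 / 2 : ℂ) • mulOp μ (fun x => (V x : ℂ)) (g t))),
      Lp.coeFn_smul (((t : ℝ) : ℂ)⁻¹) (halfStep μ V t (g t) - g t),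
      Lp.coeFn_sub (halfStep μ V t (g t)) (g t), halfStep_ae hV t (g t),
      Lp.coeFn_neg ((1 / 2 : ℂ) • mulOp μ (fun x => (V x : ℂ)) (g t)),
      Lp.coeFn_smul (1 / 2 : ℂ) (mulOp μ (fun x => (V x : ℂ)) (g t)),
      mulOp_ae (hV.memLp (μ := μ)) (g t)] with x h1 h2 h3 h4 h5 h6 h7
    rw [h1, Pi.sub_apply, h2, Pi.smul_apply, h3, Pi.sub_apply, h4, h5, Pi.neg_apply, h6,
      Pi.smul_apply, h7]
    set y : ℝ := -(t / 2) * V x with hy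
    have hyle : |y| ≤ t * C := by
      rw [hy, abs_mul, abs_neg, abs_of_pos (by positivity)]
      nlinarith [hC x, abs_nonneg (V x)]
    have e : ((t : ℝ) : ℂ)⁻¹ • ((Real.exp y : ℂ) * (g t) x - (g t) x) -
        -((1 / 2 : ℂ) • ((V x : ℂ) * (g t) x)) =
        ((t : ℝ) : ℂ)⁻¹ • (((Real.exp y - 1 - y : ℝ) : ℂ) * (g t) x) := by
      simp only [smul_eq_mul, hy]
      push_cast
      have : (t : ℂ) ≠ 0 := by
        have := ht0'.ne'
        exact_mod_cast this
      field_simp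
    rw [e, norm_smul, norm_mul, Complex.norm_real, norm_inv, Complex.norm_real, Real.norm_of_nonneg ht0'.le, ← mul_assoc]
    refine mul_le_mul_of_nonneg_right ?_ (norm_nonneg _)
    rw [inv_mul_le_iff₀ ht0']
    have h8 := Real.abs_exp_sub_one_sub_id_le (x := y) (hyle.trans ht.le)
    rw [Real.norm_eq_abs]
    refine h8.trans ?_
    rw [← sq_abs]
    calc |y| ^ 2 ≤ (t * C) ^ 2 := pow_le_pow_left₀ (abs_nonneg _) hyle 2
      _ = _ := by ring
  simpa using hdiff.add hmain

end Multiplication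

/-! ### The symmetric Trotter formula for bounded potentials -/

section Perturbation

variable {Ω : Type*} [MeasurableSpace Ω] {μ : Measure Ω} {T : ℝ≥0 → Lp ℂ 2 μ →L[ℂ] Lp ℂ 2 μ}
  {V : Ω → ℝ}

theorem isBoundedPerturbation_of_tendsto {S : ℝ≥0 → Lp ℂ 2 μ →L[ℂ] Lp ℂ 2 μ}
    (hV : IsBddMeasurable V) (hS : IsC0Semigroup S)
    (h : ∀ f, Tendsto (fun t : ℝ≥0 => ((t : ℝ) : ℂ)⁻¹ • (S t f - T t f)) (𝓝[>] 0)
      (𝓝 (-mulOp μ (fun x => (V x : ℂ)) f))) : IsBoundedPerturbation T V S := by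
  refine ⟨hS, fun f g => ?_⟩
  have hiff : ∀ h g : Lp ℂ 2 μ, (∀ᵐ x ∂μ, g x = h x - (V x : ℂ) * f x) ↔
      g = h - mulOp μ (fun x => (V x : ℂ)) f := by
    intro h g
    rw [Lp.ext_iff]
    refine eventually_congr ?_
    filter_upwards [Lp.coeFn_sub h (mulOp μ (fun x => (V x : ℂ)) f),
      mulOp_ae (hV.memLp (μ := μ)) f] with x h1 h2
    rw [h1, Pi.sub_apply, h2]
  constructor
  · intro hg
    refine ⟨g + mulOp μ (fun x => (V x : ℂ)) f, ?_, (hiff _ _).2 (by simp)⟩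
    have := hg.sub (h f)
    rw [sub_neg_eq_add] at this
    refine this.congr fun t => ?_
    rw [← smul_sub]
    congr 1
    abel
  · rintro ⟨k, hk, hgk⟩
    rw [(hiff _ _).1 hgk]
    have := hk.add (h f)
    rw [← sub_eq_add_neg] at this
    refine this.congr fun t => ?_
    rw [← smul_add]
    congr 1
    abel

/-- The semigroup picked by choice is the Duhamel one, because generators determine semigroups. -/
theorem boundedPerturbation_spec (hT : IsC0Semigroup T) (hV : IsBddMeasurable V) :
    IsC0Semigroup (boundedPerturbation T V) ∧
      ∀ f, Tendsto (fun t : ℝ≥0 => ((t : ℝ) : ℂ)⁻¹ • (boundedPerturbation T V t f - T t f)) (𝓝[>] 0)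
        (𝓝 (-mulOp μ (fun x => (V x : ℂ)) f)) := by
  obtain ⟨S, hS, hlim⟩ := hT.exists_perturbation (mulOp μ fun x => (V x : ℂ))
  have hex := isBoundedPerturbation_of_tendsto hV hS hlim
  have h : ∃ S, IsBoundedPerturbation T V S := ⟨S, hex⟩
  have hc := h.choose_spec
  have e : boundedPerturbation T V = S := by
    rw [boundedPerturbation, dif_pos h]
    exact hc.1.eq_of_inGeneratorGraph hS fun f g hfg => (hex.2 f g).2 ((hc.2 f g).1 hfg)
  rw [e]
  exact ⟨hS, hlim⟩

theorem isC0Semigroup_boundedPerturbation (hT : IsC0Semigroup T) (hV : IsBddMeasurable V) :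
    IsC0Semigroup (boundedPerturbation T V) := (boundedPerturbation_spec hT hV).1

/-- One step of the symmetric Trotter product. -/
def trotterStep (T : ℝ≥0 → Lp ℂ 2 μ →L[ℂ] Lp ℂ 2 μ) (V : Ω → ℝ) (t : ℝ≥0) :
    Lp ℂ 2 μ →L[ℂ] Lp ℂ 2 μ :=
  halfStep μ V t * T t * halfStep μ V t

/-- Chernoff's formula applies since one step has norm at most e^((ω + C)s) and is tangent to the
perturbed semigroup on all of L₂. -/
theorem tendsto_trotter (hT : IsC0Semigroup T) (hsa : ∀ t, IsSelfAdjoint (T t))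
    (hV : IsBddMeasurable V) (t : ℝ≥0) (f : Lp ℂ 2 μ) :
    Tendsto (fun n : ℕ => (trotterStep T V (t / n) ^ n) f) atTop
      (𝓝 (boundedPerturbation T V t f)) := by
  obtain ⟨hS, hlim⟩ := boundedPerturbation_spec hT hV
  obtain ⟨ω, hω, hb⟩ := hT.exists_norm_le_exp hsa
  obtain ⟨C, hC0, hC⟩ := hV.bounded
  refine hS.tendsto_pow_of_tangent (a := ω + C) (by positivity) ?_ ?_ ?_ t f
  · simp [trotterStep, halfStep_zero, hT.map_zero]
    rfl
  · intro s
    have h1 := norm_halfStep_le (μ := μ) hV hC s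
    calc _ ≤ ‖halfStep μ V s‖ * ‖T s‖ * ‖halfStep μ V s‖ :=
          (norm_mul_le _ _).trans (mul_le_mul_of_nonneg_right (norm_mul_le _ _) (norm_nonneg _))
      _ ≤ Real.exp (C / 2 * s) * Real.exp (ω * s) * Real.exp (C / 2 * s) := by
          gcongr
          exact hb s
      _ = _ := by rw [← Real.exp_add, ← Real.exp_add]; congr 1; ring
  · intro g
    have hE : Tendsto (fun s => halfStep μ V s g) (𝓝[>] 0) (𝓝 g) := by
      have h0 : Tendsto (fun t : ℝ≥0 => ((t : ℝ) : ℂ)) (𝓝[>] 0) (𝓝 0) :=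
        (Complex.continuous_ofReal.tendsto' 0 0 (by simp)).comp
          (tendsto_coe_nhdsGT_zero.mono_right nhdsWithin_le_nhds)
      have h1 := h0.smul (tendsto_halfStep_div hV (g := fun _ => g) tendsto_const_nhds)
      have h2 := h1.add_const g
      rw [zero_smul, zero_add] at h2
      refine h2.congr' ?_
      filter_upwards [self_mem_nhdsWithin] with s hs
      rw [smul_inv_smul₀ (Complex.ofReal_ne_zero.2 (NNReal.coe_pos.2 hs).ne')]
      abel
    have hTE : Tendsto (fun s => T s (halfStep μ V s g)) (𝓝[>] 0) (𝓝 g) := by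
      have := (hT.continuous_uncurry.tendsto' (0, g) g (by simp [hT.map_zero])).comp
        ((tendsto_id.mono_left nhdsWithin_le_nhds).prodMk_nhds hE)
      exact this
    have h1 := tendsto_halfStep_div hV hTE
    have h2 : Tendsto (fun s : ℝ≥0 => T s (((s : ℝ) : ℂ)⁻¹ • (halfStep μ V s g - g))) (𝓝[>] 0)
        (𝓝 (-((1 / 2 : ℂ) • mulOp μ (fun x => (V x : ℂ)) g))) := by
      have := (hT.continuous_uncurry.tendsto' (0, -((1 / 2 : ℂ) • mulOp μ (fun x => (V x : ℂ)) g))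
        _ (by rw [hT.map_zero])).comp
        ((tendsto_id.mono_left nhdsWithin_le_nhds).prodMk_nhds
          (tendsto_halfStep_div hV (g := fun _ => g) tendsto_const_nhds))
      exact this
    have h3 := (h1.add h2).sub (hlim g)
    -- To first order the two half steps contribute -V/2 each and the difference of semigroups
    -- contributes -V. The term T(s)g - g cancels, so g need not be in the domain.
    have e0 : -((1 / 2 : ℂ) • mulOp μ (fun x => (V x : ℂ)) g) +
        -((1 / 2 : ℂ) • mulOp μ (fun x => (V x : ℂ)) g) - -mulOp μ (fun x => (V x : ℂ)) g = 0 := by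
      rw [← neg_add, ← add_smul]; norm_num
    rw [e0] at h3
    refine h3.congr fun s => ?_
    rw [map_smul, ← smul_add,
      ← smul_sub, map_sub]
    congr 1
    simp only [trotterStep, mul_apply_eq_comp]
    abel

/-- A closed set of families of vectors that is invariant under the free evolution and under the
multiplication semigroups is invariant under the perturbed evolutions. -/
theorem boundedPerturbation_mem {ι : Type*} (hT : IsC0Semigroup T)
    (hsa : ∀ t, IsSelfAdjoint (T t)) {W : ι → Ω → ℝ} (hW : ∀ i, IsBddMeasurable (W i))
    {K : Set (ι → Lp ℂ 2 μ)} (hK : IsClosed K)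
    (hKT : ∀ t : ℝ≥0, ∀ f ∈ K, (fun i => T t (f i)) ∈ K)
    (hKE : ∀ t : ℝ≥0, ∀ f ∈ K, (fun i => halfStep μ (W i) t (f i)) ∈ K)
    (t : ℝ≥0) {f : ι → Lp ℂ 2 μ} (hf : f ∈ K) :
    (fun i => boundedPerturbation T (W i) t (f i)) ∈ K := by
  refine hK.mem_of_tendsto (tendsto_pi_nhds.2 fun i => tendsto_trotter hT hsa (hW i) t (f i))
    (Eventually.of_forall fun n => ?_)
  have key : ∀ k : ℕ, (fun i => (trotterStep T (W i) (t / n) ^ k) (f i)) ∈ K := by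
    intro k
    induction k with
    | zero => simpa using hf
    | succ k ih =>
      have := hKE (t / n) _ (hKT (t / n) _ (hKE (t / n) _ ih))
      simp only [pow_succ', mul_apply_eq_comp, trotterStep]
      exact this
  exact key n

/-- The symmetric placement of the half steps makes every Trotter product self-adjoint, a property
that survives strong limits. -/
theorem isSelfAdjoint_boundedPerturbation (hT : IsC0Semigroup T)
    (hsa : ∀ t, IsSelfAdjoint (T t)) (hV : IsBddMeasurable V) (t : ℝ≥0) :
    IsSelfAdjoint (boundedPerturbation T V t) := by
  rw [ContinuousLinearMap.isSelfAdjoint_iff_isSymmetric]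
  intro f g
  have hstep : ∀ n : ℕ, IsSelfAdjoint (trotterStep T V (t / n) ^ n) := by
    intro n
    refine IsSelfAdjoint.pow ?_ n
    have hE := isSelfAdjoint_halfStep (μ := μ) hV (t / n)
    have := (hsa (t / n)).conjugate (halfStep μ V (t / n))
    rwa [hE.star_eq] at this
  have h1 := (tendsto_trotter hT hsa hV t f).inner (𝕜 := ℂ) (tendsto_const_nhds (x := g))
  have h2 := (tendsto_const_nhds (x := f)).inner (𝕜 := ℂ) (tendsto_trotter hT hsa hV t g)
  refine tendsto_nhds_unique h1 (h2.congr fun n => ?_)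
  exact ((ContinuousLinearMap.isSelfAdjoint_iff_isSymmetric.1 (hstep n)) f g).symm

end Perturbation

end

noncomputable section

open scoped ComplexOrder

/-! ### Positivity and monotonicity in the potential -/

section Order

variable {Ω : Type*} [MeasurableSpace Ω] {μ : Measure Ω}

theorem Lp_nonneg_iff (f : Lp ℂ 2 μ) : 0 ≤ f ↔ ∀ᵐ x ∂μ, 0 ≤ (f x).re ∧ (f x).im = 0 := by
  rw [← Lp.coeFn_nonneg]
  refine eventually_congr (Eventually.of_forall fun x => ?_)
  rw [Pi.zero_apply, Complex.nonneg_iff, eq_comm (a := (0 : ℝ))]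

theorem Lp_nonneg_iff' (f : Lp ℂ 2 μ) : 0 ≤ f ↔ ∀ᵐ x ∂μ, 0 ≤ f x := (Lp.coeFn_nonneg f).symm

theorem Lp_le_iff (f g : Lp ℂ 2 μ) : f ≤ g ↔ ∀ᵐ x ∂μ, f x ≤ g x := (Lp.coeFn_le f g).symm

theorem isPositiveOperator_iff {A : Lp ℂ 2 μ →L[ℂ] Lp ℂ 2 μ} :
    IsPositiveOperator A ↔ ∀ f, 0 ≤ f → 0 ≤ A f := by
  simp only [IsPositiveOperator, Lp_nonneg_iff]

theorem IsPositiveOperator.map_nonneg {A : Lp ℂ 2 μ →L[ℂ] Lp ℂ 2 μ} (hA : IsPositiveOperator A)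
    {f : Lp ℂ 2 μ} (hf : 0 ≤ f) : 0 ≤ A f := isPositiveOperator_iff.1 hA f hf

theorem IsPositiveOperator.mono {A : Lp ℂ 2 μ →L[ℂ] Lp ℂ 2 μ} (hA : IsPositiveOperator A)
    {f g : Lp ℂ 2 μ} (h : f ≤ g) : A f ≤ A g := by
  have := hA.map_nonneg (sub_nonneg.2 h)
  rwa [map_sub, sub_nonneg] at this

theorem Lp_norm_le_norm {f g : Lp ℂ 2 μ} (hf : 0 ≤ f) (hfg : f ≤ g) : ‖f‖ ≤ ‖g‖ := by
  rw [Lp_nonneg_iff'] at hf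
  rw [Lp_le_iff] at hfg
  refine Lp.norm_le_norm_of_ae_le ?_
  filter_upwards [hf, hfg] with x h1 h2
  exact CStarAlgebra.norm_le_norm_of_nonneg_of_le h1 h2

theorem re_inner_nonneg {f g : Lp ℂ 2 μ} (hf : 0 ≤ f) (hg : 0 ≤ g) :
    0 ≤ (inner ℂ f g).re := by
  rw [L2.inner_def, ← RCLike.re_eq_complex_re, ← integral_re (L2.integrable_inner f g)]
  refine integral_nonneg_of_ae ?_
  filter_upwards [(Lp_nonneg_iff f).1 hf, (Lp_nonneg_iff g).1 hg] with x h1 h2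
  simp [h1.2, h2.2]
  exact mul_nonneg h2.1 h1.1

/-- Expand ‖f + (g - f)‖² and drop the nonnegative cross term. This is what makes dominated monotone
families Cauchy. -/
theorem norm_sub_sq_le {f g : Lp ℂ 2 μ} (hf : 0 ≤ f) (hfg : f ≤ g) :
    ‖g - f‖ ^ 2 ≤ ‖g‖ ^ 2 - ‖f‖ ^ 2 := by
  have h1 := re_inner_nonneg hf (sub_nonneg.2 hfg)
  have h2 := norm_add_sq (𝕜 := ℂ) f (g - f)
  rw [add_sub_cancel] at h2
  rw [h2]
  simp only [RCLike.re_eq_complex_re]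
  linarith

theorem isPositiveOperator_halfStep {V : Ω → ℝ} (hV : IsBddMeasurable V) (t : ℝ≥0) :
    IsPositiveOperator (halfStep μ V t) := by
  rw [isPositiveOperator_iff]
  intro f hf
  rw [Lp_nonneg_iff'] at hf ⊢
  filter_upwards [hf, halfStep_ae hV t f] with x h1 h2
  rw [h2]
  exact mul_nonneg (by exact_mod_cast (Real.exp_pos _).le) h1

theorem halfStep_anti {V W : Ω → ℝ} (hV : IsBddMeasurable V) (hW : IsBddMeasurable W)
    (hVW : ∀ x, V x ≤ W x) (t : ℝ≥0) {f : Lp ℂ 2 μ} (hf : 0 ≤ f) :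
    halfStep μ W t f ≤ halfStep μ V t f := by
  rw [Lp_le_iff]
  filter_upwards [(Lp_nonneg_iff' f).1 hf, halfStep_ae hV t f, halfStep_ae hW t f] with x h1 h2 h3
  rw [h2, h3]
  refine mul_le_mul_of_nonneg_right ?_ h1
  have : Real.exp (-(t / 2) * W x) ≤ Real.exp (-(t / 2) * V x) := by
    refine Real.exp_le_exp.2 ?_
    have := hVW x
    nlinarith [t.coe_nonneg]
  exact_mod_cast this

theorem isClosed_setOf_Lp_le {ι : Type*} (i j : ι) :
    IsClosed {f : ι → Lp ℂ 2 μ | f i ≤ f j} :=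
  isClosed_le (α := Lp ℂ 2 μ) (continuous_apply i) (continuous_apply j)

theorem isClosed_setOf_Lp_nonneg {ι : Type*} (i : ι) :
    IsClosed {f : ι → Lp ℂ 2 μ | 0 ≤ f i} :=
  isClosed_le (α := Lp ℂ 2 μ) continuous_const (continuous_apply i)

/-- A positive self-adjoint `C₀`-semigroup on `L₂(μ)`. -/
structure IsPositiveSymmetricSemigroup (T : ℝ≥0 → Lp ℂ 2 μ →L[ℂ] Lp ℂ 2 μ) : Prop where
  isC0 : IsC0Semigroup T
  pos : ∀ t, IsPositiveOperator (T t)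
  sa : ∀ t, IsSelfAdjoint (T t)

variable {T : ℝ≥0 → Lp ℂ 2 μ →L[ℂ] Lp ℂ 2 μ} {V W : Ω → ℝ}

theorem IsPositiveSymmetricSemigroup.boundedPerturbation (hT : IsPositiveSymmetricSemigroup T)
    (hV : IsBddMeasurable V) : IsPositiveSymmetricSemigroup (boundedPerturbation T V) where
  isC0 := isC0Semigroup_boundedPerturbation hT.isC0 hV
  sa := isSelfAdjoint_boundedPerturbation hT.isC0 hT.sa hV
  pos t := by
    rw [isPositiveOperator_iff]
    intro f hf
    have hK : IsClosed {f : Unit → Lp ℂ 2 μ | 0 ≤ f ()} :=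
      isClosed_setOf_Lp_nonneg ()
    exact boundedPerturbation_mem hT.isC0 hT.sa (W := fun _ : Unit => V) (fun _ => hV) hK
      (fun t f hf => (hT.pos t).map_nonneg hf)
      (fun t f hf => (isPositiveOperator_halfStep hV t).map_nonneg hf) t (f := fun _ => f) hf

theorem boundedPerturbation_anti (hT : IsPositiveSymmetricSemigroup T)
    (hV : IsBddMeasurable V) (hW : IsBddMeasurable W) (hVW : ∀ x, V x ≤ W x) (t : ℝ≥0)
    {f : Lp ℂ 2 μ} (hf : 0 ≤ f) :
    boundedPerturbation T W t f ≤ boundedPerturbation T V t f := by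
  have hK : IsClosed {f : Bool → Lp ℂ 2 μ | 0 ≤ f true ∧ f true ≤ f false} :=
    (isClosed_setOf_Lp_nonneg true).inter (isClosed_setOf_Lp_le true false)
  exact (boundedPerturbation_mem hT.isC0 hT.sa (W := fun i : Bool => cond i W V)
    (fun i => by cases i <;> assumption) hK
    (fun t f hf => ⟨(hT.pos t).map_nonneg hf.1, (hT.pos t).mono hf.2⟩)
    (fun t f hf => ⟨(isPositiveOperator_halfStep hW t).map_nonneg hf.1,
      (halfStep_anti hV hW hVW t hf.1).trans ((isPositiveOperator_halfStep hV t).mono hf.2)⟩)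
    t (f := fun _ => f) ⟨hf, le_rfl⟩).2

/-- Additional absorption P ≥ 0 can only shrink the effect of changing the potential from V to W. It
serves to control a change of the negative part of a potential uniformly in its positive part. -/
theorem boundedPerturbation_sub_le {P : Ω → ℝ} (hT : IsPositiveSymmetricSemigroup T)
    (hV : IsBddMeasurable V) (hW : IsBddMeasurable W) (hVW : ∀ x, V x ≤ W x)
    (hP0 : ∀ x, 0 ≤ P x)
    (hVP : IsBddMeasurable fun x => V x + P x) (hWP : IsBddMeasurable fun x => W x + P x)
    (t : ℝ≥0) {f : Lp ℂ 2 μ} (hf : 0 ≤ f) :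
    boundedPerturbation T (fun x => V x + P x) t f - boundedPerturbation T (fun x => W x + P x) t f
      ≤ boundedPerturbation T V t f - boundedPerturbation T W t f := by
  -- The entries follow the potentials V, W, V + P, W + P. The extra order relations are there
  -- because the last inequality alone is not preserved by the multiplications.
  set K : Set (Fin 4 → Lp ℂ 2 μ) := {f | (0 ≤ f 1 ∧ f 1 ≤ f 0) ∧ (0 ≤ f 3 ∧ f 3 ≤ f 2) ∧
    f 3 ≤ f 1 ∧ f 2 - f 3 ≤ f 0 - f 1} with hKdef
  have hK : IsClosed K := by
    have h : IsClosed {f : Fin 4 → Lp ℂ 2 μ | f 2 - f 3 ≤ f 0 - f 1} :=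
      isClosed_le (α := Lp ℂ 2 μ) ((continuous_apply 2).sub (continuous_apply 3))
        ((continuous_apply 0).sub (continuous_apply 1))
    exact ((isClosed_setOf_Lp_nonneg 1).inter (isClosed_setOf_Lp_le 1 0)).inter
      (((isClosed_setOf_Lp_nonneg 3).inter (isClosed_setOf_Lp_le 3 2)).inter
      ((isClosed_setOf_Lp_le 3 1).inter h))
  set U : Fin 4 → Ω → ℝ := ![V, W, fun x => V x + P x, fun x => W x + P x] with hU
  have hUb : ∀ i, IsBddMeasurable (U i) := by
    intro i
    fin_cases i <;> assumption
  refine (boundedPerturbation_mem hT.isC0 hT.sa (W := U) hUb hK ?_ ?_ t (f := fun _ => f)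
    ⟨⟨hf, le_rfl⟩, ⟨hf, le_rfl⟩, le_rfl, by simp⟩).2.2.2
  · rintro t f ⟨⟨h1, h2⟩, ⟨h3, h4⟩, h5, h6⟩
    have hp := hT.pos t
    refine ⟨⟨hp.map_nonneg h1, hp.mono h2⟩, ⟨hp.map_nonneg h3, hp.mono h4⟩, hp.mono h5, ?_⟩
    have := hp.mono h6
    simpa only [map_sub] using this
  · rintro t f ⟨⟨h1, h2⟩, ⟨h3, h4⟩, h5, h6⟩
    have hp : ∀ i, IsPositiveOperator (halfStep μ (U i) t) := fun i =>
      isPositiveOperator_halfStep (hUb i) t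
    have hWWP : ∀ x, U 1 x ≤ U 3 x := fun x => by simpa [hU] using hP0 x
    refine ⟨⟨(hp 1).map_nonneg h1,
        (halfStep_anti (hUb 0) (hUb 1) hVW t h1).trans ((hp 0).mono h2)⟩,
      ⟨(hp 3).map_nonneg h3,
        (halfStep_anti (hUb 2) (hUb 3) (fun x => by simpa [hU] using hVW x) t h3).trans
          ((hp 2).mono h4)⟩,
      (halfStep_anti (hUb 1) (hUb 3) hWWP t h3).trans ((hp 1).mono h5), ?_⟩
    rw [Lp_le_iff] at h2 h4 h5 h6 ⊢
    filter_upwards [h2, h4, h5, h6, (Lp_nonneg_iff' _).1 h3, halfStep_ae (hUb 0) t (f 0),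
      halfStep_ae (hUb 1) t (f 1), halfStep_ae (hUb 2) t (f 2), halfStep_ae (hUb 3) t (f 3),
      Lp.coeFn_sub (f 2) (f 3), Lp.coeFn_sub (f 0) (f 1),
      Lp.coeFn_sub (halfStep μ (U 2) t (f 2)) (halfStep μ (U 3) t (f 3)),
      Lp.coeFn_sub (halfStep μ (U 0) t (f 0)) (halfStep μ (U 1) t (f 1))]
      with x h2 h4 h5 h6 h3 e0 e1 e2 e3 s1 s2 s3 s4
    rw [s3, s4, Pi.sub_apply, Pi.sub_apply, e0, e1, e2, e3]
    rw [s1, s2, Pi.sub_apply, Pi.sub_apply] at h6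
    set a := Real.exp (-(t / 2) * V x) with ha
    set b := Real.exp (-(t / 2) * W x) with hb
    set d := Real.exp (-(t / 2) * P x) with hd
    have ea : Real.exp (-(t / 2) * U 0 x) = a := rfl
    have eb : Real.exp (-(t / 2) * U 1 x) = b := rfl
    have ec : Real.exp (-(t / 2) * U 2 x) = a * d := by
      rw [ha, hd, ← Real.exp_add, ← mul_add]; rfl
    have ed : Real.exp (-(t / 2) * U 3 x) = b * d := by
      rw [hb, hd, ← Real.exp_add, ← mul_add]; rfl
    have hba : b ≤ a := by
      refine Real.exp_le_exp.2 ?_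
      have := hVW x
      nlinarith [t.coe_nonneg]
    have hd1 : d ≤ 1 := by
      refine Real.exp_le_one_iff.2 ?_
      have := hP0 x
      nlinarith [t.coe_nonneg, mul_nonneg t.coe_nonneg this]
    have ha0 : (0 : ℂ) ≤ a := by exact_mod_cast (Real.exp_pos _).le
    have hba' : (0 : ℂ) ≤ a - b := by
      rw [sub_nonneg]; exact_mod_cast hba
    have hd' : (0 : ℂ) ≤ 1 - d := by
      rw [sub_nonneg]; exact_mod_cast hd1
    rw [ea, eb, ec, ed, ← sub_nonneg]
    push_cast
    -- Each summand on the right is a product of factors that are nonnegative by the order relations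
    -- in K and by b ≤ a, d ≤ 1.
    have : (a : ℂ) * f 0 x - b * f 1 x - (a * d * f 2 x - b * d * f 3 x) =
        a * ((f 0 x - f 1 x) - (f 2 x - f 3 x)) + (a - b) * (f 1 x - f 3 x) +
          (1 - d) * (a * (f 2 x - f 3 x) + (a - b) * f 3 x) := by ring
    rw [this]
    exact add_nonneg (add_nonneg (mul_nonneg ha0 (sub_nonneg.2 h6))
      (mul_nonneg hba' (sub_nonneg.2 h5)))
      (mul_nonneg hd' (add_nonneg (mul_nonneg ha0 (sub_nonneg.2 h4)) (mul_nonneg hba' h3)))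

/-- A constant commutes with everything, so all Trotter products with n ≥ 1 already equal exp(-at)
T(t). -/
theorem boundedPerturbation_const (hT : IsPositiveSymmetricSemigroup T) (a : ℝ) (t : ℝ≥0)
    (f : Lp ℂ 2 μ) :
    boundedPerturbation T (fun _ => a) t f = ((Real.exp (-(a * t)) : ℝ) : ℂ) • T t f := by
  refine tendsto_nhds_unique (tendsto_trotter hT.isC0 hT.sa (IsBddMeasurable.const a) t f) ?_
  refine tendsto_const_nhds.congr' ?_
  filter_upwards [eventually_gt_atTop 0] with n hn
  have e : trotterStep T (fun _ => a) (t / n) =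
      ((Real.exp (-(a * (t / n))) : ℝ) : ℂ) • T (t / n) := by
    ext1 g
    simp only [trotterStep, halfStep, mulOp_const, mul_apply_eq_comp, _root_.smul_apply,
      one_apply_eq_self, map_smul, smul_smul]
    congr 1
    rw [← Complex.ofReal_mul, ← Real.exp_add]
    congr 2
    push_cast
    ring
  rw [e, smul_pow, ← hT.isC0.map_nsmul_eq_pow]
  have hn' : (n : ℝ≥0) ≠ 0 := by exact_mod_cast hn.ne'
  rw [mul_div_cancel₀ _ hn', ← Complex.ofReal_pow, ← Real.exp_nat_mul, _root_.smul_apply]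
  congr 3
  have : (n : ℝ) ≠ 0 := by exact_mod_cast hn.ne'
  field_simp

end Order

/-! ### Domination of positive operators by their action on moduli -/

section Modulus

variable {Ω : Type*} [MeasurableSpace Ω] {μ : Measure Ω}

theorem norm_eq_re_of_nonneg {z : ℂ} (h : 0 ≤ z) : ‖z‖ = z.re := by
  have := Complex.eq_coe_norm_of_nonneg h
  rw [this]; simp

/-- The modulus of an `L₂`-function. -/
def absLp (f : Lp ℂ 2 μ) : Lp ℂ 2 μ := ((Lp.memLp f).norm.ofReal (K := ℂ)).toLp _

theorem absLp_ae (f : Lp ℂ 2 μ) : absLp f =ᵐ[μ] fun x => (‖f x‖ : ℂ) := MemLp.coeFn_toLp _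

theorem absLp_nonneg (f : Lp ℂ 2 μ) : 0 ≤ absLp f := by
  rw [Lp_nonneg_iff']
  filter_upwards [absLp_ae f] with x hx
  rw [hx]
  exact_mod_cast norm_nonneg _

theorem norm_absLp (f : Lp ℂ 2 μ) : ‖absLp f‖ = ‖f‖ := by
  refine le_antisymm (Lp.norm_le_norm_of_ae_le ?_) (Lp.norm_le_norm_of_ae_le ?_) <;>
  · filter_upwards [absLp_ae f] with x hx
    rw [hx]; simp

theorem IsPositiveOperator.re_apply_le {A : Lp ℂ 2 μ →L[ℂ] Lp ℂ 2 μ} (hA : IsPositiveOperator A)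
    {f g : Lp ℂ 2 μ} (h : ∀ᵐ x ∂μ, (‖f x‖ : ℂ) ≤ g x) :
    ∀ᵐ x ∂μ, (A f x).re ≤ (A g x).re := by
  set a : Lp ℂ 2 μ := ((Lp.memLp f).re.ofReal (K := ℂ)).toLp _ with ha
  set b : Lp ℂ 2 μ := ((Lp.memLp f).im.ofReal (K := ℂ)).toLp _ with hb
  have hae : a =ᵐ[μ] fun x => ((f x).re : ℂ) := MemLp.coeFn_toLp _
  have hbe : b =ᵐ[μ] fun x => ((f x).im : ℂ) := MemLp.coeFn_toLp _
  have hab : f = a + Complex.I • b := by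
    apply Lp.ext
    filter_upwards [hae, hbe, Lp.coeFn_add a (Complex.I • b), Lp.coeFn_smul Complex.I b]
      with x h1 h2 h3 h4
    rw [h3, Pi.add_apply, h4, Pi.smul_apply, h1, h2, smul_eq_mul, mul_comm Complex.I]
    exact (Complex.re_add_im _).symm
  have h1 : a ≤ g := by
    rw [Lp_le_iff]
    filter_upwards [h, hae] with x hx h1
    rw [h1]
    refine le_trans ?_ hx
    exact_mod_cast Complex.re_le_norm _
  have h2 : ∀ c : Lp ℂ 2 μ, ∀ k : Ω → ℝ, (∀ x, |k x| ≤ ‖f x‖) → c =ᵐ[μ] (fun x => (k x : ℂ)) →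
      -g ≤ c := by
    intro c k hk hc
    rw [Lp_le_iff]
    filter_upwards [h, hc, Lp.coeFn_neg g] with x hx h1 h2
    rw [h1, h2, Pi.neg_apply, neg_le]
    refine le_trans ?_ hx
    exact_mod_cast (neg_le_abs _).trans (hk x)
  have hga : -g ≤ a := h2 a _ (fun x => Complex.abs_re_le_norm _) hae
  have hgb : -g ≤ b := h2 b _ (fun x => Complex.abs_im_le_norm _) hbe
  have k1 := (Lp_le_iff _ _).1 (hA.mono h1)
  have k2 := (Lp_le_iff _ _).1 (hA.mono hga)
  have k3 := (Lp_le_iff _ _).1 (hA.mono hgb)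
  have hg : 0 ≤ g := by
    rw [Lp_nonneg_iff']
    filter_upwards [h] with x hx
    exact le_trans (by exact_mod_cast norm_nonneg _) hx
  have k4 := (Lp_nonneg_iff _).1 (hA.map_nonneg hg)
  rw [hab, map_add, map_smul]
  rw [map_neg] at k2 k3
  filter_upwards [k1, k2, k3, k4, Lp.coeFn_add (A a) (Complex.I • A b),
    Lp.coeFn_smul Complex.I (A b), Lp.coeFn_neg (A g)] with x k1 k2 k3 k4 e1 e2 e3
  rw [e1, Pi.add_apply, e2, Pi.smul_apply]
  rw [e3, Pi.neg_apply, Complex.le_def] at k2 k3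
  rw [Complex.le_def] at k1
  have : (A b x).im = 0 := by rw [← k3.2]; simp [k4.2]
  simpa [this] using k1.1

/-- The modulus of a complex number is the supremum of the real parts of its rotations. Rational
angles keep the exceptional null set countable, and continuity recovers the angle -arg at each
point. -/
theorem IsPositiveOperator.norm_apply_le {A : Lp ℂ 2 μ →L[ℂ] Lp ℂ 2 μ} (hA : IsPositiveOperator A)
    {f g : Lp ℂ 2 μ} (h : ∀ᵐ x ∂μ, (‖f x‖ : ℂ) ≤ g x) :
    ∀ᵐ x ∂μ, ‖A f x‖ ≤ (A g x).re := by
  have h1 : ∀ r : ℚ, ∀ᵐ x ∂μ, (Complex.exp ((r : ℝ) * Complex.I) * A f x).re ≤ (A g x).re := by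
    intro r
    have hc : ‖Complex.exp ((r : ℝ) * Complex.I)‖ = 1 := Complex.norm_exp_ofReal_mul_I _
    have := hA.re_apply_le (f := Complex.exp ((r : ℝ) * Complex.I) • f) (g := g) (by
      filter_upwards [h, Lp.coeFn_smul (Complex.exp ((r : ℝ) * Complex.I)) f] with x h1 h2
      rw [h2, Pi.smul_apply, norm_smul, hc, one_mul]
      exact h1)
    rw [map_smul] at this
    filter_upwards [this, Lp.coeFn_smul (Complex.exp ((r : ℝ) * Complex.I)) (A f)] with x h1 h2
    rw [h2] at h1
    exact h1
  filter_upwards [ae_all_iff.2 h1] with x hx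
  have h2 : ∀ r : ℝ, (Complex.exp ((r : ℝ) * Complex.I) * A f x).re ≤ (A g x).re := by
    intro r
    refine Rat.denseRange_cast.induction_on (p := fun r : ℝ =>
      (Complex.exp ((r : ℝ) * Complex.I) * A f x).re ≤ (A g x).re) r ?_ hx
    refine isClosed_le ?_ continuous_const
    fun_prop
  have h3 := h2 (-(A f x).arg)
  rw [← Complex.norm_mul_exp_arg_mul_I (A f x)] at h3
  rw [mul_left_comm, ← Complex.exp_add] at h3
  simpa [Complex.norm_mul_exp_arg_mul_I] using h3

theorem IsPositiveOperator.norm_apply_le_absLp {A : Lp ℂ 2 μ →L[ℂ] Lp ℂ 2 μ}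
    (hA : IsPositiveOperator A) (f : Lp ℂ 2 μ) : ∀ᵐ x ∂μ, ‖A f x‖ ≤ ‖A (absLp f) x‖ := by
  filter_upwards [hA.norm_apply_le (f := f) (g := absLp f) (by
    filter_upwards [absLp_ae f] with x hx
    rw [hx])] with x hx
  exact hx.trans (Complex.re_le_norm _)

theorem IsPositiveOperator.opNorm_le {A B : Lp ℂ 2 μ →L[ℂ] Lp ℂ 2 μ} (hA : IsPositiveOperator A)
    (h : ∀ f, 0 ≤ f → A f ≤ B f) : ‖A‖ ≤ ‖B‖ := by
  refine ContinuousLinearMap.opNorm_le_bound _ (norm_nonneg _) fun f => ?_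
  calc ‖A f‖ ≤ ‖A (absLp f)‖ := Lp.norm_le_norm_of_ae_le (hA.norm_apply_le_absLp f)
    _ ≤ ‖B (absLp f)‖ :=
      Lp_norm_le_norm (hA.map_nonneg (absLp_nonneg f)) (h _ (absLp_nonneg f))
    _ ≤ ‖B‖ * ‖f‖ := by rw [← norm_absLp f]; exact B.le_opNorm _

end Modulus

/-! ### Geometric means and the pointwise Hölder inequality -/

section GeometricMean

/-- Weighted arithmetic-geometric means, with the scaling parameter r optimised: the geometric mean
is the infimum over r of positive linear forms in (a, b). -/
theorem le_geom_mean_iff {θ a b w : ℝ} (h0 : 0 < θ) (h1 : θ < 1) (ha : 0 ≤ a) (hb : 0 ≤ b) :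
    w ≤ a ^ θ * b ^ (1 - θ) ↔
      ∀ r : ℝ, w ≤ θ * Real.exp ((1 - θ) * r) * a + (1 - θ) * Real.exp (-θ * r) * b := by
  constructor
  · intro h r
    have := Real.geom_mean_le_arith_mean2_weighted h0.le (sub_nonneg.2 h1.le)
      (p₁ := Real.exp ((1 - θ) * r) * a) (p₂ := Real.exp (-θ * r) * b) (by positivity)
      (by positivity) (by ring)
    rw [Real.mul_rpow (Real.exp_pos _).le ha, Real.mul_rpow (Real.exp_pos _).le hb,
      ← Real.exp_mul, ← Real.exp_mul] at this
    have e : Real.exp ((1 - θ) * r * θ) * a ^ θ * (Real.exp (-θ * r * (1 - θ)) * b ^ (1 - θ)) =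
        a ^ θ * b ^ (1 - θ) := by
      calc _ = (Real.exp ((1 - θ) * r * θ) * Real.exp (-θ * r * (1 - θ))) *
            (a ^ θ * b ^ (1 - θ)) := by ring
        _ = _ := by
          rw [← Real.exp_add, show (1 - θ) * r * θ + -θ * r * (1 - θ) = 0 by ring]; simp
    rw [e] at this
    linarith
  · intro h
    have hpos : ∀ ε : ℝ, 0 < ε → w ≤ (a + ε) ^ θ * (b + ε) ^ (1 - θ) := by
      intro ε hε
      have ha' : 0 < a + ε := by linarith
      have hb' : 0 < b + ε := by linarith
      -- The minimiser, at which both terms of the arithmetic mean are equal; ε > 0 keeps the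
      -- logarithms meaningful when a or b vanishes.
      set r := Real.log (b + ε) - Real.log (a + ε) with hr
      have h2 := h r
      have e1 : Real.exp ((1 - θ) * r) * (a + ε) = (a + ε) ^ θ * (b + ε) ^ (1 - θ) := by
        rw [Real.rpow_def_of_pos ha', Real.rpow_def_of_pos hb', ← Real.exp_add]
        conv_lhs => rw [← Real.exp_log ha', ← Real.exp_add]
        congr 1; rw [hr]; ring
      have e2 : Real.exp (-θ * r) * (b + ε) = (a + ε) ^ θ * (b + ε) ^ (1 - θ) := by
        rw [Real.rpow_def_of_pos ha', Real.rpow_def_of_pos hb', ← Real.exp_add]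
        conv_lhs => rw [← Real.exp_log hb', ← Real.exp_add]
        congr 1; rw [hr]; ring
      have h3 : θ * Real.exp ((1 - θ) * r) * a ≤ θ * (Real.exp ((1 - θ) * r) * (a + ε)) := by
        rw [mul_assoc]; gcongr; linarith
      have h4 : (1 - θ) * Real.exp (-θ * r) * b ≤ (1 - θ) * (Real.exp (-θ * r) * (b + ε)) := by
        rw [mul_assoc]
        have : 0 ≤ 1 - θ := by linarith
        gcongr; linarith
      rw [e1] at h3
      rw [e2] at h4
      linarith
    have hlim : Tendsto (fun ε : ℝ => (a + ε) ^ θ * (b + ε) ^ (1 - θ)) (𝓝[>] 0)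
        (𝓝 (a ^ θ * b ^ (1 - θ))) := by
      have hc : Continuous fun ε : ℝ => (a + ε) ^ θ * (b + ε) ^ (1 - θ) :=
        ((continuous_const.add continuous_id).rpow_const fun _ => Or.inr h0.le).mul
          ((continuous_const.add continuous_id).rpow_const fun _ => Or.inr (by linarith))
      exact (hc.tendsto' 0 _ (by simp)).mono_left nhdsWithin_le_nhds
    exact ge_of_tendsto hlim (by filter_upwards [self_mem_nhdsWithin] with ε hε using hpos ε hε)

variable {Ω : Type*} [MeasurableSpace Ω] {μ : Measure Ω}

/-- `w ≤ u ^ θ * v ^ (1 - θ)` for nonnegative `u, v, w`. -/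
def IsBelowGeomMean (θ : ℝ) (w u v : Lp ℂ 2 μ) : Prop :=
  ∀ᵐ x ∂μ, ‖w x‖ ≤ ‖u x‖ ^ θ * ‖v x‖ ^ (1 - θ)

theorem isBelowGeomMean_iff {θ : ℝ} (h0 : 0 < θ) (h1 : θ < 1) {w u v : Lp ℂ 2 μ} (hw : 0 ≤ w)
    (hu : 0 ≤ u) (hv : 0 ≤ v) : IsBelowGeomMean θ w u v ↔
      ∀ r : ℝ, w ≤ ((θ * Real.exp ((1 - θ) * r) : ℝ) : ℂ) • u +
        (((1 - θ) * Real.exp (-θ * r) : ℝ) : ℂ) • v := by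
  have key : ∀ r : ℝ, (w ≤ ((θ * Real.exp ((1 - θ) * r) : ℝ) : ℂ) • u +
        (((1 - θ) * Real.exp (-θ * r) : ℝ) : ℂ) • v) ↔ ∀ᵐ x ∂μ,
        ‖w x‖ ≤ θ * Real.exp ((1 - θ) * r) * ‖u x‖ + (1 - θ) * Real.exp (-θ * r) * ‖v x‖ := by
    intro r
    rw [Lp_le_iff]
    refine eventually_congr ?_
    filter_upwards [(Lp_nonneg_iff' w).1 hw, (Lp_nonneg_iff' u).1 hu, (Lp_nonneg_iff' v).1 hv,
      Lp.coeFn_add (((θ * Real.exp ((1 - θ) * r) : ℝ) : ℂ) • u)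
        ((((1 - θ) * Real.exp (-θ * r) : ℝ) : ℂ) • v),
      Lp.coeFn_smul ((θ * Real.exp ((1 - θ) * r) : ℝ) : ℂ) u,
      Lp.coeFn_smul (((1 - θ) * Real.exp (-θ * r) : ℝ) : ℂ) v] with x hw hu hv e1 e2 e3
    rw [e1, Pi.add_apply, e2, e3, Pi.smul_apply, Pi.smul_apply]
    conv_lhs => rw [Complex.eq_coe_norm_of_nonneg hw, Complex.eq_coe_norm_of_nonneg hu,
      Complex.eq_coe_norm_of_nonneg hv, smul_eq_mul, smul_eq_mul, ← Complex.ofReal_mul,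
      ← Complex.ofReal_mul, ← Complex.ofReal_add, Complex.real_le_real]
  simp only [key]
  constructor
  · intro h r
    filter_upwards [h] with x hx
    exact (le_geom_mean_iff h0 h1 (norm_nonneg _) (norm_nonneg _)).1 hx r
  · intro h
    -- Countably many r give one common null set; continuity in r extends the inequality to all real
    -- r.
    have h2 : ∀ r : ℚ, ∀ᵐ x ∂μ, ‖w x‖ ≤ θ * Real.exp ((1 - θ) * (r : ℝ)) * ‖u x‖ +
        (1 - θ) * Real.exp (-θ * (r : ℝ)) * ‖v x‖ := fun r => h r
    filter_upwards [ae_all_iff.2 h2] with x hx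
    refine (le_geom_mean_iff h0 h1 (norm_nonneg _) (norm_nonneg _)).2 fun r => ?_
    refine Rat.denseRange_cast.induction_on (p := fun r : ℝ => ‖w x‖ ≤
      θ * Real.exp ((1 - θ) * r) * ‖u x‖ + (1 - θ) * Real.exp (-θ * r) * ‖v x‖) r ?_ hx
    refine isClosed_le continuous_const ?_
    fun_prop

/-- The set of triples of nonnegative functions, the first one below the geometric mean of the
others. -/
def geomMeanSet (μ : Measure Ω) (θ : ℝ) : Set (Fin 3 → Lp ℂ 2 μ) :=
  {f | (0 ≤ f 0 ∧ 0 ≤ f 1 ∧ 0 ≤ f 2) ∧ IsBelowGeomMean θ (f 0) (f 1) (f 2)}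

theorem isClosed_geomMeanSet {θ : ℝ} (h0 : 0 < θ) (h1 : θ < 1) :
    IsClosed (geomMeanSet μ θ) := by
  have e : geomMeanSet μ θ = {f | 0 ≤ f 0 ∧ 0 ≤ f 1 ∧ 0 ≤ f 2} ∩ ⋂ r : ℝ,
      {f | f 0 ≤ ((θ * Real.exp ((1 - θ) * r) : ℝ) : ℂ) • f 1 +
        (((1 - θ) * Real.exp (-θ * r) : ℝ) : ℂ) • f 2} := by
    ext f
    simp only [geomMeanSet, Set.mem_ofPred_eq, Set.mem_inter_iff, Set.mem_iInter]
    refine and_congr_right fun h => ?_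
    exact isBelowGeomMean_iff h0 h1 h.1 h.2.1 h.2.2
  rw [e]
  refine ((isClosed_setOf_Lp_nonneg 0).inter ((isClosed_setOf_Lp_nonneg 1).inter
    (isClosed_setOf_Lp_nonneg 2))).inter (isClosed_iInter fun r => ?_)
  have hc : Continuous fun f : Fin 3 → Lp ℂ 2 μ => ((θ * Real.exp ((1 - θ) * r) : ℝ) : ℂ) • f 1 +
      (((1 - θ) * Real.exp (-θ * r) : ℝ) : ℂ) • f 2 := by fun_prop
  exact isClosed_le (α := Lp ℂ 2 μ) (continuous_apply 0) hc

/-- A positive operator preserves each of the linear inequalities whose infimum is the geometric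
mean: an abstract Hölder inequality. -/
theorem geomMeanSet_map {θ : ℝ} (h0 : 0 < θ) (h1 : θ < 1) {A : Lp ℂ 2 μ →L[ℂ] Lp ℂ 2 μ}
    (hA : IsPositiveOperator A) {f : Fin 3 → Lp ℂ 2 μ} (hf : f ∈ geomMeanSet μ θ) :
    (fun i => A (f i)) ∈ geomMeanSet μ θ := by
  obtain ⟨h, hg⟩ := hf
  have h' : 0 ≤ A (f 0) ∧ 0 ≤ A (f 1) ∧ 0 ≤ A (f 2) :=
    ⟨hA.map_nonneg h.1, hA.map_nonneg h.2.1, hA.map_nonneg h.2.2⟩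
  refine ⟨h', (isBelowGeomMean_iff h0 h1 h'.1 h'.2.1 h'.2.2).2 fun r => ?_⟩
  have := hA.mono ((isBelowGeomMean_iff h0 h1 h.1 h.2.1 h.2.2).1 hg r)
  simpa only [map_add, map_smul] using this

/-- If U₀ = θU₁ + (1-θ)U₂ then exp(-sU₀) = exp(-sU₁)^θ exp(-sU₂)^(1-θ), so the multiplications
preserve the closed set of triples, as does T by positivity. -/
theorem boundedPerturbation_geomMean {T : ℝ≥0 → Lp ℂ 2 μ →L[ℂ] Lp ℂ 2 μ}
    (hT : IsPositiveSymmetricSemigroup T) {θ : ℝ} (h0 : 0 < θ) (h1 : θ < 1) {U : Fin 3 → Ω → ℝ}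
    (hU : ∀ i, IsBddMeasurable (U i)) (hconv : ∀ x, U 0 x = θ * U 1 x + (1 - θ) * U 2 x)
    (t : ℝ≥0) {f : Fin 3 → Lp ℂ 2 μ} (hf : f ∈ geomMeanSet μ θ) :
    (fun i => boundedPerturbation T (U i) t (f i)) ∈ geomMeanSet μ θ := by
  refine boundedPerturbation_mem hT.isC0 hT.sa hU (isClosed_geomMeanSet h0 h1)
    (fun t f hf => geomMeanSet_map h0 h1 (hT.pos t) hf) ?_ t hf
  rintro t f ⟨h, hg⟩
  refine ⟨⟨(isPositiveOperator_halfStep (hU 0) t).map_nonneg h.1,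
    (isPositiveOperator_halfStep (hU 1) t).map_nonneg h.2.1,
    (isPositiveOperator_halfStep (hU 2) t).map_nonneg h.2.2⟩, ?_⟩
  unfold IsBelowGeomMean at hg ⊢
  filter_upwards [hg, halfStep_ae (hU 0) t (f 0), halfStep_ae (hU 1) t (f 1),
    halfStep_ae (hU 2) t (f 2)] with x hg e0 e1 e2
  rw [e0, e1, e2, norm_mul, norm_mul, norm_mul, Complex.norm_real, Complex.norm_real,
    Complex.norm_real, Real.norm_of_nonneg (Real.exp_pos _).le,
    Real.norm_of_nonneg (Real.exp_pos _).le, Real.norm_of_nonneg (Real.exp_pos _).le,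
    Real.mul_rpow (Real.exp_pos _).le (norm_nonneg _),
    Real.mul_rpow (Real.exp_pos _).le (norm_nonneg _), ← Real.exp_mul, ← Real.exp_mul, hconv x]
  calc _ ≤ Real.exp (-(t / 2) * (θ * U 1 x + (1 - θ) * U 2 x)) *
        (‖f 1 x‖ ^ θ * ‖f 2 x‖ ^ (1 - θ)) := mul_le_mul_of_nonneg_left hg (Real.exp_pos _).le
    _ = (Real.exp (-(t / 2) * U 1 x * θ) * Real.exp (-(t / 2) * U 2 x * (1 - θ))) *
        (‖f 1 x‖ ^ θ * ‖f 2 x‖ ^ (1 - θ)) := by rw [← Real.exp_add]; congr 2; ring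
    _ = _ := by ring

end GeometricMean

/-! ### Strong limits of operators and semigroups -/

section StrongLimits

variable {X : Type*} [NormedAddCommGroup X] [NormedSpace ℂ X] [CompleteSpace X]

theorem tendsto_apply_of_tendsto {A : ℕ → X →L[ℂ] X} {B : X →L[ℂ] X}
    (hA : ∀ x, Tendsto (fun n => A n x) atTop (𝓝 (B x))) {x : ℕ → X} {y : X}
    (hx : Tendsto x atTop (𝓝 y)) : Tendsto (fun n => A n (x n)) atTop (𝓝 (B y)) := by
  obtain ⟨C, hC⟩ := banach_steinhaus (g := A) fun x => by
    obtain ⟨C, hC⟩ := (hA x).norm.bddAbove_range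
    exact ⟨C, fun n => hC ⟨n, rfl⟩⟩
  have h1 : Tendsto (fun n => A n (x n - y)) atTop (𝓝 0) := by
    refine squeeze_zero_norm (fun n => (A n).le_of_opNorm_le (hC n) _) ?_
    have := (hx.sub_const y).norm.const_mul C
    simpa using this
  have h2 := h1.add (hA y)
  simp only [map_sub, sub_add_cancel, zero_add] at h2
  exact h2

omit [CompleteSpace X] in
theorem IsC0Semigroup.of_tendsto_zero {S : ℝ≥0 → X →L[ℂ] X} (h0 : S 0 = ContinuousLinearMap.id ℂ X)
    (hadd : ∀ s t, S (s + t) = (S s).comp (S t)) (hb : ∀ τ : ℝ≥0, ∃ C, ∀ t ≤ τ, ‖S t‖ ≤ C)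
    (hc : ∀ f, Tendsto (fun t => S t f) (𝓝 0) (𝓝 f)) : IsC0Semigroup S := by
  refine ⟨h0, hadd, fun f => ?_⟩
  rw [continuous_iff_continuousAt]
  intro t₀
  obtain ⟨C, hC⟩ := hb (t₀ + 1)
  rw [ContinuousAt, tendsto_iff_norm_sub_tendsto_zero]
  have hd : Tendsto (fun t : ℝ≥0 => nndist t t₀) (𝓝 t₀) (𝓝 0) := by
    have : Continuous fun t : ℝ≥0 => nndist t t₀ := continuous_id.nndist continuous_const
    exact this.tendsto' _ _ (nndist_self t₀)
  have h1 : Tendsto (fun t : ℝ≥0 => C * ‖S (nndist t t₀) f - f‖) (𝓝 t₀) (𝓝 0) := by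
    have := (((hc f).comp hd).sub_const f).norm.const_mul C
    simpa using this
  refine squeeze_zero' (Eventually.of_forall fun _ => norm_nonneg _) ?_ h1
  have h2 : ∀ᶠ t : ℝ≥0 in 𝓝 t₀, t < t₀ + 1 := gt_mem_nhds (by simp)
  have key : ∀ s t : ℝ≥0, s ≤ t → s ≤ t₀ + 1 → ‖S t f - S s f‖ ≤ C * ‖S (nndist t s) f - f‖ := by
    intro s t hst hs
    have e : t = s + nndist t s := by
      rw [← NNReal.coe_inj, NNReal.coe_add, coe_nndist, NNReal.dist_eq,
        abs_of_nonneg (sub_nonneg.2 (NNReal.coe_le_coe.2 hst))]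
      ring
    have e2 : S t f - S s f = S s (S (nndist t s) f - f) := by
      rw [map_sub]
      conv_lhs => rw [e, hadd]
      rfl
    rw [e2]
    exact (S s).le_of_opNorm_le (hC s hs) _
  filter_upwards [h2] with t ht
  rcases le_total t₀ t with h | h
  · exact key t₀ t h (by simp)
  · rw [norm_sub_rev, nndist_comm]
    exact key t t₀ h ht.le

end StrongLimits

/-! ### Monotone convergence in L₂ and squeezed semigroups -/

section MonotoneLimits

variable {Ω : Type*} [MeasurableSpace Ω] {μ : Measure Ω}

theorem cauchySeq_of_norm_sq {ι : Type*} [Nonempty ι] [SemilatticeSup ι] {f : ι → Lp ℂ 2 μ}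
    (hf : ∀ i j, i ≤ j → ‖f j - f i‖ ^ 2 ≤ |‖f j‖ ^ 2 - ‖f i‖ ^ 2|)
    (hc : CauchySeq fun i => ‖f i‖ ^ 2) : CauchySeq f := by
  rw [Metric.cauchySeq_iff'] at hc ⊢
  intro ε hε
  obtain ⟨N, hN⟩ := hc (ε ^ 2) (by positivity)
  refine ⟨N, fun n hn => ?_⟩
  have h1 := (hf N n hn).trans_lt (hN n hn)
  rw [dist_eq_norm]
  exact lt_of_pow_lt_pow_left₀ 2 hε.le h1

theorem exists_tendsto_of_monotone {ι : Type*} [Nonempty ι] [SemilatticeSup ι]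
    {f : ι → Lp ℂ 2 μ} (h0 : ∀ i, 0 ≤ f i) (hf : Monotone f) {g : Lp ℂ 2 μ} (hg : ∀ i, f i ≤ g) :
    ∃ F, Tendsto f atTop (𝓝 F) := by
  refine cauchySeq_tendsto_of_complete (cauchySeq_of_norm_sq (fun i j hij => ?_) ?_)
  · exact (norm_sub_sq_le (h0 i) (hf hij)).trans (le_abs_self _)
  · have hm : Monotone fun i => ‖f i‖ ^ 2 := fun i j hij =>
      pow_le_pow_left₀ (norm_nonneg _) (Lp_norm_le_norm (h0 i) (hf hij)) 2
    exact (tendsto_atTop_ciSup hm ⟨‖g‖ ^ 2, by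
      rintro _ ⟨i, rfl⟩
      exact pow_le_pow_left₀ (norm_nonneg _) (Lp_norm_le_norm (h0 i) (hg i)) 2⟩).cauchySeq

theorem exists_tendsto_of_antitone {ι : Type*} [Nonempty ι] [SemilatticeSup ι]
    {f : ι → Lp ℂ 2 μ} (h0 : ∀ i, 0 ≤ f i) (hf : Antitone f) : ∃ F, Tendsto f atTop (𝓝 F) := by
  refine cauchySeq_tendsto_of_complete (cauchySeq_of_norm_sq (fun i j hij => ?_) ?_)
  · rw [norm_sub_rev, abs_sub_comm]
    exact (norm_sub_sq_le (h0 j) (hf hij)).trans (le_abs_self _)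
  · have hm : Antitone fun i => ‖f i‖ ^ 2 := fun i j hij =>
      pow_le_pow_left₀ (norm_nonneg _) (Lp_norm_le_norm (h0 j) (hf hij)) 2
    exact (tendsto_atTop_ciInf hm ⟨0, by
      rintro _ ⟨i, rfl⟩
      positivity⟩).cauchySeq

theorem exists_nonneg_decomposition (f : Lp ℂ 2 μ) : ∃ f₁ f₂ f₃ f₄ : Lp ℂ 2 μ,
    (0 ≤ f₁ ∧ 0 ≤ f₂ ∧ 0 ≤ f₃ ∧ 0 ≤ f₄) ∧ f = f₁ - f₂ + Complex.I • (f₃ - f₄) := by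
  have key : ∀ k : Ω → ℝ, MemLp k 2 μ → ∃ a b : Lp ℂ 2 μ, 0 ≤ a ∧ 0 ≤ b ∧
      (a - b : Lp ℂ 2 μ) =ᵐ[μ] fun x => (k x : ℂ) := by
    intro k hk
    refine ⟨(hk.pos_part.ofReal (K := ℂ)).toLp _, (hk.neg_part.ofReal (K := ℂ)).toLp _, ?_, ?_, ?_⟩
    · rw [Lp_nonneg_iff']
      filter_upwards [(hk.pos_part.ofReal (K := ℂ)).coeFn_toLp] with x hx
      rw [hx]
      exact Complex.zero_le_real.2 (le_max_right (k x) 0)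
    · rw [Lp_nonneg_iff']
      filter_upwards [(hk.neg_part.ofReal (K := ℂ)).coeFn_toLp] with x hx
      rw [hx]
      exact Complex.zero_le_real.2 (le_max_right (-k x) 0)
    · refine (Lp.coeFn_sub _ _).trans ?_
      filter_upwards [(hk.pos_part.ofReal (K := ℂ)).coeFn_toLp,
        (hk.neg_part.ofReal (K := ℂ)).coeFn_toLp] with x h1 h2
      rw [Pi.sub_apply, h1, h2]
      have : k x = max (k x) 0 - max (-k x) 0 := by
        rcases le_total (k x) 0 with h | h
        · rw [max_eq_right h, max_eq_left (by linarith)]; ring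
        · rw [max_eq_left h, max_eq_right (by linarith)]; ring
      conv_rhs => rw [this]
      push_cast
      rfl
  obtain ⟨a, b, ha, hb, hab⟩ := key _ (Lp.memLp f).re
  obtain ⟨c, d, hc, hd, hcd⟩ := key _ (Lp.memLp f).im
  refine ⟨a, b, c, d, ⟨ha, hb, hc, hd⟩, ?_⟩
  apply Lp.ext
  filter_upwards [hab, hcd, Lp.coeFn_add (a - b) (Complex.I • (c - d)),
    Lp.coeFn_smul Complex.I (c - d)] with x h1 h2 h3 h4
  rw [h3, Pi.add_apply, h4, Pi.smul_apply, h1, h2, smul_eq_mul, mul_comm Complex.I]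
  exact (Complex.re_add_im _).symm

theorem induction_on_nonneg {P : Lp ℂ 2 μ → Prop} (h0 : ∀ f, 0 ≤ f → P f)
    (hadd : ∀ f g, P f → P g → P (f + g)) (hsmul : ∀ (c : ℂ) f, P f → P (c • f)) (f : Lp ℂ 2 μ) :
    P f := by
  obtain ⟨a, b, c, d, ⟨ha, hb, hc, hd⟩, rfl⟩ := exists_nonneg_decomposition f
  have hsub : ∀ f g, P f → P g → P (f - g) := by
    intro f g hf hg
    have := hadd f ((-1 : ℂ) • g) hf (hsmul _ _ hg)
    rwa [neg_one_smul, ← sub_eq_add_neg] at this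
  exact hadd _ _ (hsub _ _ (h0 a ha) (h0 b hb)) (hsmul _ _ (hsub _ _ (h0 c hc) (h0 d hd)))

/-- Strong limits of positive self-adjoint semigroups that are squeezed between two
`C₀`-semigroups. -/
theorem IsPositiveSymmetricSemigroup.of_tendsto {A : ℕ → ℝ≥0 → Lp ℂ 2 μ →L[ℂ] Lp ℂ 2 μ}
    (hA : ∀ n, IsPositiveSymmetricSemigroup (A n)) {L U B : ℝ≥0 → Lp ℂ 2 μ →L[ℂ] Lp ℂ 2 μ}
    (hL : IsC0Semigroup L) (hU : IsC0Semigroup U)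
    (hB : ∀ t f, Tendsto (fun n => A n t f) atTop (𝓝 (B t f)))
    (hLB : ∀ t f, 0 ≤ f → L t f ≤ B t f) (hBU : ∀ t f, 0 ≤ f → B t f ≤ U t f) :
    IsPositiveSymmetricSemigroup B := by
  have hpos : ∀ t, IsPositiveOperator (B t) := by
    intro t
    rw [isPositiveOperator_iff]
    intro f hf
    exact ge_of_tendsto' (α := Lp ℂ 2 μ) (hB t f) fun n => ((hA n).pos t).map_nonneg hf
  have hsa : ∀ t, IsSelfAdjoint (B t) := by
    intro t
    rw [ContinuousLinearMap.isSelfAdjoint_iff_isSymmetric]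
    intro f g
    have h1 := (hB t f).inner (𝕜 := ℂ) (tendsto_const_nhds (x := g))
    have h2 := (tendsto_const_nhds (x := f)).inner (𝕜 := ℂ) (hB t g)
    refine tendsto_nhds_unique h1 (h2.congr fun n => ?_)
    exact ((ContinuousLinearMap.isSelfAdjoint_iff_isSymmetric.1 ((hA n).sa t)) f g).symm
  refine ⟨IsC0Semigroup.of_tendsto_zero ?_ ?_ ?_ ?_, hpos, hsa⟩
  · ext1 f
    have := hB 0 f
    simp only [(hA _).isC0.map_zero] at this
    exact tendsto_nhds_unique this tendsto_const_nhds
  · intro s t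
    ext1 f
    have h1 := hB (s + t) f
    simp only [(hA _).isC0.map_add_apply] at h1
    exact tendsto_nhds_unique h1 (tendsto_apply_of_tendsto (hB s) (hB t f))
  · intro τ
    obtain ⟨C, -, hC⟩ := hU.exists_bound_Icc τ
    exact ⟨C, fun t ht => ((hpos t).opNorm_le (hBU t)).trans (hC t ht)⟩
  · refine induction_on_nonneg ?_ ?_ ?_
    · intro f hf
      have hL0 : Tendsto (fun t => L t f) (𝓝 0) (𝓝 f) :=
        (hL.strongly_continuous f).tendsto' 0 f (by simp [hL.map_zero])
      have hU0 : Tendsto (fun t => U t f) (𝓝 0) (𝓝 f) :=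
        (hU.strongly_continuous f).tendsto' 0 f (by simp [hU.map_zero])
      -- Squeezing: 0 ≤ B(t)f - L(t)f ≤ U(t)f - L(t)f, and the right-hand side tends to 0 in norm as
      -- t → 0.
      have h1 : Tendsto (fun t => B t f - L t f) (𝓝 0) (𝓝 0) := by
        refine squeeze_zero_norm (a := fun t => ‖U t f - L t f‖) (fun t => ?_) ?_
        · exact Lp_norm_le_norm (sub_nonneg.2 (hLB t f hf)) (sub_le_sub_right (hBU t f hf) _)
        · simpa using (hU0.sub hL0).norm
      simpa using h1.add hL0
    · intro f g hf hg
      simpa only [map_add] using hf.add hg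
    · intro c f hf
      simpa only [map_smul] using hf.const_smul c

end MonotoneLimits

/-! ### Admissible potentials and existence of the limit semigroups -/

section Admissible

variable {Ω : Type*} [MeasurableSpace Ω] {μ : Measure Ω}
  {T : ℝ≥0 → Lp ℂ 2 μ →L[ℂ] Lp ℂ 2 μ} {V W : Ω → ℝ}

/-- The truncation `(V ∧ a) ∨ (-a)` at a real level. -/
def realTruncation (V : Ω → ℝ) (a : ℝ) : Ω → ℝ := fun x => max (min (V x) a) (-a)

omit [MeasurableSpace Ω] in
theorem truncation_eq (V : Ω → ℝ) (n : ℕ) : truncation V n = realTruncation V n := rfl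

theorem isBddMeasurable_realTruncation (hV : Measurable V) (a : ℝ) :
    IsBddMeasurable (realTruncation V a) := by
  refine ⟨(hV.min measurable_const).max measurable_const, |a|, abs_nonneg a, fun x => ?_⟩
  unfold realTruncation
  rw [abs_le]
  constructor
  · exact (neg_le_neg (le_abs_self a)).trans (le_max_right _ _)
  · exact max_le ((min_le_right _ _).trans (le_abs_self a)) (neg_le_abs a)

theorem isBddMeasurable_truncation (hV : Measurable V) (n : ℕ) :
    IsBddMeasurable (truncation V n) := isBddMeasurable_realTruncation hV n

theorem IsBddMeasurable.add (hV : IsBddMeasurable V) (hW : IsBddMeasurable W) :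
    IsBddMeasurable fun x => V x + W x := by
  obtain ⟨C, hC0, hC⟩ := hV.bounded
  obtain ⟨D, hD0, hD⟩ := hW.bounded
  exact ⟨hV.measurable.add hW.measurable, C + D, by positivity, fun x =>
    (abs_add_le _ _).trans (add_le_add (hC x) (hD x))⟩

omit [MeasurableSpace Ω] in
theorem realTruncation_mono {V W : Ω → ℝ} (h : ∀ x, V x ≤ W x) (a : ℝ) (x : Ω) :
    realTruncation V a x ≤ realTruncation W a x :=
  max_le_max (min_le_min (h x) le_rfl) le_rfl

omit [MeasurableSpace Ω] in
theorem realTruncation_of_nonneg (h : ∀ x, 0 ≤ V x) {a : ℝ} (ha : 0 ≤ a) (x : Ω) :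
    realTruncation V a x = min (V x) a :=
  max_eq_left ((neg_nonpos.2 ha).trans (le_min (h x) ha))

omit [MeasurableSpace Ω] in
theorem realTruncation_of_nonpos (h : ∀ x, V x ≤ 0) {a : ℝ} (ha : 0 ≤ a) (x : Ω) :
    realTruncation V a x = max (V x) (-a) := by
  unfold realTruncation
  rw [min_eq_left ((h x).trans ha)]

omit [MeasurableSpace Ω] in
-- The positive and negative parts can be truncated independently. This allows the negative level to
-- be frozen while the positive one grows.
theorem realTruncation_eq_add (V : Ω → ℝ) {a : ℝ} (ha : 0 ≤ a) (x : Ω) :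
    realTruncation V a x = realTruncation (fun x => -max (-V x) 0) a x +
      realTruncation (fun x => max (V x) 0) a x := by
  rw [realTruncation_of_nonneg (fun x => le_max_right _ _) ha,
    realTruncation_of_nonpos (fun x => neg_nonpos.2 (le_max_right _ _)) ha]
  unfold realTruncation
  rcases le_total (V x) 0 with h | h
  · rw [min_eq_left (h.trans ha), max_eq_left (by linarith : (0 : ℝ) ≤ -V x), neg_neg,
      max_eq_right h, min_eq_left ha, add_zero]
  · rw [max_eq_right (by linarith : -V x ≤ 0), neg_zero, max_eq_left (neg_nonpos.2 ha),
      max_eq_left h, zero_add, max_eq_left]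
    exact (neg_nonpos.2 ha).trans (le_min h ha)

omit [MeasurableSpace Ω] in
theorem realTruncation_monotone_of_nonneg (h : ∀ x, 0 ≤ V x) {a b : ℝ} (ha : 0 ≤ a) (hab : a ≤ b)
    (x : Ω) : realTruncation V a x ≤ realTruncation V b x := by
  rw [realTruncation_of_nonneg h ha, realTruncation_of_nonneg h (ha.trans hab)]
  exact min_le_min le_rfl hab

omit [MeasurableSpace Ω] in
theorem realTruncation_antitone_of_nonpos (h : ∀ x, V x ≤ 0) {a b : ℝ} (ha : 0 ≤ a) (hab : a ≤ b)
    (x : Ω) : realTruncation V b x ≤ realTruncation V a x := by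
  rw [realTruncation_of_nonpos h ha, realTruncation_of_nonpos h (ha.trans hab)]
  exact max_le_max le_rfl (neg_le_neg hab)

theorem boundedPerturbation_zero (hT : IsPositiveSymmetricSemigroup T) (t : ℝ≥0) (f : Lp ℂ 2 μ) :
    boundedPerturbation T (fun _ => 0) t f = T t f := by
  simpa using boundedPerturbation_const hT 0 t f

theorem boundedPerturbation_le_self (hT : IsPositiveSymmetricSemigroup T) (hV : IsBddMeasurable V)
    (h : ∀ x, 0 ≤ V x) (t : ℝ≥0) {f : Lp ℂ 2 μ} (hf : 0 ≤ f) :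
    boundedPerturbation T V t f ≤ T t f := by
  rw [← boundedPerturbation_zero hT]
  exact boundedPerturbation_anti hT (IsBddMeasurable.const 0) hV h t hf

theorem self_le_boundedPerturbation (hT : IsPositiveSymmetricSemigroup T) (hV : IsBddMeasurable V)
    (h : ∀ x, V x ≤ 0) (t : ℝ≥0) {f : Lp ℂ 2 μ} (hf : 0 ≤ f) :
    T t f ≤ boundedPerturbation T V t f := by
  rw [← boundedPerturbation_zero hT]
  exact boundedPerturbation_anti hT hV (IsBddMeasurable.const 0) h t hf

/-- Pointwise convergence on nonnegative functions gives a strong limit. -/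
theorem exists_strong_limit {A : ℕ → ℝ≥0 → Lp ℂ 2 μ →L[ℂ] Lp ℂ 2 μ}
    (h : ∀ t f, 0 ≤ f → ∃ F, Tendsto (fun n => A n t f) atTop (𝓝 F)) :
    ∃ B : ℝ≥0 → Lp ℂ 2 μ →L[ℂ] Lp ℂ 2 μ, ∀ t f, Tendsto (fun n => A n t f) atTop (𝓝 (B t f)) := by
  have h' : ∀ t f, ∃ F, Tendsto (fun n => A n t f) atTop (𝓝 F) := by
    intro t
    refine induction_on_nonneg (h t) ?_ ?_
    · rintro f g ⟨F, hF⟩ ⟨G, hG⟩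
      exact ⟨F + G, by simpa only [map_add] using hF.add hG⟩
    · rintro c f ⟨F, hF⟩
      exact ⟨c • F, by simpa only [map_smul] using hF.const_smul c⟩
  choose F hF using h'
  refine ⟨fun t => continuousLinearMapOfTendsto (A · t) (f := F t)
    (tendsto_pi_nhds.2 fun f => hF t f), fun t f => hF t f⟩

/-- The truncated semigroups decrease, hence converge, and the limit is squeezed between T_W and T.
-/
theorem IsAdmissibleOneSigned.of_nonneg (hT : IsPositiveSymmetricSemigroup T)
    (hV : Measurable V) (hW : Measurable W) (h0 : ∀ x, 0 ≤ V x) (hVW : ∀ x, V x ≤ W x)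
    (h : IsAdmissibleOneSigned T W) : IsAdmissibleOneSigned T V := by
  obtain ⟨Q, hQ, hlim⟩ := h
  have hVn := fun n : ℕ => isBddMeasurable_truncation hV n
  have hps := fun n : ℕ => hT.boundedPerturbation (hVn n)
  obtain ⟨B, hB⟩ := exists_strong_limit (A := fun n => boundedPerturbation T (truncation V n))
    fun t f hf => exists_tendsto_of_antitone (fun n => ((hps n).pos t).map_nonneg hf)
      fun m n hmn => boundedPerturbation_anti hT (hVn m) (hVn n)
        (realTruncation_monotone_of_nonneg h0 m.cast_nonneg (by exact_mod_cast hmn)) t hf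
  refine ⟨B, (IsPositiveSymmetricSemigroup.of_tendsto hps hQ hT.isC0 hB ?_ ?_).isC0, hB⟩
  · intro t f hf
    exact le_of_tendsto_of_tendsto' (α := Lp ℂ 2 μ) (hlim t f) (hB t f) fun n =>
      boundedPerturbation_anti hT (hVn n) (isBddMeasurable_truncation hW n)
        (realTruncation_mono hVW n) t hf
  · intro t f hf
    refine le_of_tendsto' (α := Lp ℂ 2 μ) (hB t f) fun n =>
      boundedPerturbation_le_self hT (hVn n) (fun x => ?_) t hf
    rw [truncation_eq, realTruncation_of_nonneg h0 n.cast_nonneg]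
    exact le_min (h0 x) n.cast_nonneg

/-- Here the truncated semigroups increase. Convergence needs an upper bound, and T_W provides it.
-/
theorem IsAdmissibleOneSigned.of_nonpos (hT : IsPositiveSymmetricSemigroup T)
    (hV : Measurable V) (hW : Measurable W) (h0 : ∀ x, V x ≤ 0) (hVW : ∀ x, W x ≤ V x)
    (h : IsAdmissibleOneSigned T W) : IsAdmissibleOneSigned T V := by
  obtain ⟨Q, hQ, hlim⟩ := h
  have hVn := fun n : ℕ => isBddMeasurable_truncation hV n
  have hps := fun n : ℕ => hT.boundedPerturbation (hVn n)
  have hVQ : ∀ n t f, 0 ≤ f → boundedPerturbation T (truncation V n) t f ≤ Q t f := by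
    intro n t f hf
    refine ge_of_tendsto (α := Lp ℂ 2 μ) (hlim t f) ?_
    filter_upwards [eventually_ge_atTop n] with m hm
    refine boundedPerturbation_anti hT (isBddMeasurable_truncation hW m) (hVn n) (fun x => ?_) t hf
    exact (realTruncation_mono hVW m x).trans
      (realTruncation_antitone_of_nonpos h0 n.cast_nonneg (by exact_mod_cast hm) x)
  obtain ⟨B, hB⟩ := exists_strong_limit (A := fun n => boundedPerturbation T (truncation V n))
    fun t f hf => exists_tendsto_of_monotone (g := Q t f)
      (fun n => ((hps n).pos t).map_nonneg hf)
      (fun m n hmn => boundedPerturbation_anti hT (hVn n) (hVn m)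
        (realTruncation_antitone_of_nonpos h0 m.cast_nonneg (by exact_mod_cast hmn)) t hf)
      fun n => hVQ n t f hf
  refine ⟨B, (IsPositiveSymmetricSemigroup.of_tendsto hps hT.isC0 hQ hB ?_ ?_).isC0, hB⟩
  · intro t f hf
    refine ge_of_tendsto' (α := Lp ℂ 2 μ) (hB t f) fun n =>
      self_le_boundedPerturbation hT (hVn n) (fun x => ?_) t hf
    rw [truncation_eq, realTruncation_of_nonpos h0 n.cast_nonneg]
    exact max_le (h0 x) (neg_nonpos.2 n.cast_nonneg)
  · intro t f hf
    exact le_of_tendsto' (α := Lp ℂ 2 μ) (hB t f) fun n => hVQ n t f hf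

/-- For p > 1 both the positive and the negative part of V lie below those of pV. -/
theorem IsAdmissible.of_const_mul (hT : IsPositiveSymmetricSemigroup T) (hV : Measurable V) {p : ℝ}
    (hp : 1 < p) (h : IsAdmissible T fun x => p * V x) : IsAdmissible T V := by
  have key : ∀ y : ℝ, max y 0 ≤ max (p * y) 0 := by
    intro y
    rcases le_total y 0 with hy | hy
    · rw [max_eq_right hy]; exact le_max_right _ _
    · rw [max_eq_left hy]
      exact le_trans (by nlinarith) (le_max_left _ _)
  constructor
  · exact h.1.of_nonneg hT (hV.max measurable_const) ((hV.const_mul p).max measurable_const)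
      (fun x => le_max_right _ _) (fun x => key _)
  · refine h.2.of_nonpos hT (hV.neg.max measurable_const).neg
      ((hV.const_mul p).neg.max measurable_const).neg
      (fun x => neg_nonpos.2 (le_max_right _ _)) (fun x => neg_le_neg ?_)
    have := key (-V x)
    rw [mul_neg] at this
    exact this

/-- The limits along real truncation levels exist for admissible potentials. -/
theorem IsAdmissible.exists_limit (hT : IsPositiveSymmetricSemigroup T) (hV : Measurable V)
    (h : IsAdmissible T V) : ∃ S : ℝ≥0 → Lp ℂ 2 μ →L[ℂ] Lp ℂ 2 μ,
      IsPositiveSymmetricSemigroup S ∧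
      (∀ t f, Tendsto (fun a : ℝ => boundedPerturbation T (realTruncation V a) t f) atTop
        (𝓝 (S t f))) ∧
      ∃ ω : ℝ, 0 ≤ ω ∧ ∀ (t : ℝ≥0) (a : ℝ), 0 ≤ a →
        ‖boundedPerturbation T (realTruncation V a) t‖ ≤ Real.exp (ω * t) := by
  obtain ⟨⟨L, hL, hlimL⟩, ⟨U, hU, hlimU⟩⟩ := h
  set P : Ω → ℝ := fun x => max (V x) 0 with hP
  set N : Ω → ℝ := fun x => -max (-V x) 0 with hN
  have hPm : Measurable P := hV.max measurable_const
  have hNm : Measurable N := (hV.neg.max measurable_const).neg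
  have hP0 : ∀ x, 0 ≤ P x := fun x => le_max_right _ _
  have hN0 : ∀ x, N x ≤ 0 := fun x => neg_nonpos.2 (le_max_right _ _)
  have hPa := fun a : ℝ => isBddMeasurable_realTruncation hPm a
  have hNa := fun a : ℝ => isBddMeasurable_realTruncation hNm a
  have hVa := fun a : ℝ => isBddMeasurable_realTruncation hV a
  have hNneg : ∀ a : ℝ, 0 ≤ a → ∀ x, realTruncation N a x ≤ 0 := by
    intro a ha x
    rw [realTruncation_of_nonpos hN0 ha]
    exact max_le (hN0 x) (neg_nonpos.2 ha)
  have hPpos : ∀ a : ℝ, 0 ≤ a → ∀ x, 0 ≤ realTruncation P a x := by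
    intro a ha x
    rw [realTruncation_of_nonneg hP0 ha]
    exact le_min (hP0 x) ha
  have hUps : IsPositiveSymmetricSemigroup U := by
    refine IsPositiveSymmetricSemigroup.of_tendsto
      (fun n => hT.boundedPerturbation (isBddMeasurable_truncation hNm n)) hT.isC0 hU hlimU
      (fun t f hf => ?_) fun t f hf => le_rfl
    exact ge_of_tendsto' (α := Lp ℂ 2 μ) (hlimU t f) fun n => self_le_boundedPerturbation hT
      (isBddMeasurable_truncation hNm n) (hNneg n n.cast_nonneg) t hf
  have hNU : ∀ a : ℝ, 0 ≤ a → ∀ t f, 0 ≤ f →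
      boundedPerturbation T (realTruncation N a) t f ≤ U t f := by
    intro a ha t f hf
    refine ge_of_tendsto (α := Lp ℂ 2 μ) (hlimU t f) ?_
    filter_upwards [eventually_ge_atTop ⌈a⌉₊] with n hn
    exact boundedPerturbation_anti hT (isBddMeasurable_truncation hNm n) (hNa a)
      (realTruncation_antitone_of_nonpos hN0 ha (Nat.ceil_le.1 hn)) t hf
  have hVU : ∀ a : ℝ, 0 ≤ a → ∀ t f, 0 ≤ f →
      boundedPerturbation T (realTruncation V a) t f ≤ U t f := by
    intro a ha t f hf
    refine le_trans ?_ (hNU a ha t f hf)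
    refine boundedPerturbation_anti hT (hNa a) (hVa a) (fun x => ?_) t hf
    rw [realTruncation_eq_add V ha]
    exact le_add_of_nonneg_right (hPpos a ha x)
  have hps := fun a : ℝ => hT.boundedPerturbation (hVa a)
  have hcauchy : ∀ t f, 0 ≤ f →
      ∃ F, Tendsto (fun a : ℝ => boundedPerturbation T (realTruncation V a) t f) atTop (𝓝 F) := by
    intro t f hf
    refine cauchySeq_tendsto_of_complete (Metric.cauchySeq_iff'.2 fun ε hε => ?_)
    -- Freeze the negative part at a level m at which its semigroup is within ε/4 of the limit U on
    -- f. The positive part may then still vary freely.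
    obtain ⟨m, hm⟩ := (((hlimU t f).const_sub (U t f)).norm.eventually
      (gt_mem_nhds (show ‖U t f - U t f‖ < ε / 4 by simpa using by positivity))).exists
    have hm0 : (0 : ℝ) ≤ m := m.cast_nonneg
    set G : ℝ → Lp ℂ 2 μ := fun a =>
      boundedPerturbation T (fun x => realTruncation N m x + realTruncation P a x) t f with hG
    have hGb := fun a : ℝ => (hNa m).add (hPa a)
    -- Restricted to levels a ≥ 0, since the truncation of a nonnegative function is monotone in the
    -- level only there.
    have hGlim : ∃ F, Tendsto (fun a : Set.Ici (0 : ℝ) => G a) atTop (𝓝 F) := by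
      refine exists_tendsto_of_antitone
        (fun a => ((hT.boundedPerturbation (hGb a)).pos t).map_nonneg hf) fun a b hab => ?_
      exact boundedPerturbation_anti hT (hGb a) (hGb b) (fun x => add_le_add_right
        (realTruncation_monotone_of_nonneg hP0 a.2 hab x) _) t hf
    obtain ⟨F, hF⟩ := hGlim
    obtain ⟨K, hK⟩ := Metric.tendsto_atTop.1 hF (ε / 4) (by positivity)
    have hdist : ∀ a : ℝ, (m : ℝ) ≤ a →
        ‖boundedPerturbation T (realTruncation V a) t f - G a‖ < ε / 4 := by
      intro a hma
      have ha0 : 0 ≤ a := hm0.trans hma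
      have e : realTruncation V a = fun x => realTruncation N a x + realTruncation P a x :=
        funext (realTruncation_eq_add V ha0)
      have hanti := realTruncation_antitone_of_nonpos hN0 hm0 hma
      refine lt_of_le_of_lt ?_ hm
      refine Lp_norm_le_norm (sub_nonneg.2 ?_) ?_
      · rw [e]
        exact boundedPerturbation_anti hT ((hNa a).add (hPa a)) (hGb a)
          (fun x => add_le_add_left (hanti x) _) t hf
      · rw [e]
        -- The truncated positive part plays the role of the common absorption, so the error is at
        -- most U(t)f minus the semigroup at negative level m, uniformly in a.
        refine (boundedPerturbation_sub_le hT (hNa a) (hNa m) hanti (hPpos a ha0)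
          ((hNa a).add (hPa a)) (hGb a) t hf).trans ?_
        exact sub_le_sub_right (hNU a ha0 t f hf) _
    refine ⟨max K m, fun a ha => ?_⟩
    have hKa : K.1 ≤ a := (le_max_left _ _).trans ha
    have hma : (m : ℝ) ≤ a := (le_max_right _ _).trans ha
    have h1 := hdist a hma
    have h2 := hdist (max K m) (le_max_right _ _)
    have h3 := hK ⟨a, K.2.out.trans hKa⟩ hKa
    have h4 := hK ⟨max (K : ℝ) m, K.2.out.trans (le_max_left _ _)⟩ (le_max_left (K : ℝ) m)
    rw [← dist_eq_norm] at h1 h2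
    calc _ ≤ dist (boundedPerturbation T (realTruncation V a) t f) (G a) + dist (G a) F +
          dist F (G (max (K : ℝ) m)) + dist (G (max (K : ℝ) m))
            (boundedPerturbation T (realTruncation V (max (K : ℝ) m)) t f) :=
          (dist_triangle _ _ _).trans (add_le_add_left (dist_triangle4 _ _ _ _) _)
      _ < ε := by
          rw [dist_comm F, dist_comm (G (max (K : ℝ) m)) (boundedPerturbation _ _ _ _)]
          simp only at h3 h4
          linarith
  obtain ⟨B, hB⟩ := exists_strong_limit (A := fun n : ℕ =>
    boundedPerturbation T (realTruncation V n)) fun t f hf => by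
      obtain ⟨F, hF⟩ := hcauchy t f hf
      exact ⟨F, hF.comp tendsto_natCast_atTop_atTop⟩
  have hBreal : ∀ t f, Tendsto (fun a : ℝ => boundedPerturbation T (realTruncation V a) t f) atTop
      (𝓝 (B t f)) := by
    intro t
    refine induction_on_nonneg (fun f hf => ?_) ?_ ?_
    · obtain ⟨F, hF⟩ := hcauchy t f hf
      rwa [tendsto_nhds_unique (hB t f) (hF.comp tendsto_natCast_atTop_atTop)]
    · intro f g hf hg
      simpa only [map_add] using hf.add hg
    · intro c f hf
      simpa only [map_smul] using hf.const_smul c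
  refine ⟨B, IsPositiveSymmetricSemigroup.of_tendsto (fun n => hps n) hL hU hB ?_ ?_, hBreal, ?_⟩
  · intro t f hf
    refine le_of_tendsto_of_tendsto' (α := Lp ℂ 2 μ) (hlimL t f) (hB t f) fun n =>
      boundedPerturbation_anti hT (hVa n) (isBddMeasurable_truncation hPm n) (fun x => ?_) t hf
    exact realTruncation_mono (fun x => le_max_left _ _) n x
  · intro t f hf
    exact le_of_tendsto' (α := Lp ℂ 2 μ) (hB t f) fun n => hVU n n.cast_nonneg t f hf
  · obtain ⟨ω, hω, hb⟩ := hU.exists_norm_le_exp hUps.sa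
    exact ⟨ω, hω, fun t a ha => (((hps a).pos t).opNorm_le (hVU a ha t)).trans (hb t)⟩

theorem absorptionSemigroup_eq {S : ℝ≥0 → Lp ℂ 2 μ →L[ℂ] Lp ℂ 2 μ}
    (h : ∀ t f, Tendsto (fun a : ℝ => boundedPerturbation T (realTruncation V a) t f) atTop
        (𝓝 (S t f))) : absorptionSemigroup T V = S := by
  funext t
  have h1 : IsAbsorptionLimit T V t (S t) := fun f => (h t f).comp tendsto_natCast_atTop_atTop
  have hex : ∃ B, IsAbsorptionLimit T V t B := ⟨_, h1⟩
  rw [absorptionSemigroup, dif_pos hex]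
  ext1 f
  exact tendsto_nhds_unique (hex.choose_spec f) (h1 f)

end Admissible

/-! ### A Phragmén–Lindelöf principle on the half-plane -/

section PhragmenLindelof

/-- Shift by δ to reach the closed half-plane and divide by (1 + εz)ᵏ to be bounded on the positive
axis. On the imaginary axis the quotient is at most A e^(κδ), hence throughout. Let ε → 0, then δ →
0: neither κ nor the polynomial bound leaves a trace. -/
theorem norm_le_of_bound_on_right_half_plane {g : ℂ → ℂ}
    (hd : DifferentiableOn ℂ g {z | 0 < z.re}) {A κ C : ℝ} {k : ℕ} (hA : 0 ≤ A)
    (hκ : 0 ≤ κ) (hg : ∀ z : ℂ, 0 < z.re → ‖g z‖ ≤ A * Real.exp (κ * z.re))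
    (hre : ∀ x : ℝ, 1 ≤ x → ‖g x‖ ≤ C * x ^ k) {x : ℝ} (hx : 0 < x) : ‖g x‖ ≤ A := by
  have hC : 0 ≤ C := by
    have := (norm_nonneg _).trans (hre 1 le_rfl)
    simpa using this
  have h1 : ∀ δ ε y : ℝ, 0 < δ → 0 < ε → 0 ≤ y →
      ‖g (y + δ)‖ ≤ A * Real.exp (κ * δ) * (1 + ε * y) ^ k := by
    intro δ ε y hδ hε hy
    set h : ℂ → ℂ := fun z => g (z + δ) / (1 + ε * z) ^ k with hh
    have hden : ∀ z : ℂ, 0 ≤ z.re → 1 ≤ ‖1 + ε * z‖ := by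
      intro z hz
      have : 1 ≤ (1 + ε * z).re := by
        simp only [Complex.add_re, Complex.one_re, Complex.re_ofReal_mul]
        nlinarith
      exact this.trans (Complex.re_le_norm _)
    have hbd : ∀ z : ℂ, 0 ≤ z.re → ‖h z‖ ≤ A * Real.exp (κ * (z.re + δ)) := by
      intro z hz
      rw [hh, norm_div, norm_pow]
      have h2 := hg (z + δ) (by simp; linarith)
      simp only [Complex.add_re, Complex.ofReal_re] at h2
      exact (div_le_self (norm_nonneg _) (one_le_pow₀ (hden z hz))).trans h2
    have hdiff : DiffContOnCl ℂ h {z | 0 < z.re} := by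
      refine DifferentiableOn.diffContOnCl ?_
      rw [Complex.closure_setOfPred_lt_re]
      intro z hz
      have hz' : 0 ≤ z.re := hz
      have hgz : DifferentiableAt ℂ (fun z => g (z + δ)) z := by
        have : DifferentiableAt ℂ g (z + δ) := hd.differentiableAt
          ((isOpen_lt continuous_const Complex.continuous_re).mem_nhds (by
            simp; linarith))
        exact this.comp z (by fun_prop)
      have h0 : (1 : ℂ) + ε * z ≠ 0 := by
        intro h0
        have := hden z hz'
        rw [h0, norm_zero] at this
        linarith
      have hne : ((1 : ℂ) + ε * z) ^ k ≠ 0 := pow_ne_zero k h0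
      exact (hgz.div (by fun_prop) hne).differentiableWithinAt
    -- The growth is of exponential order 1, below the critical order 2 for boundedness assumed on
    -- the positive axis.
    have hmain := PhragmenLindelof.right_half_plane_of_bounded_on_real (C := A * Real.exp (κ * δ))
      hdiff ⟨1, one_lt_two, κ, ?_⟩ ?_ ?_ (z := (y : ℂ)) (by simpa using hy)
    · rw [hh, norm_div, norm_pow] at hmain
      have hpos : 0 < ‖(1 : ℂ) + ε * y‖ ^ k := by
        have := hden (y : ℂ) (by simpa using hy)
        positivity
      rw [div_le_iff₀ hpos] at hmain
      have e : ‖(1 : ℂ) + ε * y‖ = 1 + ε * y := by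
        have : (1 : ℂ) + ε * y = ((1 + ε * y : ℝ) : ℂ) := by push_cast; rfl
        rw [this, Complex.norm_real, Real.norm_of_nonneg (by positivity)]
      rwa [e] at hmain
    · refine Asymptotics.IsBigO.of_bound (A * Real.exp (κ * δ)) ?_
      filter_upwards [inf_le_right (a := Bornology.cobounded ℂ)
        (mem_principal_self {z : ℂ | 0 < z.re})] with z hz
      have hz' : 0 < z.re := hz
      refine (hbd z hz'.le).trans ?_
      rw [Real.norm_of_nonneg (Real.exp_pos _).le, Real.rpow_one, mul_assoc, ← Real.exp_add]
      refine mul_le_mul_of_nonneg_left (Real.exp_le_exp.2 ?_) hA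
      nlinarith [Complex.re_le_norm z]
    · refine isBoundedUnder_of_eventually_le (a := C * (1 / ε + δ) ^ k) ?_
      filter_upwards [eventually_ge_atTop 1] with y hy
      rw [hh, norm_div, norm_pow]
      have e : ‖(1 : ℂ) + ε * y‖ = 1 + ε * y := by
        have : (1 : ℂ) + ε * y = ((1 + ε * y : ℝ) : ℂ) := by push_cast; rfl
        rw [this, Complex.norm_real, Real.norm_of_nonneg (by positivity)]
      have e2 : (y : ℂ) + δ = ((y + δ : ℝ) : ℂ) := by push_cast; rfl
      rw [e, e2, div_le_iff₀ (by positivity)]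
      refine (hre (y + δ) (by linarith)).trans ?_
      rw [mul_assoc, ← mul_pow]
      refine mul_le_mul_of_nonneg_left (pow_le_pow_left₀ (by positivity) ?_ k) hC
      have : (1 / ε + δ) * (1 + ε * y) = y + δ + (1 / ε + δ * ε * y) := by field_simp; ring
      rw [this]
      have : 0 ≤ 1 / ε + δ * ε * y := by positivity
      linarith
    · intro y
      have := hbd (y * Complex.I) (by simp)
      simpa using this
  have h2 : ∀ δ y : ℝ, 0 < δ → 0 ≤ y → ‖g (y + δ)‖ ≤ A * Real.exp (κ * δ) := by
    intro δ y hδ hy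
    have hc : Continuous fun ε : ℝ => A * Real.exp (κ * δ) * (1 + ε * y) ^ k := by fun_prop
    have hlim : Tendsto (fun ε : ℝ => A * Real.exp (κ * δ) * (1 + ε * y) ^ k) (𝓝[>] 0)
        (𝓝 (A * Real.exp (κ * δ))) := (hc.tendsto' 0 _ (by simp)).mono_left nhdsWithin_le_nhds
    refine ge_of_tendsto hlim ?_
    exact eventually_nhdsWithin_of_forall (s := Set.Ioi 0) fun ε hε => h1 δ ε y hδ hε hy
  have hc : Continuous fun δ : ℝ => A * Real.exp (κ * δ) := by fun_prop
  have hlim : Tendsto (fun δ : ℝ => A * Real.exp (κ * δ)) (𝓝[>] 0) (𝓝 A) :=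
    (hc.tendsto' 0 A (by simp)).mono_left nhdsWithin_le_nhds
  refine ge_of_tendsto hlim ?_
  filter_upwards [Ioo_mem_nhdsGT hx] with δ hδ
  have := h2 δ (x - δ) hδ.1 (sub_nonneg.2 hδ.2.le)
  simpa using this

end PhragmenLindelof

/-! ### Holomorphic extension of self-adjoint contraction semigroups -/

section HolomorphicExtension

/-- The function `x ↦ x ^ z` used to define complex powers of positive operators. -/
def rePow (z : ℂ) : ℂ → ℂ := fun w => (w.re : ℂ) ^ z

theorem continuous_rePow {z : ℂ} (hz : 0 < z.re) : Continuous (rePow z) :=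
  (Complex.continuous_ofReal_cpow_const hz).comp Complex.continuous_re

/-- The derivative of `rePow z` with respect to the exponent. -/
def rePowLog (z : ℂ) : ℂ → ℂ := fun w => (w.re : ℂ) ^ z * Real.log w.re

theorem continuous_rePowLog {z : ℂ} (hz : 0 < z.re) : ContinuousOn (rePowLog z) {w | 0 ≤ w.re} := by
  have h : ContinuousOn (fun x : ℝ => (x : ℂ) ^ z * Real.log x) (Set.Ici 0) := by
    intro x hx
    rcases eq_or_lt_of_le (show 0 ≤ x from hx) with h | h
    · subst h
      rw [ContinuousWithinAt, Complex.ofReal_zero, Real.log_zero, Complex.ofReal_zero, mul_zero,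
        tendsto_zero_iff_norm_tendsto_zero, ← Set.Ioi_insert, nhdsWithin_insert, tendsto_sup]
      refine ⟨tendsto_pure_left.2 fun s hs => ?_, ?_⟩
      · simpa using mem_of_mem_nhds hs
      have := (tendsto_log_mul_rpow_nhdsGT_zero hz).norm
      rw [norm_zero] at this
      refine this.congr' ?_
      filter_upwards [self_mem_nhdsWithin] with y hy
      have hy' : 0 < y := hy
      rw [norm_mul, norm_mul, Complex.norm_cpow_eq_rpow_re_of_pos hy', Complex.norm_real,
        Real.norm_of_nonneg (Real.rpow_nonneg hy'.le _), mul_comm]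
    · refine ContinuousAt.continuousWithinAt ?_
      refine (Complex.continuous_ofReal_cpow_const hz).continuousAt.mul ?_
      exact Complex.continuous_ofReal.continuousAt.comp (Real.continuousAt_log h.ne')
  exact h.comp Complex.continuous_re.continuousOn fun w hw => hw

theorem sq_mul_exp_le {a L : ℝ} (ha : 0 < a) (hL : L ≤ 0) : L ^ 2 * Real.exp (a * L) ≤ 2 / a ^ 2 := by
  have h1 := Real.quadratic_le_exp_of_nonneg (x := a * -L) (by nlinarith)
  rw [le_div_iff₀ (by positivity)]
  have h2 : (a * L) ^ 2 ≤ 2 * Real.exp (a * -L) := by nlinarith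
  have h3 : Real.exp (a * -L) * Real.exp (a * L) = 1 := by
    rw [← Real.exp_add, show a * -L + a * L = 0 by ring, Real.exp_zero]
  calc L ^ 2 * Real.exp (a * L) * a ^ 2 = (a * L) ^ 2 * Real.exp (a * L) := by ring
    _ ≤ 2 * Real.exp (a * -L) * Real.exp (a * L) :=
      mul_le_mul_of_nonneg_right h2 (Real.exp_pos _).le
    _ = 2 := by rw [mul_assoc, h3, mul_one]

/-- A second-order Taylor bound uniform over the base in [0, 1]: half of Re z absorbs the factor
exp(‖h‖ |log x|), the other half the square of the logarithm. -/
theorem norm_rePow_sub_le {z h : ℂ} (hz : 0 < z.re) (hh : ‖h‖ ≤ z.re / 2) {w : ℂ} (h0 : 0 ≤ w.re)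
    (h1 : w.re ≤ 1) :
    ‖rePow (z + h) w - rePow z w - h * rePowLog z w‖ ≤ 8 / z.re ^ 2 * ‖h‖ ^ 2 := by
  unfold rePow rePowLog
  rcases eq_or_lt_of_le h0 with hw | hw
  · have e1 : z ≠ 0 := fun h => by simp [h] at hz
    have e2 : z + h ≠ 0 := fun h' => by
      have h3 := congrArg Complex.re h'
      have h4 := (abs_le.1 ((Complex.abs_re_le_norm h).trans hh)).1
      simp only [Complex.add_re, Complex.zero_re] at h3
      linarith
    rw [← hw]
    simp [Complex.zero_cpow e1, Complex.zero_cpow e2]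
    positivity
  · set x := w.re with hx
    have hx0 : (x : ℂ) ≠ 0 := by exact_mod_cast hw.ne'
    have hL : Real.log x ≤ 0 := Real.log_nonpos h0 h1
    have e : (x : ℂ) ^ (z + h) - (x : ℂ) ^ z - h * ((x : ℂ) ^ z * Real.log x) =
        (x : ℂ) ^ z * (Complex.exp (h * Real.log x) - ∑ m ∈ Finset.range 2,
          (h * Real.log x) ^ m / (m.factorial : ℂ)) := by
      rw [Complex.cpow_add _ _ hx0, Finset.sum_range_succ, Finset.sum_range_one,
        Complex.cpow_def_of_ne_zero hx0 h, ← Complex.ofReal_log h0, mul_comm (Real.log x : ℂ) h]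
      simp
      ring
    rw [e, norm_mul, Complex.norm_cpow_eq_rpow_re_of_pos hw]
    have h2 := Complex.norm_exp_sub_sum_le_norm_mul_exp (h * Real.log x) 2
    have h3 : ‖h * (Real.log x : ℂ)‖ = ‖h‖ * -Real.log x := by
      rw [norm_mul, Complex.norm_real, Real.norm_of_nonpos hL]
    rw [h3] at h2
    have h4 : x ^ z.re * Real.exp (‖h‖ * -Real.log x) ≤ Real.exp (z.re / 2 * Real.log x) := by
      rw [Real.rpow_def_of_pos hw, ← Real.exp_add]
      refine Real.exp_le_exp.2 ?_
      nlinarith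
    calc _ ≤ x ^ z.re * ((‖h‖ * -Real.log x) ^ 2 * Real.exp (‖h‖ * -Real.log x)) :=
          mul_le_mul_of_nonneg_left h2 (Real.rpow_nonneg h0 _)
      _ = ‖h‖ ^ 2 * (Real.log x ^ 2 * (x ^ z.re * Real.exp (‖h‖ * -Real.log x))) := by ring
      _ ≤ ‖h‖ ^ 2 * (Real.log x ^ 2 * Real.exp (z.re / 2 * Real.log x)) := by gcongr
      _ ≤ ‖h‖ ^ 2 * (2 / (z.re / 2) ^ 2) := by
          gcongr
          exact sq_mul_exp_le (by linarith) hL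
      _ = _ := by field_simp; ring

variable {H : Type*} [NormedAddCommGroup H] [InnerProductSpace ℂ H] [CompleteSpace H]
  {S : ℝ≥0 → H →L[ℂ] H}

theorem hasDerivAt_cfc_rePow {B : H →L[ℂ] H} [IsStarNormal B]
    (hB : ∀ w ∈ spectrum ℂ B, w = w.re ∧ 0 ≤ w.re ∧ w.re ≤ 1) {z : ℂ} (hz : 0 < z.re) :
    HasDerivAt (fun z => cfc (rePow z) B) (cfc (rePowLog z) B) z := by
  rw [hasDerivAt_iff_isLittleO_nhds_zero]
  refine Asymptotics.IsBigO.trans_isLittleO (g := fun h : ℂ => ‖h‖ ^ 2) ?_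
    (Asymptotics.isLittleO_norm_pow_id one_lt_two)
  refine Asymptotics.IsBigO.of_bound (8 / z.re ^ 2) ?_
  have : ∀ᶠ h : ℂ in 𝓝 0, ‖h‖ < z.re / 2 := by
    have : Tendsto (fun h : ℂ => ‖h‖) (𝓝 0) (𝓝 0) := tendsto_norm_zero
    exact this.eventually (gt_mem_nhds (by linarith))
  filter_upwards [this] with h hh
  have hzh : 0 < (z + h).re := by
    have h4 := (abs_le.1 ((Complex.abs_re_le_norm h).trans hh.le)).1
    simp only [Complex.add_re]
    linarith
  have c1 : ContinuousOn (rePow (z + h)) (spectrum ℂ B) := (continuous_rePow hzh).continuousOn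
  have c2 : ContinuousOn (rePow z) (spectrum ℂ B) := (continuous_rePow hz).continuousOn
  have c3 : ContinuousOn (rePowLog z) (spectrum ℂ B) :=
    (continuous_rePowLog hz).mono fun w hw => (hB w hw).2.1
  rw [← cfc_sub (rePow (z + h)) (rePow z) B c1 c2, ← cfc_smul h (rePowLog z) B c3,
    
    ← cfc_sub (fun x => rePow (z + h) x - rePow z x) (fun x => h • rePowLog z x) B (c1.sub c2)
      (c3.const_smul h), Real.norm_of_nonneg (by positivity)]
  refine norm_cfc_le (by positivity) fun w hw => ?_
  exact norm_rePow_sub_le hz hh.le (hB w hw).2.1 (hB w hw).2.2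

/-- S(t) = S(t/2)* S(t/2) is positive, and contractivity bounds its spectrum by 1. -/
theorem spectrum_selfAdjoint_contraction (hS : IsC0Semigroup S) (hsa : ∀ t, IsSelfAdjoint (S t))
    (hb : ∀ t, ‖S t‖ ≤ 1) (t : ℝ≥0) :
    ∀ w ∈ spectrum ℂ (S t), w = w.re ∧ 0 ≤ w.re ∧ w.re ≤ 1 := by
  intro w hw
  have h1 := (hsa t).mem_spectrum_eq_re hw
  have hw' : w.re ∈ spectrum ℝ (S t) := by
    rw [h1] at hw
    exact (spectrum.algebraMap_mem_iff ℂ).1 hw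
  refine ⟨h1, ?_, ?_⟩
  · have e : S t = star (S (t / 2)) * S (t / 2) := by
      rw [(hsa _).star_eq]
      have := hS.map_add (t / 2) (t / 2)
      rwa [add_halves] at this
    rw [e] at hw'
    exact spectrum_star_mul_self_nonneg _ hw'
  · rcases subsingleton_or_nontrivial H with hH | hH
    · have : Subsingleton (H →L[ℂ] H) := inferInstance
      rw [spectrum.of_subsingleton] at hw
      exact hw.elim
    · exact (Complex.re_le_norm w).trans ((spectrum.norm_le_norm_of_mem hw).trans (hb t))

/-- The extension is S(1)^z in the functional calculus. For t = m/n it agrees with S(t) because S(1)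
and S(m/n) are the n-th and m-th powers of S(1/n); continuity covers the remaining t. -/
theorem exists_holomorphic_extension (hS : IsC0Semigroup S) (hsa : ∀ t, IsSelfAdjoint (S t))
    (hb : ∀ t, ‖S t‖ ≤ 1) : ∃ Z : ℂ → H →L[ℂ] H, DifferentiableOn ℂ Z {z | 0 < z.re} ∧
      (∀ z : ℂ, 0 < z.re → ‖Z z‖ ≤ 1) ∧ ∀ t : ℝ≥0, 0 < t → Z (t : ℝ) = S t := by
  have hn : ∀ t, IsStarNormal (S t) := fun t => (hsa t).isStarNormal
  have hsp := spectrum_selfAdjoint_contraction hS hsa hb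
  have hder : ∀ z : ℂ, 0 < z.re → HasDerivAt (fun z => cfc (rePow z) (S 1))
      (cfc (rePowLog z) (S 1)) z := fun z hz => hasDerivAt_cfc_rePow (hsp 1) hz
  refine ⟨fun z => cfc (rePow z) (S 1),
    fun z hz => (hder z hz).differentiableAt.differentiableWithinAt, fun z hz => ?_, ?_⟩
  · refine norm_cfc_le zero_le_one fun w hw => ?_
    obtain ⟨-, h0, h1⟩ := hsp 1 w hw
    rw [rePow, Complex.norm_cpow_eq_rpow_re_of_nonneg h0 hz.ne']
    exact Real.rpow_le_one h0 h1 hz.le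
  · have hrat : ∀ m n : ℕ, 0 < m → 0 < n →
        cfc (rePow ((m / n : ℝ≥0) : ℝ)) (S 1) = S (m / n) := by
      intro m n hm hn0
      have hn' : (n : ℝ≥0) ≠ 0 := by exact_mod_cast hn0.ne'
      have e1 : S 1 = S (1 / n) ^ n := by
        rw [← hS.map_nsmul_eq_pow, mul_one_div_cancel hn']
      have e2 : S (m / n) = S (1 / n) ^ m := by
        rw [← hS.map_nsmul_eq_pow, mul_one_div]
      have hz : 0 < (((m / n : ℝ≥0) : ℝ) : ℂ).re := by
        rw [Complex.ofReal_re, NNReal.coe_pos]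
        positivity
      rw [e1, e2, ← cfc_comp_pow _ n (S (1 / n)) (continuous_rePow hz).continuousOn,
        ← cfc_pow_id (R := ℂ) (S (1 / n)) m]
      refine cfc_congr fun w hw => ?_
      obtain ⟨h1, h0, -⟩ := hsp _ w hw
      simp only [rePow]
      rw [h1, ← Complex.ofReal_pow, ← Complex.ofReal_pow, Complex.ofReal_re,
        ← Complex.ofReal_cpow (pow_nonneg (by simpa using h0) _)]
      congr 1
      rw [← Real.rpow_natCast, ← Real.rpow_mul (by simpa using h0), ← Real.rpow_natCast]
      congr 1
      push_cast
      have : (n : ℝ) ≠ 0 := by exact_mod_cast hn0.ne'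
      field_simp
    intro t ht
    ext1 f
    have ht' : 0 < (t : ℝ) := NNReal.coe_pos.2 ht
    have hq : Tendsto (fun n : ℕ => (((⌊(t : ℝ) * n⌋₊ / n : ℝ≥0)) : ℝ)) atTop (𝓝 (t : ℝ)) := by
      have := (tendsto_nat_floor_mul_div_atTop ht'.le).comp tendsto_natCast_atTop_atTop
      refine this.congr fun n => ?_
      push_cast
      rfl
    have h1 : Tendsto (fun n : ℕ => S (⌊(t : ℝ) * n⌋₊ / n) f) atTop (𝓝 (S t f)) :=
      ((hS.strongly_continuous f).tendsto t).comp (NNReal.tendsto_coe.1 hq)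
    have hzc : ContinuousAt (fun z => cfc (rePow z) (S 1)) ((t : ℝ) : ℂ) :=
      (hder _ (by simpa using ht)).continuousAt
    have h2 : Tendsto (fun n : ℕ => cfc (rePow (((⌊(t : ℝ) * n⌋₊ / n : ℝ≥0) : ℝ) : ℂ)) (S 1) f)
        atTop (𝓝 (cfc (rePow ((t : ℝ) : ℂ)) (S 1) f)) := by
      have h3 := hzc.tendsto.comp ((Complex.continuous_ofReal.tendsto _).comp hq)
      exact ((ContinuousLinearMap.apply ℂ H f).continuous.tendsto _).comp h3
    refine tendsto_nhds_unique h2 (h1.congr' ?_)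
    filter_upwards [eventually_gt_atTop 0, hq.eventually (lt_mem_nhds ht')] with n hn0 hn1
    have hm : 0 < ⌊(t : ℝ) * n⌋₊ := by
      rcases Nat.eq_zero_or_pos ⌊(t : ℝ) * n⌋₊ with h | h
      · rw [h] at hn1; simp at hn1
      · exact h
    rw [hrat _ _ hm hn0]

/-- If the twisted matrix coefficients of a self-adjoint contraction semigroup grow at most
polynomially as `t → 0`, up to the factor `exp (α² t)`, then they obey the sharp bound. -/
theorem norm_inner_twisted_le (hS : IsC0Semigroup S) (hsa : ∀ t, IsSelfAdjoint (S t))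
    (hb : ∀ t, ‖S t‖ ≤ 1) {E : ℂ → H →L[ℂ] H} (hE : Differentiable ℂ E) {R : ℝ} (hR : 0 ≤ R)
    (hEn : ∀ z, ‖E z‖ ≤ Real.exp (R * |z.re|)) {u v : H} {C : ℝ} {k : ℕ}
    (h : ∀ t : ℝ≥0, 0 < t → t ≤ 1 → ∀ α : ℝ,
      ‖inner ℂ v (E (-α) (S t (E α u)))‖ ≤ C * (t : ℝ)⁻¹ ^ k * Real.exp (α ^ 2 * t))
    {t : ℝ≥0} (ht : 0 < t) (α : ℝ) :
    ‖inner ℂ v (E (-α) (S t (E α u)))‖ ≤ Real.exp (α ^ 2 * t) * (‖v‖ * ‖u‖) := by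
  obtain ⟨Z, hZd, hZb, hZS⟩ := exists_holomorphic_extension hS hsa hb
  have ht' : 0 < (t : ℝ) := NNReal.coe_pos.2 ht
  set l : ℝ := α * t with hl
  -- The inversion s = 1/r, with the twist parameter l/r proportional to s: the growth exp((l/r)² r)
  -- equals exp(l² s), cancelled exactly by the last factor. A singularity r^(-k) as r → 0 becomes
  -- growth sᵏ at infinity. The choice l = αt makes the parameter equal to α at s = 1/t.
  set g : ℂ → ℂ := fun s =>
    inner ℂ v ((E (-(l * s)) * Z s⁻¹ * E (l * s)) u) * Complex.exp (-(l ^ 2 * s)) with hg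
  have hinv : ∀ s : ℂ, 0 < s.re → 0 < (s⁻¹).re := by
    intro s hs
    rw [Complex.inv_re]
    refine div_pos hs (Complex.normSq_pos.2 ?_)
    rintro rfl
    simp at hs
  have hgd : DifferentiableOn ℂ g {z | 0 < z.re} := by
    intro s hs
    have hs' : 0 < s.re := hs
    have hs0 : s ≠ 0 := by rintro rfl; simp at hs'
    have d1 : DifferentiableAt ℂ (fun s => Z s⁻¹) s := by
      have : DifferentiableAt ℂ Z s⁻¹ := hZd.differentiableAt
        ((isOpen_lt continuous_const Complex.continuous_re).mem_nhds (hinv s hs'))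
      exact this.comp s (differentiableAt_inv hs0)
    have d2 : DifferentiableAt ℂ (fun s => E (-(l * s))) s :=
      (hE _).comp s (by fun_prop)
    have d3 : DifferentiableAt ℂ (fun s => E (l * s)) s :=
      (hE _).comp s (by fun_prop)
    have d4 : DifferentiableAt ℂ (fun s => (E (-(l * s)) * Z s⁻¹ * E (l * s)) u) s :=
      ((d2.mul d1).mul d3).clm_apply (differentiableAt_const u)
    have d5 : DifferentiableAt ℂ
        (fun s => inner ℂ v ((E (-(l * s)) * Z s⁻¹ * E (l * s)) u)) s :=
      (innerSL ℂ v).differentiableAt.comp s d4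
    exact (d5.mul (by fun_prop)).differentiableWithinAt
  have hgb : ∀ s : ℂ, 0 < s.re → ‖g s‖ ≤ (‖v‖ * ‖u‖) * Real.exp (2 * R * |l| * s.re) := by
    intro s hs
    have n1 : ‖E (-(l * s))‖ ≤ Real.exp (R * (|l| * s.re)) := by
      have := hEn (-(l * s))
      rwa [Complex.neg_re, abs_neg, Complex.re_ofReal_mul, abs_mul, abs_of_pos hs] at this
    have n2 : ‖E (l * s)‖ ≤ Real.exp (R * (|l| * s.re)) := by
      have := hEn (l * s)
      rwa [Complex.re_ofReal_mul, abs_mul, abs_of_pos hs] at this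
    have n3 : ‖Complex.exp (-(l ^ 2 * s))‖ ≤ 1 := by
      rw [Complex.norm_exp, Real.exp_le_one_iff, Complex.neg_re, ← Complex.ofReal_pow,
        Complex.re_ofReal_mul]
      have := mul_nonneg (sq_nonneg l) hs.le
      linarith
    have n4 : ‖E (-(l * s)) * Z s⁻¹ * E (l * s)‖ ≤ Real.exp (2 * R * |l| * s.re) := by
      calc _ ≤ ‖E (-(l * s))‖ * ‖Z s⁻¹‖ * ‖E (l * s)‖ :=
            (norm_mul_le _ _).trans (mul_le_mul_of_nonneg_right (norm_mul_le _ _) (norm_nonneg _))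
        _ ≤ Real.exp (R * (|l| * s.re)) * 1 * Real.exp (R * (|l| * s.re)) := by
            gcongr
            exact hZb _ (hinv s hs)
        _ = _ := by rw [mul_one, ← Real.exp_add]; congr 1; ring
    calc ‖g s‖ = ‖inner ℂ v ((E (-(l * s)) * Z s⁻¹ * E (l * s)) u)‖ *
          ‖Complex.exp (-(l ^ 2 * s))‖ := norm_mul _ _
      _ ≤ ‖inner ℂ v ((E (-(l * s)) * Z s⁻¹ * E (l * s)) u)‖ * 1 := by gcongr
      _ ≤ ‖v‖ * (Real.exp (2 * R * |l| * s.re) * ‖u‖) := by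
          rw [mul_one]
          exact (norm_inner_le_norm _ _).trans (mul_le_mul_of_nonneg_left
            (ContinuousLinearMap.le_of_opNorm_le _ n4 _) (norm_nonneg _))
      _ = _ := by ring
  have hval : ∀ r : ℝ≥0, 0 < r → ‖g ((r : ℝ)⁻¹ : ℝ)‖ =
      ‖inner ℂ v (E (-(l * (r : ℝ)⁻¹ : ℝ)) (S r (E (l * (r : ℝ)⁻¹ : ℝ) u)))‖ *
        Real.exp (-(l ^ 2 * (r : ℝ)⁻¹)) := by
    intro r hr
    rw [hg]
    simp only
    rw [norm_mul, Complex.norm_exp]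
    congr 2
    · rw [← Complex.ofReal_inv, inv_inv, hZS r hr, ← Complex.ofReal_mul]
      rfl
    · rw [← Complex.ofReal_pow, ← Complex.ofReal_mul, ← Complex.ofReal_neg, Complex.ofReal_re]
  have hre : ∀ x : ℝ, 1 ≤ x → ‖g x‖ ≤ C * x ^ k := by
    intro x hx
    have hx0 : 0 < x := by linarith
    have hr : 0 < Real.toNNReal x⁻¹ := Real.toNNReal_pos.2 (inv_pos.2 hx0)
    have hrc : ((Real.toNNReal x⁻¹ : ℝ≥0) : ℝ) = x⁻¹ := Real.coe_toNNReal _ (inv_pos.2 hx0).le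
    have h1 := hval _ hr
    have h2 := h _ hr (by
      rw [← NNReal.coe_le_coe, hrc]
      exact inv_le_one_of_one_le₀ hx) (l * x)
    rw [hrc, inv_inv] at h1 h2
    rw [h1]
    calc _ ≤ C * x ^ k * Real.exp ((l * x) ^ 2 * x⁻¹) * Real.exp (-(l ^ 2 * x)) :=
          mul_le_mul_of_nonneg_right h2 (Real.exp_pos _).le
      _ = C * x ^ k := by
          rw [mul_assoc, ← Real.exp_add]
          have : (l * x) ^ 2 * x⁻¹ + -(l ^ 2 * x) = 0 := by field_simp; ring
          rw [this, Real.exp_zero, mul_one]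
  have hfin := norm_le_of_bound_on_right_half_plane hgd (by positivity) (by positivity) hgb hre
    (x := (t : ℝ)⁻¹) (inv_pos.2 ht')
  rw [hval t ht, show l * (t : ℝ)⁻¹ = α by rw [hl]; field_simp,
    show l ^ 2 * (t : ℝ)⁻¹ = α ^ 2 * t by rw [hl]; field_simp, Real.exp_neg, ← div_eq_mul_inv,
    div_le_iff₀ (Real.exp_pos _)] at hfin
  linarith

end HolomorphicExtension

/-! ### Weighted norms and reduction to cut-off functions -/

section WeightedNorm

variable {Ω : Type*} [MeasurableSpace Ω] {μ : Measure Ω}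

/-- The norm `‖w⁻¹ g‖_r` of an `L₂`-function. -/
def weightedNorm (w : Ω → ℝ) (r : ℝ≥0∞) (g : Lp ℂ 2 μ) : ℝ≥0∞ :=
  eLpNorm (fun x => (w x : ℂ)⁻¹ * g x) r μ

variable {w : Ω → ℝ} {r q : ℝ≥0∞} {A : Lp ℂ 2 μ →L[ℂ] Lp ℂ 2 μ}

theorem aestronglyMeasurable_weight_mul (hw : Measurable w) (g : Lp ℂ 2 μ) :
    AEStronglyMeasurable (fun x => (w x : ℂ)⁻¹ * g x) μ :=
  (Complex.measurable_ofReal.comp hw).inv.aestronglyMeasurable.mul (Lp.aestronglyMeasurable g)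

theorem weightedNorm_mono {f g : Lp ℂ 2 μ} (h : ∀ᵐ x ∂μ, ‖f x‖ ≤ ‖g x‖) :
    weightedNorm w r f ≤ weightedNorm w r g := by
  refine eLpNorm_mono_ae ?_
  filter_upwards [h] with x hx
  rw [norm_mul, norm_mul]
  gcongr

theorem weightedNorm_absLp (f : Lp ℂ 2 μ) : weightedNorm w r (absLp f) = weightedNorm w r f := by
  refine le_antisymm (weightedNorm_mono ?_) (weightedNorm_mono ?_) <;>
  · filter_upwards [absLp_ae f] with x hx
    rw [hx]; simp

theorem weightedNorm_smul (c : ℂ) (f : Lp ℂ 2 μ) :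
    weightedNorm w r (c • f) = ‖c‖ₑ * weightedNorm w r f := by
  rw [weightedNorm, weightedNorm, ← eLpNorm_const_smul]
  refine eLpNorm_congr_ae ?_
  filter_upwards [Lp.coeFn_smul c f] with x hx
  rw [hx]
  simp only [Pi.smul_apply, smul_eq_mul]
  ring

theorem weightedNorm_zero : weightedNorm w r (0 : Lp ℂ 2 μ) = 0 := by
  rw [weightedNorm]
  refine (eLpNorm_congr_ae ?_).trans eLpNorm_zero
  filter_upwards [Lp.coeFn_zero ℂ 2 μ] with x hx
  rw [hx]; simp

theorem eq_zero_of_weightedNorm_eq_zero (hw : Measurable w) (hpos : ∀ x, 0 < w x) (hr : r ≠ 0)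
    {g : Lp ℂ 2 μ} (h : weightedNorm w r g = 0) : g = 0 := by
  rw [weightedNorm, eLpNorm_eq_zero_iff (aestronglyMeasurable_weight_mul hw g) hr] at h
  apply Lp.ext
  filter_upwards [h, Lp.coeFn_zero ℂ 2 μ] with x h1 h2
  rw [h2]
  have : (w x : ℂ)⁻¹ ≠ 0 := inv_ne_zero (by exact_mod_cast (hpos x).ne')
  exact (mul_eq_zero.1 h1).resolve_left this

/-- By homogeneity the supremum over the unit ball becomes an inequality on all of L₂, with infinite
norms allowed. K ≠ 0 rules out the product 0 · ∞ = 0. -/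
theorem weightedNorm_le_of_weightedOpNorm_le (hw : Measurable w) (hpos : ∀ x, 0 < w x)
    {K : ℝ≥0∞} (hK : weightedOpNorm A w 1 r ≤ K) (hK0 : K ≠ 0) (g : Lp ℂ 2 μ) :
    weightedNorm w r (A g) ≤ K * weightedNorm w 1 g := by
  by_cases h0 : weightedNorm w 1 g = 0
  · rw [eq_zero_of_weightedNorm_eq_zero hw hpos one_ne_zero h0, map_zero, weightedNorm_zero]
    exact zero_le
  by_cases h1 : weightedNorm w 1 g = ∞
  · rw [h1, ENNReal.mul_top hK0]; exact le_top
  set s : ℝ := (weightedNorm w 1 g).toReal with hs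
  have hs0 : 0 < s := ENNReal.toReal_pos h0 h1
  set g' : Lp ℂ 2 μ := ((s⁻¹ : ℝ) : ℂ) • g with hg'
  have hsn : ‖((s⁻¹ : ℝ) : ℂ)‖ₑ = (weightedNorm w 1 g)⁻¹ := by
    rw [← ofReal_norm, Complex.norm_real, Real.norm_of_nonneg (inv_pos.2 hs0).le,
      ENNReal.ofReal_inv_of_pos hs0, ENNReal.ofReal_toReal h1]
  have hn : weightedNorm w 1 g' = 1 := by
    rw [hg', weightedNorm_smul, hsn, ENNReal.inv_mul_cancel h0 h1]
  have hwx : ∀ x, (w x : ℂ) ≠ 0 := fun x => by exact_mod_cast (hpos x).ne'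
  have e : (fun x => (w x : ℂ) * ((w x : ℂ)⁻¹ * g' x)) = g' := by
    ext x; rw [mul_inv_cancel_left₀ (hwx x)]
  have hm : MemLp (fun x => (w x : ℂ) * ((w x : ℂ)⁻¹ * g' x)) 2 μ := by
    rw [e]; exact Lp.memLp g'
  have e2 : hm.toLp _ = g' := by
    apply Lp.ext
    filter_upwards [hm.coeFn_toLp] with x hx
    rw [hx, mul_inv_cancel_left₀ (hwx x)]
  have h2 : eLpNorm (fun x => (w x : ℂ)⁻¹ * A (hm.toLp _) x) r μ ≤ weightedOpNorm A w 1 r := by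
    unfold weightedOpNorm
    refine le_iSup_of_le (fun x => (w x : ℂ)⁻¹ * g' x) (le_iSup_of_le
      ⟨aestronglyMeasurable_weight_mul hw g', ?_⟩ (le_iSup_of_le hn.le (le_iSup_of_le hm le_rfl)))
    exact hn.le.trans_lt ENNReal.one_lt_top
  rw [e2] at h2
  have h3 : weightedNorm w r (A g') ≤ K := h2.trans hK
  rw [hg', map_smul, weightedNorm_smul, hsn] at h3
  calc weightedNorm w r (A g) = weightedNorm w 1 g * ((weightedNorm w 1 g)⁻¹ *
        weightedNorm w r (A g)) := by
        rw [← mul_assoc, ENNReal.mul_inv_cancel h0 h1, one_mul]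
    _ ≤ weightedNorm w 1 g * K := by gcongr
    _ = _ := mul_comm _ _

theorem weightedOpNorm_le_of_weightedNorm_le (hpos : ∀ x, 0 < w x) {K : ℝ≥0∞}
    (h : ∀ g : Lp ℂ 2 μ, weightedNorm w r (A g) ≤ K * weightedNorm w q g) :
    weightedOpNorm A w q r ≤ K := by
  unfold weightedOpNorm
  refine iSup_le fun f => iSup_le fun hf => iSup_le fun hf1 => iSup_le fun hm => ?_
  refine (h (hm.toLp _)).trans ?_
  have : weightedNorm w q (hm.toLp _) = eLpNorm f q μ := by
    refine eLpNorm_congr_ae ?_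
    filter_upwards [hm.coeFn_toLp] with x hx
    rw [hx, inv_mul_cancel_left₀]
    exact_mod_cast (hpos x).ne'
  rw [this]
  exact (mul_le_mul_right hf1 K).trans (mul_one K).le

/-- Fatou's lemma along an almost everywhere convergent subsequence. -/
theorem weightedNorm_le_of_tendsto (hw : Measurable w) {g : ℕ → Lp ℂ 2 μ} {g₀ : Lp ℂ 2 μ}
    (h : Tendsto g atTop (𝓝 g₀)) {K : ℝ≥0∞} (hK : ∀ n, weightedNorm w r (g n) ≤ K) :
    weightedNorm w r g₀ ≤ K := by
  obtain ⟨ns, -, hns⟩ := (tendstoInMeasure_of_tendsto_Lp h).exists_seq_tendsto_ae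
  refine (Lp.eLpNorm_lim_le_liminf_eLpNorm (p := r)
    (f := fun n x => (w x : ℂ)⁻¹ * g (ns n) x)
    (fun n => aestronglyMeasurable_weight_mul hw _) _ ?_).trans ?_
  · filter_upwards [hns] with x hx
    exact hx.const_mul _
  · exact liminf_le_of_le (by isBoundedDefault) fun b hb => by
      obtain ⟨n, hn⟩ := hb.exists
      exact hn.trans (hK _)

/-- Bounded functions that live on a set of finite measure on which `log ρ` is bounded. -/
def IsNice (ρ : Ω → ℝ) (g : Lp ℂ 2 μ) : Prop :=
  ∃ (E : Set Ω) (R : ℝ), MeasurableSet E ∧ μ E < ∞ ∧ 0 ≤ R ∧ (∀ x ∈ E, |Real.log (ρ x)| ≤ R) ∧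
    ∀ᵐ x ∂μ, ‖g x‖ ≤ R ∧ (x ∉ E → g x = 0)

theorem exists_isNice_tendsto {ρ : Ω → ℝ} (hρ : Measurable ρ) (g : Lp ℂ 2 μ) :
    ∃ g' : ℕ → Lp ℂ 2 μ, (∀ n, IsNice ρ (g' n)) ∧ Tendsto g' atTop (𝓝 g) ∧
      ∀ n, ∀ᵐ x ∂μ, g' n x = 0 ∨ g' n x = g x := by
  -- The lower cutoff |g| ≥ 1/(n+1) makes the measure finite for g in L₂, without σ-finiteness of μ.
  set E : ℕ → Set Ω := fun n => {x | |Real.log (ρ x)| ≤ n} ∩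
    ({x | (1 : ℝ) / (n + 1) ≤ ‖g x‖} ∩ {x | ‖g x‖ ≤ n}) with hE
  have hgm : Measurable fun x => ‖g x‖ := (Lp.stronglyMeasurable g).measurable.norm
  have hEm : ∀ n, MeasurableSet (E n) := fun n =>
    (measurableSet_le (hρ.log.abs) measurable_const).inter
      ((measurableSet_le measurable_const hgm).inter (measurableSet_le hgm measurable_const))
  have hEfin : ∀ n, μ (E n) < ∞ := fun n => by
    have hpos : (0 : ℝ) < 1 / (n + 1) := by positivity
    refine (measure_mono ?_).trans_lt ((Lp.memLp g).meas_ge_lt_top' two_ne_zero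
      ENNReal.ofNat_ne_top (ε := ENNReal.ofReal (1 / (n + 1))) (by simpa using hpos))
    intro x hx
    have := hx.2.1
    change ENNReal.ofReal (1 / (n + 1)) ≤ ‖g x‖ₑ
    rw [← ofReal_norm]
    exact ENNReal.ofReal_le_ofReal this
  have hmem : ∀ n, MemLp ((E n).indicator g) 2 μ := fun n => (Lp.memLp g).indicator (hEm n)
  have hae : ∀ n, (hmem n).toLp _ =ᵐ[μ] (E n).indicator g := fun n => (hmem n).coeFn_toLp
  refine ⟨fun n => (hmem n).toLp _, fun n => ⟨E n, n, hEm n, hEfin n, n.cast_nonneg,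
    fun x hx => hx.1, ?_⟩, ?_, fun n => ?_⟩
  · filter_upwards [hae n] with x hx
    rw [hx]
    by_cases hxE : x ∈ E n
    · rw [Set.indicator_of_mem hxE]
      exact ⟨hxE.2.2, fun h => absurd hxE h⟩
    · rw [Set.indicator_of_notMem hxE]
      simp
  · rw [Lp.tendsto_Lp_iff_tendsto_eLpNorm']
    have e : ∀ n, eLpNorm (⇑((hmem n).toLp _) - ⇑g) 2 μ =
        (∫⁻ x, ‖(E n).indicator g x - g x‖ₑ ^ (2 : ℝ) ∂μ) ^ (1 / 2 : ℝ) := by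
      intro n
      rw [eLpNorm_congr_ae ((hae n).sub (EventuallyEq.refl _ _)),
        eLpNorm_eq_lintegral_rpow_enorm_toReal two_ne_zero ENNReal.ofNat_ne_top]
      simp
    simp_rw [e]
    have h0 : (0 : ℝ≥0∞) = 0 ^ (1 / 2 : ℝ) := by rw [ENNReal.zero_rpow_of_pos (by norm_num)]
    rw [h0]
    refine (ENNReal.continuous_rpow_const.tendsto _).comp ?_
    have hfin : ∫⁻ x, ‖g x‖ₑ ^ (2 : ℝ) ∂μ ≠ ∞ := by
      have := lintegral_rpow_enorm_lt_top_of_eLpNorm_lt_top two_ne_zero ENNReal.ofNat_ne_top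
        (Lp.memLp g).2
      simpa using this.ne
    have hz : (0 : ℝ≥0∞) = ∫⁻ x, (0 : ℝ≥0∞) ∂μ := by simp
    rw [hz]
    refine tendsto_lintegral_of_dominated_convergence (fun x => ‖g x‖ₑ ^ (2 : ℝ)) (fun n => ?_)
      (fun n => Eventually.of_forall fun x => ?_) hfin (Eventually.of_forall fun x => ?_)
    · exact ((((Lp.stronglyMeasurable g).measurable.indicator (hEm n)).sub
        (Lp.stronglyMeasurable g).measurable).enorm.pow_const _)
    · by_cases hxE : x ∈ E n <;> simp [hxE]
    · refine tendsto_const_nhds.congr' ?_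
      by_cases hg0 : g x = 0
      · refine Eventually.of_forall fun n => ?_
        by_cases hxE : x ∈ E n <;> simp [hxE, hg0]
      · have h1 : ∀ᶠ n : ℕ in atTop, (1 : ℝ) / (n + 1) < ‖g x‖ :=
          tendsto_one_div_add_atTop_nhds_zero_nat.eventually (gt_mem_nhds (norm_pos_iff.2 hg0))
        have h2 : ∀ a : ℝ, ∀ᶠ n : ℕ in atTop, a ≤ n := fun a =>
          tendsto_natCast_atTop_atTop.eventually_ge_atTop a
        filter_upwards [h1, h2 ‖g x‖, h2 |Real.log (ρ x)|] with n h1 h2 h3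
        have hxE : x ∈ E n := ⟨h3, h1.le, h2⟩
        rw [Set.indicator_of_mem hxE]; simp
  · filter_upwards [hae n] with x hx
    rw [hx]
    by_cases hxE : x ∈ E n
    · exact Or.inr (Set.indicator_of_mem hxE _)
    · exact Or.inl (Set.indicator_of_notMem hxE _)

/-- The approximants equal g or 0 at almost every point, so their weighted norms do not exceed that
of g; the left-hand side is lower semicontinuous. -/
theorem weightedNorm_apply_le_of_isNice {ρ : Ω → ℝ} (hρ : Measurable ρ) (hw : Measurable w)
    {K : ℝ≥0∞} (h : ∀ g : Lp ℂ 2 μ, IsNice ρ g → weightedNorm w r (A g) ≤ K * weightedNorm w q g)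
    (g : Lp ℂ 2 μ) : weightedNorm w r (A g) ≤ K * weightedNorm w q g := by
  obtain ⟨g', h1, h2, h3⟩ := exists_isNice_tendsto hρ g
  refine weightedNorm_le_of_tendsto hw ((A.continuous.tendsto g).comp h2) fun n => ?_
  refine (h _ (h1 n)).trans (mul_le_mul_right (weightedNorm_mono ?_) K)
  filter_upwards [h3 n] with x hx
  rcases hx with hx | hx <;> rw [hx]
  simp

theorem IsPositiveOperator.weightedNorm_apply_le (hA : IsPositiveOperator A) {K : ℝ≥0∞}
    (h : ∀ g : Lp ℂ 2 μ, 0 ≤ g → weightedNorm w r (A g) ≤ K * weightedNorm w q g)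
    (g : Lp ℂ 2 μ) : weightedNorm w r (A g) ≤ K * weightedNorm w q g := by
  calc weightedNorm w r (A g) ≤ weightedNorm w r (A (absLp g)) :=
        weightedNorm_mono (hA.norm_apply_le_absLp g)
    _ ≤ K * weightedNorm w q (absLp g) := h _ (absLp_nonneg g)
    _ = _ := by rw [weightedNorm_absLp]

end WeightedNorm

/-! ### Twisting by complex powers of the weight and weighted L₂ estimates -/

section Twist

variable {Ω : Type*} {ρ : Ω → ℝ}

/-- The function `ρ ^ z`, cut off to the set where `|log ρ| ≤ R`. -/
def twistFun (ρ : Ω → ℝ) (R : ℝ) (z : ℂ) : Ω → ℂ :=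
  {x | |Real.log (ρ x)| ≤ R}.indicator fun x => Complex.exp (z * Real.log (ρ x))

theorem norm_twistFun_le (R : ℝ) (z : ℂ) (x : Ω) :
    ‖twistFun ρ R z x‖ ≤ Real.exp (R * |z.re|) := by
  unfold twistFun
  by_cases hx : |Real.log (ρ x)| ≤ R
  · rw [Set.indicator_of_mem (by exact hx), Complex.norm_exp, Complex.re_mul_ofReal]
    refine Real.exp_le_exp.2 ((le_abs_self _).trans ?_)
    rw [abs_mul, mul_comm]
    gcongr
  · rw [Set.indicator_of_notMem (by exact hx), norm_zero]
    positivity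

theorem norm_twistFun_sub_le {R : ℝ} (hR : 0 ≤ R) (z : ℂ) {h : ℂ} (hh : ‖h‖ ≤ 1) (x : Ω) :
    ‖twistFun ρ R (z + h) x - twistFun ρ R z x - h * (Real.log (ρ x) * twistFun ρ R z x)‖ ≤
      Real.exp (R * |z.re|) * (R ^ 2 * Real.exp R) * ‖h‖ ^ 2 := by
  by_cases hx : |Real.log (ρ x)| ≤ R
  · have e : twistFun ρ R (z + h) x - twistFun ρ R z x - h * (Real.log (ρ x) * twistFun ρ R z x) =
        twistFun ρ R z x * (Complex.exp (h * Real.log (ρ x)) - ∑ m ∈ Finset.range 2,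
          (h * Real.log (ρ x)) ^ m / (m.factorial : ℂ)) := by
      unfold twistFun
      rw [Set.indicator_of_mem (by exact hx), Set.indicator_of_mem (by exact hx), add_mul,
        Complex.exp_add, Finset.sum_range_succ, Finset.sum_range_one]
      simp
      ring
    rw [e, norm_mul]
    have h2 := Complex.norm_exp_sub_sum_le_norm_mul_exp (h * Real.log (ρ x)) 2
    have h3 : ‖h * (Real.log (ρ x) : ℂ)‖ ≤ ‖h‖ * R := by
      rw [norm_mul, Complex.norm_real, Real.norm_eq_abs]
      gcongr
    have h4 : ‖h‖ * R ≤ R := mul_le_of_le_one_left hR hh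
    calc _ ≤ Real.exp (R * |z.re|) * ((‖h‖ * R) ^ 2 * Real.exp R) := by
          refine mul_le_mul (norm_twistFun_le R z x) (h2.trans ?_) (norm_nonneg _)
            (Real.exp_pos _).le
          gcongr
          exact h3.trans h4
      _ = _ := by ring
  · unfold twistFun
    rw [Set.indicator_of_notMem (by exact hx), Set.indicator_of_notMem (by exact hx)]
    simp only [mul_zero, sub_zero, norm_zero]
    positivity

theorem twistFun_ofReal_of_mem {R : ℝ} {x : Ω} (hρ : 0 < ρ x) (hx : |Real.log (ρ x)| ≤ R) (α : ℝ) :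
    twistFun ρ R α x = ((ρ x ^ α : ℝ) : ℂ) := by
  unfold twistFun
  rw [Set.indicator_of_mem (by exact hx), Real.rpow_def_of_pos hρ]
  push_cast
  rw [mul_comm]

theorem norm_twistFun_ofReal_le {R : ℝ} {x : Ω} (hρ : 0 < ρ x) (α : ℝ) :
    ‖twistFun ρ R α x‖ ≤ ρ x ^ α := by
  by_cases hx : |Real.log (ρ x)| ≤ R
  · rw [twistFun_ofReal_of_mem hρ hx, Complex.norm_real, Real.norm_of_nonneg (by positivity)]
  · unfold twistFun
    rw [Set.indicator_of_notMem (by exact hx), norm_zero]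
    positivity

variable [MeasurableSpace Ω] {μ : Measure Ω}

theorem measurable_twistFun (hρ : Measurable ρ) (R : ℝ) (z : ℂ) : Measurable (twistFun ρ R z) :=
  ((Complex.measurable_ofReal.comp hρ.log).const_mul z).cexp.indicator
    (measurableSet_le hρ.log.abs measurable_const)

theorem memLp_twistFun (hρ : Measurable ρ) (R : ℝ) (z : ℂ) : MemLp (twistFun ρ R z) ∞ μ :=
  memLp_top_of_bound (measurable_twistFun hρ R z).aestronglyMeasurable _
    (Eventually.of_forall (norm_twistFun_le R z))

/-- Multiplication by `ρ ^ z`, cut off to the set where `|log ρ| ≤ R`. -/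
def twist (μ : Measure Ω) (ρ : Ω → ℝ) (R : ℝ) (z : ℂ) : Lp ℂ 2 μ →L[ℂ] Lp ℂ 2 μ :=
  mulOp μ (twistFun ρ R z)

theorem twist_ae (hρ : Measurable ρ) (R : ℝ) (z : ℂ) (f : Lp ℂ 2 μ) :
    twist μ ρ R z f =ᵐ[μ] fun x => twistFun ρ R z x * f x :=
  mulOp_ae (memLp_twistFun hρ R z) f

theorem norm_twist_le (hρ : Measurable ρ) (R : ℝ) (z : ℂ) :
    ‖twist μ ρ R z‖ ≤ Real.exp (R * |z.re|) :=
  mulOp_norm_le (measurable_twistFun hρ R z).aestronglyMeasurable (Real.exp_pos _).le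
    (norm_twistFun_le R z)

/-- The cutoff |log ρ| ≤ R makes the exponent bounded, so the Taylor remainder of the exponential is
uniform in the point and the family of bounded operators is entire. -/
theorem differentiable_twist (hρ : Measurable ρ) {R : ℝ} (hR : 0 ≤ R) :
    Differentiable ℂ (twist μ ρ R) := by
  intro z
  set D : Lp ℂ 2 μ →L[ℂ] Lp ℂ 2 μ := mulOp μ fun x => Real.log (ρ x) * twistFun ρ R z x with hD
  have hDm : MemLp (fun x => (Real.log (ρ x) : ℂ) * twistFun ρ R z x) ∞ μ := by
    refine memLp_top_of_bound ((Complex.measurable_ofReal.comp hρ.log).mul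
      (measurable_twistFun hρ R z)).aestronglyMeasurable (R * Real.exp (R * |z.re|))
      (Eventually.of_forall fun x => ?_)
    rw [norm_mul, Complex.norm_real, Real.norm_eq_abs]
    by_cases hx : |Real.log (ρ x)| ≤ R
    · exact mul_le_mul hx (norm_twistFun_le R z x) (norm_nonneg _) hR
    · unfold twistFun
      rw [Set.indicator_of_notMem (by exact hx), norm_zero, mul_zero]
      positivity
  refine HasDerivAt.differentiableAt (f' := D) ?_
  rw [hasDerivAt_iff_isLittleO_nhds_zero]
  refine Asymptotics.IsBigO.trans_isLittleO (g := fun h : ℂ => ‖h‖ ^ 2) ?_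
    (Asymptotics.isLittleO_norm_pow_id one_lt_two)
  refine Asymptotics.IsBigO.of_bound (Real.exp (R * |z.re|) * (R ^ 2 * Real.exp R)) ?_
  filter_upwards [Metric.closedBall_mem_nhds (0 : ℂ) one_pos] with h hh
  rw [mem_closedBall_zero_iff] at hh
  rw [Real.norm_of_nonneg (by positivity)]
  refine ContinuousLinearMap.opNorm_le_bound _ (by positivity) fun f => ?_
  refine Lp.norm_le_mul_norm_of_ae_le_mul ?_
  have e : (twist μ ρ R (z + h) - twist μ ρ R z - h • D) f =
      twist μ ρ R (z + h) f - twist μ ρ R z f - h • D f := rfl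
  rw [e]
  filter_upwards [Lp.coeFn_sub (twist μ ρ R (z + h) f - twist μ ρ R z f) (h • D f),
    Lp.coeFn_sub (twist μ ρ R (z + h) f) (twist μ ρ R z f), Lp.coeFn_smul h (D f),
    twist_ae hρ R (z + h) f, twist_ae hρ R z f, mulOp_ae hDm f] with x h1 h2 h3 h4 h5 h6
  rw [h1, Pi.sub_apply, h2, Pi.sub_apply, h3, Pi.smul_apply, h4, h5, hD, h6, smul_eq_mul]
  rw [show twistFun ρ R (z + h) x * f x - twistFun ρ R z x * f x -
      h * (Real.log (ρ x) * twistFun ρ R z x * f x) = (twistFun ρ R (z + h) x - twistFun ρ R z x -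
      h * (Real.log (ρ x) * twistFun ρ R z x)) * f x by ring, norm_mul]
  exact mul_le_mul_of_nonneg_right (norm_twistFun_sub_le hR z hh x) (norm_nonneg _)

theorem weightedNorm_twist_neg_le (hρ : Measurable ρ) (hpos : ∀ x, 0 < ρ x) (R α : ℝ) (r : ℝ≥0∞)
    (g : Lp ℂ 2 μ) : weightedNorm (fun _ => 1) r (twist μ ρ R (-α) g) ≤
      weightedNorm (fun x => ρ x ^ α) r g := by
  refine eLpNorm_mono_ae ?_
  filter_upwards [twist_ae hρ R (-α) g] with x hx
  rw [hx, norm_mul, norm_mul, norm_mul, norm_inv, norm_inv, Complex.norm_real, Complex.norm_real,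
    norm_one, inv_one, one_mul, Real.norm_of_nonneg (Real.rpow_nonneg (hpos x).le α),
    ← Real.rpow_neg (hpos x).le, ← Complex.ofReal_neg]
  exact mul_le_mul_of_nonneg_right (norm_twistFun_ofReal_le (hpos x) _) (norm_nonneg _)

theorem weightedNorm_twist_le (hρ : Measurable ρ) (hpos : ∀ x, 0 < ρ x) (R α : ℝ) (r : ℝ≥0∞)
    (g : Lp ℂ 2 μ) : weightedNorm (fun x => ρ x ^ α) r (twist μ ρ R α g) ≤
      weightedNorm (fun _ => 1) r g := by
  refine eLpNorm_mono_ae ?_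
  filter_upwards [twist_ae hρ R α g] with x hx
  rw [hx, norm_mul, norm_mul, norm_mul, norm_inv, norm_inv, Complex.norm_real, Complex.norm_real,
    norm_one, inv_one, one_mul, Real.norm_of_nonneg (Real.rpow_nonneg (hpos x).le α), ← mul_assoc]
  refine mul_le_of_le_one_left (norm_nonneg _) ?_
  rw [inv_mul_le_iff₀ (Real.rpow_pos_of_pos (hpos x) α), mul_one]
  exact norm_twistFun_ofReal_le (hpos x) _

/-- Hölder's inequality; the reciprocal weights cancel in the integrand. -/
theorem enorm_inner_le_weightedNorm {w w' : Ω → ℝ} (hww : ∀ x, w' x * w x = 1)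
    (hw : Measurable w) (hw' : Measurable w') (q r : ℝ≥0∞) [ENNReal.HolderTriple q r 1]
    (v y : Lp ℂ 2 μ) : ‖inner ℂ v y‖ₑ ≤ weightedNorm w' q v * weightedNorm w r y := by
  rw [L2.inner_def]
  refine (enorm_integral_le_lintegral_enorm _).trans ?_
  refine le_trans (le_of_eq ?_) (eLpNorm_smul_le_mul_eLpNorm (p := q) (q := r) (r := 1)
    (aestronglyMeasurable_weight_mul hw y) (aestronglyMeasurable_weight_mul hw' v))
  rw [eLpNorm_one_eq_lintegral_enorm]
  refine lintegral_congr fun x => ?_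
  have hx : (w' x : ℂ)⁻¹ * (w x : ℂ)⁻¹ = 1 := by
    rw [← mul_inv, ← Complex.ofReal_mul, hww]; simp
  have e : ((w' x : ℂ)⁻¹ * v x) * ((w x : ℂ)⁻¹ * y x) = v x * y x := by
    rw [mul_mul_mul_comm, hx, one_mul]
  change _ = ‖((w' x : ℂ)⁻¹ * v x) * ((w x : ℂ)⁻¹ * y x)‖ₑ
  rw [e, enorm_mul, RCLike.inner_apply, enorm_mul, mul_comm, RCLike.enorm_conj]

theorem memLp_of_bound_of_support {f : Ω → ℂ} (hf : AEStronglyMeasurable f μ) {E : Set Ω}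
    (hE : MeasurableSet E) (hfin : μ E < ∞) {C : ℝ} (h : ∀ᵐ x ∂μ, ‖f x‖ ≤ C ∧ (x ∉ E → f x = 0))
    (q : ℝ≥0∞) : MemLp f q μ := by
  have : IsFiniteMeasure (μ.restrict E) := ⟨by simpa using hfin⟩
  have h1 : MemLp f q (μ.restrict E) :=
    MemLp.of_bound hf.restrict C (ae_restrict_of_ae (h.mono fun x hx => hx.1))
  refine ((memLp_indicator_iff_restrict hE).2 h1).ae_eq ?_
  filter_upwards [h] with x hx
  by_cases hxE : x ∈ E
  · exact Set.indicator_of_mem hxE _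
  · rw [Set.indicator_of_notMem hxE, hx.2 hxE]

theorem IsNice.weightedNorm_one_ne_top {g : Lp ℂ 2 μ} (hg : IsNice ρ g) (q : ℝ≥0∞) :
    weightedNorm (fun _ => 1) q g ≠ ∞ := by
  obtain ⟨E, R, hE, hfin, -, -, h⟩ := hg
  have := (memLp_of_bound_of_support (Lp.aestronglyMeasurable g) hE hfin h q).2.ne
  unfold weightedNorm
  simpa using this

variable {S : ℝ≥0 → Lp ℂ 2 μ →L[ℂ] Lp ℂ 2 μ}

/-- The weighted q→r bound, for conjugate q and r and small t, serves only as the a priori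
polynomial bound in the Phragmén–Lindelöf argument, so C and k do not survive. The factor e^(ωt)
enters by rescaling to contractions. -/
theorem norm_inner_twist_le (hρ : Measurable ρ) (hpos : ∀ x, 0 < ρ x) (hS : IsC0Semigroup S)
    (hsa : ∀ t, IsSelfAdjoint (S t)) {ω : ℝ} (hω : 0 ≤ ω) (hb : ∀ t : ℝ≥0, ‖S t‖ ≤ Real.exp (ω * t))
    (q r : ℝ≥0∞) [ENNReal.HolderTriple q r 1] {C : ℝ} (hC : 0 ≤ C) {k : ℕ}
    (h : ∀ t : ℝ≥0, 0 < t → t ≤ 1 → ∀ (α : ℝ) (g : Lp ℂ 2 μ),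
      weightedNorm (fun x => ρ x ^ α) r (S t g) ≤
        ENNReal.ofReal (C * (t : ℝ)⁻¹ ^ k * Real.exp (α ^ 2 * t)) *
          weightedNorm (fun x => ρ x ^ α) q g)
    {u v : Lp ℂ 2 μ} (hu : IsNice ρ u) (hv : IsNice ρ v) {R : ℝ} (hR : 0 ≤ R)
    {t : ℝ≥0} (ht : 0 < t) (α : ℝ) :
    ‖inner ℂ v (twist μ ρ R (-α) (S t (twist μ ρ R α u)))‖ ≤
      Real.exp ((ω + α ^ 2) * t) * (‖v‖ * ‖u‖) := by
  set S' : ℝ≥0 → Lp ℂ 2 μ →L[ℂ] Lp ℂ 2 μ :=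
    fun t => ((Real.exp (-ω * t) : ℝ) : ℂ) • S t with hS'
  have h1 : IsC0Semigroup S' := hS.exp_smul (-ω)
  have h2 : ∀ t, IsSelfAdjoint (S' t) := fun t =>
    IsSelfAdjoint.smul (Complex.conj_ofReal _) (hsa t)
  have h3 : ∀ t, ‖S' t‖ ≤ 1 := fun t => by
    rw [hS', norm_smul, Complex.norm_real, Real.norm_of_nonneg (Real.exp_pos _).le]
    calc _ ≤ Real.exp (-ω * t) * Real.exp (ω * t) := by gcongr; exact hb t
      _ = 1 := by rw [← Real.exp_add]; simp
  have e : ∀ (t : ℝ≥0) (α : ℝ), ‖inner ℂ v (twist μ ρ R (-α) (S' t (twist μ ρ R α u)))‖ =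
      Real.exp (-ω * t) * ‖inner ℂ v (twist μ ρ R (-α) (S t (twist μ ρ R α u)))‖ := fun t α => by
    rw [hS', smul_apply, map_smul, inner_smul_right, norm_mul, Complex.norm_real,
      Real.norm_of_nonneg (Real.exp_pos _).le]
  have h4 := norm_inner_twisted_le h1 h2 h3 (differentiable_twist hρ hR) hR (norm_twist_le hρ R)
    (u := u) (v := v) (C := C * ((weightedNorm (fun _ => 1) q v).toReal *
      (weightedNorm (fun _ => 1) q u).toReal)) (k := k) ?_ ht α
  · rw [e, ← le_div_iff₀' (Real.exp_pos _)] at h4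
    refine h4.trans (le_of_eq ?_)
    rw [add_mul, Real.exp_add, neg_mul, Real.exp_neg]
    field_simp
  · intro t ht ht1 α
    rw [e]
    refine (mul_le_of_le_one_left (norm_nonneg _) ?_).trans ?_
    · rw [Real.exp_le_one_iff]
      have : 0 ≤ ω * t := by positivity
      linarith
    have h5 := enorm_inner_le_weightedNorm (w := fun _ => 1) (w' := fun _ => 1) (fun _ => one_mul 1)
      measurable_const measurable_const q r v (twist μ ρ R (-α) (S t (twist μ ρ R α u)))
    have h6 := (weightedNorm_twist_neg_le hρ hpos R α r (S t (twist μ ρ R α u))).trans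
      (h t ht ht1 α _)
    have h7 := h5.trans (mul_le_mul_right (h6.trans
      (mul_le_mul_right (weightedNorm_twist_le hρ hpos R α q u) _)) _)
    have hnn : 0 ≤ C * (t : ℝ)⁻¹ ^ k * Real.exp (α ^ 2 * t) := by positivity
    have h8 := ENNReal.toReal_mono (ENNReal.mul_ne_top (hv.weightedNorm_one_ne_top q)
      (ENNReal.mul_ne_top ENNReal.ofReal_ne_top (hu.weightedNorm_one_ne_top q))) h7
    rw [toReal_enorm, ENNReal.toReal_mul, ENNReal.toReal_mul, ENNReal.toReal_ofReal hnn] at h8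
    exact h8.trans (le_of_eq (by ring))

/-- Cut-off functions are dense in L₂, so the matrix coefficient bounds give an operator bound for
the twisted semigroup, uniform in the cutoff R; then R → ∞ by Fatou. -/
theorem weightedNorm_two_le (hρ : Measurable ρ) (hpos : ∀ x, 0 < ρ x) (hS : IsC0Semigroup S)
    (hsa : ∀ t, IsSelfAdjoint (S t)) {ω : ℝ} (hω : 0 ≤ ω) (hb : ∀ t : ℝ≥0, ‖S t‖ ≤ Real.exp (ω * t))
    (q r : ℝ≥0∞) [ENNReal.HolderTriple q r 1] {C : ℝ} (hC : 0 ≤ C) {k : ℕ}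
    (h : ∀ t : ℝ≥0, 0 < t → t ≤ 1 → ∀ (α : ℝ) (g : Lp ℂ 2 μ),
      weightedNorm (fun x => ρ x ^ α) r (S t g) ≤
        ENNReal.ofReal (C * (t : ℝ)⁻¹ ^ k * Real.exp (α ^ 2 * t)) *
          weightedNorm (fun x => ρ x ^ α) q g)
    {t : ℝ≥0} (ht : 0 < t) (α : ℝ) (g : Lp ℂ 2 μ) :
    weightedNorm (fun x => ρ x ^ α) 2 (S t g) ≤
      ENNReal.ofReal (Real.exp ((ω + α ^ 2) * t)) * weightedNorm (fun x => ρ x ^ α) 2 g := by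
  have hw : Measurable fun x => ρ x ^ α := hρ.pow_const α
  refine weightedNorm_apply_le_of_isNice hρ hw (fun g hg => ?_) g
  have key : ∀ R : ℝ, 0 ≤ R → ∀ u : Lp ℂ 2 μ, ‖twist μ ρ R (-α) (S t (twist μ ρ R α u))‖ ≤
      Real.exp ((ω + α ^ 2) * t) * ‖u‖ := by
    intro R hR u
    obtain ⟨u', hu1, hu2, -⟩ := exists_isNice_tendsto hρ u
    have hcont : Continuous fun u : Lp ℂ 2 μ => twist μ ρ R (-α) (S t (twist μ ρ R α u)) := by
      fun_prop
    refine le_of_tendsto_of_tendsto' ((hcont.tendsto u).norm.comp hu2) (hu2.norm.const_mul _)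
      fun n => ?_
    simp only [Function.comp_apply]
    set y := twist μ ρ R (-α) (S t (twist μ ρ R α (u' n))) with hy
    obtain ⟨v, hv1, hv2, -⟩ := exists_isNice_tendsto hρ y
    have h1 : ‖inner ℂ y y‖ ≤ Real.exp ((ω + α ^ 2) * t) * (‖y‖ * ‖u' n‖) :=
      le_of_tendsto_of_tendsto' (hv2.inner tendsto_const_nhds).norm
        ((hv2.norm.mul_const _).const_mul _) fun m =>
          norm_inner_twist_le hρ hpos hS hsa hω hb q r hC h (hu1 n) (hv1 m) hR ht α
    rw [inner_self_eq_norm_sq_to_K, norm_pow, RCLike.norm_ofReal, abs_norm] at h1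
    rcases eq_or_ne ‖y‖ 0 with h0 | h0
    · rw [h0]; positivity
    · have : 0 < ‖y‖ := lt_of_le_of_ne (norm_nonneg _) (Ne.symm h0)
      nlinarith
  obtain ⟨E, R₀, -, -, hR₀, hE, hgE⟩ := hg
  have h2 : ∀ R : ℝ, R₀ ≤ R → eLpNorm (twist μ ρ R (-α) (S t g)) 2 μ ≤
      ENNReal.ofReal (Real.exp ((ω + α ^ 2) * t)) * weightedNorm (fun x => ρ x ^ α) 2 g := by
    intro R hR
    set u := twist μ ρ R (-α) g with hu
    -- Once R exceeds the bound of |log ρ| on the support of g, the two opposite twists are inverse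
    -- to each other on g.
    have hug : twist μ ρ R α u = g := by
      apply Lp.ext
      filter_upwards [twist_ae hρ R α u, twist_ae hρ R (-α) g, hgE] with x h1 h2 h3
      rw [h1, hu, h2]
      by_cases hx : x ∈ E
      · rw [← Complex.ofReal_neg, twistFun_ofReal_of_mem (hpos x) ((hE x hx).trans hR),
          twistFun_ofReal_of_mem (hpos x) ((hE x hx).trans hR), ← mul_assoc, ← Complex.ofReal_mul,
          ← Real.rpow_add (hpos x)]
        simp
      · rw [h3.2 hx]; simp
    have h3 := key R (hR₀.trans hR) u
    rw [hug] at h3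
    have h4 : ∀ y : Lp ℂ 2 μ, eLpNorm y 2 μ = ENNReal.ofReal ‖y‖ := fun y => by
      rw [Lp.norm_def, ENNReal.ofReal_toReal (Lp.eLpNorm_ne_top y)]
    calc eLpNorm (twist μ ρ R (-α) (S t g)) 2 μ
        ≤ ENNReal.ofReal (Real.exp ((ω + α ^ 2) * t) * ‖u‖) := by
          rw [h4]; exact ENNReal.ofReal_le_ofReal h3
      _ = ENNReal.ofReal (Real.exp ((ω + α ^ 2) * t)) * eLpNorm u 2 μ := by
          rw [ENNReal.ofReal_mul (Real.exp_pos _).le, h4]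
      _ ≤ _ := by
          gcongr
          have := weightedNorm_twist_neg_le hρ hpos R α 2 g
          unfold weightedNorm at this ⊢
          simpa using this
  obtain ⟨N, hN⟩ := exists_nat_ge R₀
  refine (Lp.eLpNorm_lim_le_liminf_eLpNorm (p := 2)
    (f := fun n : ℕ => twist μ ρ ((n + N : ℕ) : ℝ) (-α) (S t g))
    (fun n => Lp.aestronglyMeasurable _) _ ?_).trans ?_
  · have hall := ae_all_iff.2 fun n : ℕ => twist_ae hρ ((n + N : ℕ) : ℝ) (-α) (S t g)
    filter_upwards [hall] with x hx
    refine tendsto_const_nhds.congr' ?_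
    filter_upwards [tendsto_natCast_atTop_atTop.eventually_ge_atTop |Real.log (ρ x)|] with n hn
    rw [hx n, ← Complex.ofReal_neg, twistFun_ofReal_of_mem (hpos x), Real.rpow_neg (hpos x).le]
    · push_cast; rfl
    · refine hn.trans ?_
      push_cast
      have : (0 : ℝ) ≤ N := N.cast_nonneg
      linarith
  · exact liminf_le_of_le (by isBoundedDefault) fun b hb => by
      obtain ⟨n, hn⟩ := hb.exists
      refine hn.trans (h2 _ (hN.trans ?_))
      push_cast
      have : (0 : ℝ) ≤ n := n.cast_nonneg
      linarith

end Twist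

/-! ### Weighted L₂ bounds and the Hölder inequality for the absorption semigroups -/

section WeightedBounds

variable {Ω : Type*} [MeasurableSpace Ω] {μ : Measure Ω} {ρ : Ω → ℝ}
  {T S U : ℝ≥0 → Lp ℂ 2 μ →L[ℂ] Lp ℂ 2 μ} {V W : Ω → ℝ}

/-- From W ≥ -C the perturbed semigroup is dominated by e^(Ct) T(t). -/
theorem weightedNorm_boundedPerturbation_le (hT : IsPositiveSymmetricSemigroup T)
    (hW : IsBddMeasurable W) {C : ℝ} (hC : ∀ x, |W x| ≤ C) (w : Ω → ℝ) (q r : ℝ≥0∞) {K : ℝ}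
    {t : ℝ≥0} (h : ∀ g, weightedNorm w r (T t g) ≤ ENNReal.ofReal K * weightedNorm w q g)
    (g : Lp ℂ 2 μ) : weightedNorm w r (boundedPerturbation T W t g) ≤
      ENNReal.ofReal (Real.exp (C * t) * K) * weightedNorm w q g := by
  refine ((hT.boundedPerturbation hW).pos t).weightedNorm_apply_le (fun g hg => ?_) g
  have h1 := boundedPerturbation_anti hT (IsBddMeasurable.const (-C)) hW
    (fun x => (abs_le.1 (hC x)).1) t hg
  rw [boundedPerturbation_const hT] at h1
  have h2 := ((hT.boundedPerturbation hW).pos t).map_nonneg hg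
  rw [Lp_nonneg_iff'] at h2
  rw [Lp_le_iff] at h1
  calc _ ≤ weightedNorm w r (((Real.exp (-(-C * t)) : ℝ) : ℂ) • T t g) := by
        refine weightedNorm_mono ?_
        filter_upwards [h1, h2] with x h1 h2
        rw [norm_eq_re_of_nonneg h2, norm_eq_re_of_nonneg (h2.trans h1)]
        exact h1.1
    _ ≤ ENNReal.ofReal (Real.exp (C * t)) * (ENNReal.ofReal K * weightedNorm w q g) := by
        rw [weightedNorm_smul, ← ofReal_norm, Complex.norm_real,
          Real.norm_of_nonneg (Real.exp_pos _).le, neg_mul, neg_neg]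
        gcongr
        exact h g
    _ = _ := by rw [← mul_assoc, ENNReal.ofReal_mul (Real.exp_pos _).le]

/-- The Phragmén–Lindelöf step uses an integer power, so ν is rounded up. -/
theorem rpow_neg_le_inv_pow {t ν : ℝ} (ht : 0 < t) (ht1 : t ≤ 1) : t ^ (-ν) ≤ t⁻¹ ^ ⌈ν⌉₊ := by
  rw [Real.rpow_neg ht.le, ← Real.inv_rpow ht.le, ← Real.rpow_natCast]
  exact Real.rpow_le_rpow_of_exponent_le ((one_le_inv₀ ht).2 ht1) (Nat.le_ceil ν)

/-- Weighted `L₂`-bounds for the semigroup `T_V` as a limit of bounded perturbations. -/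
theorem weightedNorm_two_absorption_le (hρ : Measurable ρ) (hpos : ∀ x, 0 < ρ x)
    (hT : IsPositiveSymmetricSemigroup T) {c ν : ℝ} (hc : 0 < c)
    (hT_ultra : ∀ t : ℝ≥0, 0 < t → ∀ (α : ℝ) (g : Lp ℂ 2 μ),
      weightedNorm (fun x => ρ x ^ α) ∞ (T t g) ≤
        ENNReal.ofReal (c * (t : ℝ) ^ (-ν) * Real.exp (α ^ 2 * t)) *
          weightedNorm (fun x => ρ x ^ α) 1 g)
    (hV : Measurable V)
    (hlim : ∀ t f, Tendsto (fun a : ℝ => boundedPerturbation T (realTruncation V a) t f) atTop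
      (𝓝 (S t f))) {ω : ℝ} (hω : 0 ≤ ω)
    (hb : ∀ (t : ℝ≥0) (a : ℝ), 0 ≤ a →
      ‖boundedPerturbation T (realTruncation V a) t‖ ≤ Real.exp (ω * t))
    {t : ℝ≥0} (ht : 0 < t) (α : ℝ) (g : Lp ℂ 2 μ) :
    weightedNorm (fun x => ρ x ^ α) 2 (S t g) ≤
      ENNReal.ofReal (Real.exp ((ω + α ^ 2) * t)) * weightedNorm (fun x => ρ x ^ α) 2 g := by
  refine weightedNorm_le_of_tendsto (hρ.pow_const α)
    ((hlim t g).comp tendsto_natCast_atTop_atTop) fun n => ?_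
  have hW := isBddMeasurable_realTruncation hV (n : ℝ)
  obtain ⟨C, hC0, hC⟩ := hW.bounded
  have hP := hT.boundedPerturbation hW
  -- The crude constant e^C c depends on the truncation level n but is absent from the conclusion,
  -- and ω is uniform in n. Hence the limit n → ∞ is possible.
  refine weightedNorm_two_le hρ hpos hP.isC0 hP.sa hω (fun t => hb t n n.cast_nonneg) 1 ∞
    (C := Real.exp C * c) (k := ⌈ν⌉₊) (by positivity) (fun t ht ht1 α g => ?_) ht α g
  refine (weightedNorm_boundedPerturbation_le hT hW hC _ 1 ∞ (hT_ultra t ht α) g).trans ?_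
  gcongr ENNReal.ofReal ?_ * _
  have ht' : (0 : ℝ) < t := NNReal.coe_pos.2 ht
  have ht1' : (t : ℝ) ≤ 1 := by exact_mod_cast ht1
  have h1 : Real.exp (C * t) ≤ Real.exp C := Real.exp_le_exp.2 (mul_le_of_le_one_right hC0 ht1')
  have h2 := rpow_neg_le_inv_pow (ν := ν) ht' ht1'
  calc Real.exp (C * t) * (c * (t : ℝ) ^ (-ν) * Real.exp (α ^ 2 * t))
      ≤ Real.exp C * (c * (t : ℝ)⁻¹ ^ ⌈ν⌉₊ * Real.exp (α ^ 2 * t)) := by gcongr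
    _ = _ := by ring

/-- The argument is self-improving: a weighted L₂ bound with factor e^(ωt) is itself an a priori
bound for t ≤ 1 with q = r = 2 and k = 0, and the contraction property then permits ω = 0. -/
theorem weightedNorm_two_contraction_le (hρ : Measurable ρ) (hpos : ∀ x, 0 < ρ x)
    (hS : IsC0Semigroup S) (hsa : ∀ t, IsSelfAdjoint (S t)) (hb : ∀ t, 0 < t → ‖S t‖ ≤ 1)
    {ω : ℝ} (hω : 0 ≤ ω) (h : ∀ t : ℝ≥0, 0 < t → ∀ (α : ℝ) (g : Lp ℂ 2 μ),
      weightedNorm (fun x => ρ x ^ α) 2 (S t g) ≤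
        ENNReal.ofReal (Real.exp ((ω + α ^ 2) * t)) * weightedNorm (fun x => ρ x ^ α) 2 g)
    {t : ℝ≥0} (ht : 0 < t) (α : ℝ) (g : Lp ℂ 2 μ) :
    weightedNorm (fun x => ρ x ^ α) 2 (S t g) ≤
      ENNReal.ofReal (Real.exp (α ^ 2 * t)) * weightedNorm (fun x => ρ x ^ α) 2 g := by
  have hb' : ∀ t : ℝ≥0, ‖S t‖ ≤ Real.exp (0 * t) := by
    intro t
    rw [zero_mul, Real.exp_zero]
    rcases eq_or_lt_of_le (zero_le (a := t)) with h | h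
    · rw [← h, hS.map_zero]
      exact ContinuousLinearMap.norm_id_le
    · exact hb t h
  have := weightedNorm_two_le hρ hpos hS hsa le_rfl hb' 2 2 (C := Real.exp ω) (k := 0)
    (Real.exp_pos _).le (fun t ht ht1 α g => ?_) ht α g
  · simpa using this
  · refine (h t ht α g).trans ?_
    have ht1' : (t : ℝ) ≤ 1 := by exact_mod_cast ht1
    rw [pow_zero, mul_one, ← Real.exp_add]
    gcongr
    rw [add_mul]
    gcongr
    exact mul_le_of_le_one_right hω ht1'

/-- The pointwise Hölder inequality between `T_V`, `T_{pV}` and `T`. -/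
theorem absorption_geomMean (hT : IsPositiveSymmetricSemigroup T) (hV : Measurable V) {p : ℝ}
    (hp : 1 < p)
    (hS : ∀ t f, Tendsto (fun a : ℝ => boundedPerturbation T (realTruncation V a) t f) atTop
      (𝓝 (S t f)))
    (hU : ∀ t f, Tendsto (fun a : ℝ => boundedPerturbation T (realTruncation (fun x => p * V x) a)
      t f) atTop (𝓝 (U t f)))
    (t : ℝ≥0) {f : Fin 3 → Lp ℂ 2 μ} (hf : f ∈ geomMeanSet μ p⁻¹) :
    ![S t (f 0), U t (f 1), T t (f 2)] ∈ geomMeanSet μ p⁻¹ := by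
  have hp0 : 0 < p := by linarith
  have h0 : 0 < p⁻¹ := inv_pos.2 hp0
  have h1 : p⁻¹ < 1 := inv_lt_one_of_one_lt₀ hp
  -- Truncating pV at level pa gives p times the truncation of V at level a, so the potentials stay
  -- in exact convex relation. This is why real levels are needed.
  refine (isClosed_geomMeanSet h0 h1).mem_of_tendsto (f := fun a : ℝ => fun i =>
    boundedPerturbation T (![realTruncation V a, realTruncation (fun x => p * V x) (p * a),
      fun _ => 0] i) t (f i)) (b := atTop) ?_ (Eventually.of_forall fun a => ?_)
  · rw [tendsto_pi_nhds]
    intro i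
    fin_cases i
    · exact hS t (f 0)
    · exact (hU t (f 1)).comp (tendsto_id.const_mul_atTop hp0)
    · have : ∀ a : ℝ, boundedPerturbation T (fun _ => 0) t (f 2) = T t (f 2) := fun a =>
        boundedPerturbation_zero hT t (f 2)
      exact tendsto_const_nhds.congr fun a => (this a).symm
  · refine boundedPerturbation_geomMean hT h0 h1 (fun i => ?_) (fun x => ?_) t hf
    · fin_cases i
      · exact isBddMeasurable_realTruncation hV a
      · exact isBddMeasurable_realTruncation (hV.const_mul p) (p * a)
      · exact IsBddMeasurable.const 0
    · have : max (min (p * V x) (p * a)) (-(p * a)) = p * max (min (V x) a) (-a) := by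
        rw [mul_max_of_nonneg _ _ hp0.le, mul_min_of_nonneg _ _ hp0.le, mul_neg]
      simp only [Matrix.cons_val_zero, Matrix.cons_val_one, Matrix.cons_val, realTruncation]
      rw [this, inv_mul_cancel_left₀ hp0.ne']
      ring

end WeightedBounds

/-! ### The interpolation inequality -/

section Interpolation

variable {Ω : Type*} [MeasurableSpace Ω] {μ : Measure Ω} {ρ : Ω → ℝ}

theorem lintegral_enorm_rpow_le_interpolation {φ : Ω → ℝ≥0∞} (hφ : AEMeasurable φ μ) {σ : ℝ}
    (h0 : 0 ≤ σ) (h1 : σ ≤ 1) :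
    ∫⁻ x, φ x ^ (1 + σ) ∂μ ≤ (∫⁻ x, φ x ∂μ) ^ (1 - σ) * (∫⁻ x, φ x ^ (2 : ℝ) ∂μ) ^ σ := by
  refine le_trans (le_of_eq (lintegral_congr fun x => ?_)) (ENNReal.lintegral_mul_norm_pow_le hφ
    (hφ.pow_const (2 : ℝ)) (sub_nonneg.2 h1) h0 (by ring))
  rw [← ENNReal.rpow_mul, ← ENNReal.rpow_add_of_nonneg _ _ (by linarith) (by linarith)]
  congr 1; ring

theorem weightedNorm_one_eq (w : Ω → ℝ) (g : Lp ℂ 2 μ) :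
    weightedNorm w 1 g = ∫⁻ x, ‖(w x : ℂ)⁻¹ * g x‖ₑ ∂μ := eLpNorm_one_eq_lintegral_enorm

theorem weightedNorm_two_sq (w : Ω → ℝ) (g : Lp ℂ 2 μ) :
    weightedNorm w 2 g ^ (2 : ℝ) = ∫⁻ x, ‖(w x : ℂ)⁻¹ * g x‖ₑ ^ (2 : ℝ) ∂μ := by
  rw [weightedNorm, eLpNorm_eq_lintegral_rpow_enorm_toReal two_ne_zero ENNReal.ofNat_ne_top,
    ← ENNReal.rpow_mul]
  simp

theorem enorm_weight_mul_le {w : ℝ} {θ : ℝ} (h0 : 0 ≤ θ) (h1 : θ ≤ 1) {a b c : ℂ}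
    (h : ‖a‖ ≤ ‖b‖ ^ θ * ‖c‖ ^ (1 - θ)) :
    ‖(w : ℂ)⁻¹ * a‖ₑ ≤ ‖(w : ℂ)⁻¹ * b‖ₑ ^ θ * ‖(w : ℂ)⁻¹ * c‖ₑ ^ (1 - θ) := by
  have h2 : ‖a‖ₑ ≤ ‖b‖ₑ ^ θ * ‖c‖ₑ ^ (1 - θ) := by
    rw [← ofReal_norm, ← ofReal_norm, ← ofReal_norm, ENNReal.ofReal_rpow_of_nonneg (norm_nonneg _) h0,
      ENNReal.ofReal_rpow_of_nonneg (norm_nonneg _) (sub_nonneg.2 h1),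
      ← ENNReal.ofReal_mul (by positivity)]
    exact ENNReal.ofReal_le_ofReal h
  rw [enorm_mul, enorm_mul, enorm_mul, ENNReal.mul_rpow_of_nonneg _ _ h0,
    ENNReal.mul_rpow_of_nonneg _ _ (sub_nonneg.2 h1), mul_mul_mul_comm,
    ← ENNReal.rpow_add_of_nonneg _ _ h0 (sub_nonneg.2 h1), add_sub_cancel, ENNReal.rpow_one]
  gcongr

/-- The cutoffs in g keep arbitrary positive powers of g / ρ^α inside L₂. -/
theorem IsNice.exists_weightedPow {g : Lp ℂ 2 μ} (hg : IsNice ρ g) (hρ : Measurable ρ)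
    (hpos : ∀ x, 0 < ρ x) (α : ℝ) {s : ℝ} (hs : 0 < s) : ∃ u : Lp ℂ 2 μ, 0 ≤ u ∧
      u =ᵐ[μ] fun x => ((ρ x ^ α * (‖g x‖ / ρ x ^ α) ^ s : ℝ) : ℂ) := by
  obtain ⟨E, R, hE, hfin, hR, hlog, h⟩ := hg
  have hw : ∀ x ∈ E, ∀ β : ℝ, ρ x ^ β ≤ Real.exp (R * |β|) := by
    intro x hx β
    rw [Real.rpow_def_of_pos (hpos x)]
    refine Real.exp_le_exp.2 ((le_abs_self _).trans ?_)
    rw [abs_mul]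
    gcongr
    exact hlog x hx
  have hm : MemLp (fun x => ((ρ x ^ α * (‖g x‖ / ρ x ^ α) ^ s : ℝ) : ℂ)) 2 μ := by
    refine memLp_of_bound_of_support ?_ hE hfin
      (C := Real.exp (R * |α|) * (R * Real.exp (R * |-α|)) ^ s) ?_ 2
    · exact (Complex.measurable_ofReal.comp ((hρ.pow_const α).mul
        (((Lp.stronglyMeasurable g).measurable.norm.div
          (hρ.pow_const α)).pow_const s))).aestronglyMeasurable
    · filter_upwards [h] with x hx
      by_cases hxE : x ∈ E
      · refine ⟨?_, fun h => absurd hxE h⟩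
        rw [Complex.norm_real, Real.norm_of_nonneg
          (mul_nonneg (Real.rpow_nonneg (hpos x).le _) (Real.rpow_nonneg
            (div_nonneg (norm_nonneg _) (Real.rpow_nonneg (hpos x).le _)) _))]
        refine mul_le_mul (hw x hxE α) (Real.rpow_le_rpow
          (div_nonneg (norm_nonneg _) (Real.rpow_nonneg (hpos x).le _)) ?_ hs.le)
          (Real.rpow_nonneg (div_nonneg (norm_nonneg _) (Real.rpow_nonneg (hpos x).le _)) _)
          (Real.exp_pos _).le
        rw [div_eq_mul_inv, ← Real.rpow_neg (hpos x).le]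
        exact mul_le_mul hx.1 (hw x hxE (-α)) (Real.rpow_nonneg (hpos x).le _) hR
      · have e : ((ρ x ^ α * (‖g x‖ / ρ x ^ α) ^ s : ℝ) : ℂ) = 0 := by
          rw [hx.2 hxE, norm_zero, zero_div, Real.zero_rpow hs.ne', mul_zero, Complex.ofReal_zero]
        rw [e, norm_zero]
        exact ⟨by positivity, fun _ => rfl⟩
  refine ⟨hm.toLp _, ?_, hm.coeFn_toLp⟩
  rw [Lp_nonneg_iff']
  filter_upwards [hm.coeFn_toLp] with x hx
  rw [hx]
  have := Real.rpow_nonneg (hpos x).le α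
  exact_mod_cast mul_nonneg this (Real.rpow_nonneg (div_nonneg (norm_nonneg _) this) _)

theorem enorm_weightedPow {w : ℝ} (hw : 0 < w) (z : ℂ) {s : ℝ} (hs : 0 ≤ s) :
    ‖(w : ℂ)⁻¹ * ((w * (‖z‖ / w) ^ s : ℝ) : ℂ)‖ₑ = ‖(w : ℂ)⁻¹ * z‖ₑ ^ s := by
  have h1 : 0 ≤ ‖z‖ / w := by positivity
  have e : (w : ℂ)⁻¹ * ((w * (‖z‖ / w) ^ s : ℝ) : ℂ) = (((‖z‖ / w) ^ s : ℝ) : ℂ) := by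
    rw [Complex.ofReal_mul, inv_mul_cancel_left₀ (by exact_mod_cast hw.ne')]
  rw [e, ← ofReal_norm, ← ofReal_norm, Complex.norm_real, norm_mul, norm_inv, Complex.norm_real,
    Real.norm_of_nonneg (by positivity), Real.norm_of_nonneg hw.le,
    ENNReal.ofReal_rpow_of_nonneg (by positivity) hs]
  congr 2
  rw [div_eq_inv_mul]

/-- The interpolation step: a bound for the weighted `L₂`-norm of `A g` in terms of weighted `L₁`-
and `L₂`-norms of `g` if `A` lies below a geometric mean of `B` and `D`. -/
theorem weightedNorm_two_interpolation (hρ : Measurable ρ) (hpos : ∀ x, 0 < ρ x) (α : ℝ) {θ : ℝ}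
    (h0 : 0 < θ) (h1 : θ < 1) {A B D : Lp ℂ 2 μ →L[ℂ] Lp ℂ 2 μ}
    (hgeo : ∀ f ∈ geomMeanSet μ θ, ![A (f 0), B (f 1), D (f 2)] ∈ geomMeanSet μ θ)
    {KA KB KD : ℝ≥0∞}
    (hA : ∀ g, weightedNorm (fun x => ρ x ^ α) 1 (A g) ≤ KA * weightedNorm (fun x => ρ x ^ α) 1 g)
    (hB : ∀ g, weightedNorm (fun x => ρ x ^ α) 2 (B g) ≤ KB * weightedNorm (fun x => ρ x ^ α) 2 g)
    (hD : ∀ g, weightedNorm (fun x => ρ x ^ α) ∞ (D g) ≤ KD * weightedNorm (fun x => ρ x ^ α) 1 g)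
    {σ : ℝ} (hσ : σ = θ / (2 - θ)) {g : Lp ℂ 2 μ} (hg : IsNice ρ g) (hg0 : 0 ≤ g) :
    weightedNorm (fun x => ρ x ^ α) 2 (A g) ^ (2 : ℝ) ≤
      (KD * KA * weightedNorm (fun x => ρ x ^ α) 1 g ^ (2 : ℝ)) ^ (1 - σ) *
        (KB ^ (2 : ℝ) * weightedNorm (fun x => ρ x ^ α) 2 g ^ (2 : ℝ)) ^ σ := by
  have h2θ : 0 < 2 - θ := by linarith
  have hσ0 : 0 < σ := by rw [hσ]; positivity
  have hσ1 : σ < 1 := by rw [hσ, div_lt_one h2θ]; linarith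
  -- These identities determine σ: raised to the power 1 + σ, the geometric mean carries B with
  -- exponent 2σ, as suits an L₂ bound, and D with exponent 1 - σ.
  have e1 : θ * (1 + σ) = 2 * σ := by rw [hσ]; field_simp; ring
  have e2 : (1 - θ) * (1 + σ) = 1 - σ := by rw [hσ]; field_simp; ring
  set w : Ω → ℝ := fun x => ρ x ^ α with hw
  have hwpos : ∀ x, 0 < w x := fun x => Real.rpow_pos_of_pos (hpos x) α
  have hwm : Measurable w := hρ.pow_const α
  have hmeas : ∀ f : Lp ℂ 2 μ, AEMeasurable (fun x => ‖(w x : ℂ)⁻¹ * f x‖ₑ) μ := fun f =>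
    (aestronglyMeasurable_weight_mul hwm f).enorm
  obtain ⟨u, hu0, hu⟩ := hg.exists_weightedPow hρ hpos α (s := (1 + σ) / 2) (by linarith)
  obtain ⟨v, hv0, hv⟩ := hg.exists_weightedPow hρ hpos α (s := 1 + σ) (by linarith)
  -- With φ = |g|/w the choice is u = w φ^((1+σ)/2), v = w φ^(1+σ). Then u^θ v^(1-θ) = |g|, while
  -- the squared weighted L₂ norm of u and the weighted L₁ norm of v are both Q = ∫ φ^(1+σ).
  have hmem : ![g, u, v] ∈ geomMeanSet μ θ := by
    refine ⟨⟨hg0, hu0, hv0⟩, ?_⟩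
    change ∀ᵐ x ∂μ, ‖g x‖ ≤ ‖u x‖ ^ θ * ‖v x‖ ^ (1 - θ)
    filter_upwards [hu, hv] with x hu hv
    have hφ : 0 ≤ ‖g x‖ / w x := div_nonneg (norm_nonneg _) (hwpos x).le
    change u x = ((w x * (‖g x‖ / w x) ^ ((1 + σ) / 2) : ℝ) : ℂ) at hu
    change v x = ((w x * (‖g x‖ / w x) ^ (1 + σ) : ℝ) : ℂ) at hv
    have hp1 : 0 ≤ w x * (‖g x‖ / w x) ^ ((1 + σ) / 2) :=
      mul_nonneg (hwpos x).le (Real.rpow_nonneg hφ _)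
    have hp2 : 0 ≤ w x * (‖g x‖ / w x) ^ (1 + σ) :=
      mul_nonneg (hwpos x).le (Real.rpow_nonneg hφ _)
    rw [hu, hv, Complex.norm_real, Complex.norm_real, Real.norm_of_nonneg hp1,
      Real.norm_of_nonneg hp2,
      Real.mul_rpow (hwpos x).le (Real.rpow_nonneg hφ _),
      Real.mul_rpow (hwpos x).le (Real.rpow_nonneg hφ _), ← Real.rpow_mul hφ, ← Real.rpow_mul hφ,
      mul_mul_mul_comm, ← Real.rpow_add (hwpos x), add_sub_cancel, Real.rpow_one,
      ← Real.rpow_add_of_nonneg hφ (by nlinarith) (by nlinarith),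
      show (1 + σ) / 2 * θ + (1 + σ) * (1 - θ) = 1 by linarith [e1, e2], Real.rpow_one,
      mul_div_cancel₀ _ (hwpos x).ne']
  obtain ⟨-, hAg⟩ := hgeo _ hmem
  change ∀ᵐ x ∂μ, ‖A g x‖ ≤ ‖B u x‖ ^ θ * ‖D v x‖ ^ (1 - θ) at hAg
  set Q : ℝ≥0∞ := ∫⁻ x, ‖(w x : ℂ)⁻¹ * g x‖ₑ ^ (1 + σ) ∂μ with hQ
  have hQu : weightedNorm w 2 u ^ (2 : ℝ) = Q := by
    rw [weightedNorm_two_sq]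
    refine lintegral_congr_ae ?_
    filter_upwards [hu] with x hu
    change u x = ((w x * (‖g x‖ / w x) ^ ((1 + σ) / 2) : ℝ) : ℂ) at hu
    rw [hu, enorm_weightedPow (hwpos x) _ (by linarith), ← ENNReal.rpow_mul]
    congr 1; ring
  have hQv : weightedNorm w 1 v = Q := by
    rw [weightedNorm_one_eq]
    refine lintegral_congr_ae ?_
    filter_upwards [hv] with x hv
    change v x = ((w x * (‖g x‖ / w x) ^ (1 + σ) : ℝ) : ℂ) at hv
    rw [hv, enorm_weightedPow (hwpos x) _ (by linarith)]
  have hQle : Q ≤ weightedNorm w 1 g ^ (1 - σ) * (weightedNorm w 2 g ^ (2 : ℝ)) ^ σ := by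
    rw [weightedNorm_one_eq, weightedNorm_two_sq]
    exact lintegral_enorm_rpow_le_interpolation (hmeas g) hσ0.le hσ1.le
  -- Split the square as the power 1 - σ, kept for the L₁ bound of A, times the power 1 + σ, to
  -- which the Hölder inequality between A, B and D applies.
  have hpt : ∀ᵐ x ∂μ, ‖(w x : ℂ)⁻¹ * A g x‖ₑ ^ (2 : ℝ) ≤
      weightedNorm w ∞ (D v) ^ (1 - σ) *
        (‖(w x : ℂ)⁻¹ * A g x‖ₑ ^ (1 - σ) * (‖(w x : ℂ)⁻¹ * B u x‖ₑ ^ (2 : ℝ)) ^ σ) := by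
    have hDv : ∀ᵐ x ∂μ, ‖(w x : ℂ)⁻¹ * D v x‖ₑ ≤ weightedNorm w ∞ (D v) := by
      rw [weightedNorm, eLpNorm_exponent_top]
      exact enorm_ae_le_eLpNormEssSup _ _
    filter_upwards [hAg, hDv] with x h2 h3
    have h4 := enorm_weight_mul_le (w := w x) h0.le h1.le h2
    have h5 := ENNReal.rpow_le_rpow h4 (show 0 ≤ 1 + σ by linarith)
    rw [ENNReal.mul_rpow_of_nonneg _ _ (by linarith), ← ENNReal.rpow_mul, ← ENNReal.rpow_mul, e1,
      e2] at h5
    calc _ = ‖(w x : ℂ)⁻¹ * A g x‖ₑ ^ (1 - σ) * ‖(w x : ℂ)⁻¹ * A g x‖ₑ ^ (1 + σ) := by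
          rw [← ENNReal.rpow_add_of_nonneg _ _ (by linarith) (by linarith)]
          congr 1; ring
      _ ≤ ‖(w x : ℂ)⁻¹ * A g x‖ₑ ^ (1 - σ) * (‖(w x : ℂ)⁻¹ * B u x‖ₑ ^ (2 * σ) *
          weightedNorm w ∞ (D v) ^ (1 - σ)) := by
          refine mul_le_mul_right (h5.trans (mul_le_mul_right ?_ _)) _
          exact ENNReal.rpow_le_rpow h3 (by linarith)
      _ = _ := by rw [ENNReal.rpow_mul]; ring
  have hint : weightedNorm w 2 (A g) ^ (2 : ℝ) ≤ weightedNorm w ∞ (D v) ^ (1 - σ) *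
      (weightedNorm w 1 (A g) ^ (1 - σ) * (weightedNorm w 2 (B u) ^ (2 : ℝ)) ^ σ) := by
    rw [weightedNorm_two_sq w (A g), weightedNorm_one_eq w (A g), weightedNorm_two_sq w (B u)]
    refine (lintegral_mono_ae hpt).trans ?_
    have hprod : AEMeasurable (fun x => ‖(w x : ℂ)⁻¹ * A g x‖ₑ ^ (1 - σ) *
        (‖(w x : ℂ)⁻¹ * B u x‖ₑ ^ (2 : ℝ)) ^ σ) μ :=
      ((hmeas _).pow_const _).mul (((hmeas _).pow_const _).pow_const _)
    rw [lintegral_const_mul'' _ hprod]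
    gcongr
    exact ENNReal.lintegral_mul_norm_pow_le (hmeas _) ((hmeas _).pow_const _) (by linarith) hσ0.le
      (by ring)
  have hσ1' : 0 ≤ 1 - σ := by linarith
  set N₁ := weightedNorm w 1 g with hN₁
  set N₂ := weightedNorm w 2 g with hN₂
  calc _ ≤ (KD * Q) ^ (1 - σ) * ((KA * N₁) ^ (1 - σ) * (KB ^ (2 : ℝ) * Q) ^ σ) := by
        refine hint.trans (mul_le_mul' (ENNReal.rpow_le_rpow ((hD v).trans (by rw [hQv])) hσ1')
          (mul_le_mul' (ENNReal.rpow_le_rpow (hA g) hσ1') (ENNReal.rpow_le_rpow ?_ hσ0.le)))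
        rw [← hQu, ← ENNReal.mul_rpow_of_nonneg _ _ zero_le_two]
        exact ENNReal.rpow_le_rpow (hB u) zero_le_two
    _ = (KD * KA * N₁) ^ (1 - σ) * (KB ^ (2 : ℝ)) ^ σ * (Q ^ (1 - σ) * Q ^ σ) := by
        simp only [ENNReal.mul_rpow_of_nonneg _ _ hσ1', ENNReal.mul_rpow_of_nonneg _ _ hσ0.le]
        ring
    _ = (KD * KA * N₁) ^ (1 - σ) * (KB ^ (2 : ℝ)) ^ σ * Q := by
        rw [← ENNReal.rpow_add_of_nonneg _ _ hσ1' hσ0.le, sub_add_cancel, ENNReal.rpow_one]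
    _ ≤ (KD * KA * N₁) ^ (1 - σ) * (KB ^ (2 : ℝ)) ^ σ * (N₁ ^ (1 - σ) * (N₂ ^ (2 : ℝ)) ^ σ) := by
        gcongr
    _ = _ := by
        rw [show N₁ ^ (2 : ℝ) = N₁ * N₁ by rw [ENNReal.rpow_two, sq]]
        simp only [ENNReal.mul_rpow_of_nonneg _ _ hσ1', ENNReal.mul_rpow_of_nonneg _ _ hσ0.le]
        ring

theorem weightedNorm_two_interpolation' (hρ : Measurable ρ) (hpos : ∀ x, 0 < ρ x) (α : ℝ) {θ : ℝ}
    (h0 : 0 < θ) (h1 : θ < 1) {A B D : Lp ℂ 2 μ →L[ℂ] Lp ℂ 2 μ}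
    (hgeo : ∀ f ∈ geomMeanSet μ θ, ![A (f 0), B (f 1), D (f 2)] ∈ geomMeanSet μ θ)
    {KA KB KD : ℝ≥0∞}
    (hA : ∀ g, weightedNorm (fun x => ρ x ^ α) 1 (A g) ≤ KA * weightedNorm (fun x => ρ x ^ α) 1 g)
    (hB : ∀ g, weightedNorm (fun x => ρ x ^ α) 2 (B g) ≤ KB * weightedNorm (fun x => ρ x ^ α) 2 g)
    (hD : ∀ g, weightedNorm (fun x => ρ x ^ α) ∞ (D g) ≤ KD * weightedNorm (fun x => ρ x ^ α) 1 g)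
    {σ : ℝ} (hσ : σ = θ / (2 - θ)) {g : Lp ℂ 2 μ} (hg0 : 0 ≤ g) :
    weightedNorm (fun x => ρ x ^ α) 2 (A g) ^ (2 : ℝ) ≤
      (KD * KA * weightedNorm (fun x => ρ x ^ α) 1 g ^ (2 : ℝ)) ^ (1 - σ) *
        (KB ^ (2 : ℝ) * weightedNorm (fun x => ρ x ^ α) 2 g ^ (2 : ℝ)) ^ σ := by
  have hσ0 : 0 ≤ σ := by rw [hσ]; exact div_nonneg h0.le (by linarith)
  have hσ1 : 0 ≤ 1 - σ := by
    rw [hσ, sub_nonneg, div_le_one (by linarith)]; linarith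
  obtain ⟨g', hn, hlim, hg'⟩ := exists_isNice_tendsto hρ g
  have hg'0 : ∀ n, 0 ≤ g' n := fun n => by
    rw [Lp_nonneg_iff'] at hg0 ⊢
    filter_upwards [hg0, hg' n] with x h1 h2
    rcases h2 with h2 | h2 <;> rw [h2]
    exact h1
  have hmono : ∀ (n : ℕ) (r : ℝ≥0∞), weightedNorm (fun x => ρ x ^ α) r (g' n) ≤
      weightedNorm (fun x => ρ x ^ α) r g := fun n r => by
    refine weightedNorm_mono ?_
    filter_upwards [hg' n] with x h2
    rcases h2 with h2 | h2 <;> rw [h2]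
    simp
  rw [← ENNReal.le_rpow_inv_iff two_pos]
  refine weightedNorm_le_of_tendsto (hρ.pow_const α) ((A.continuous.tendsto g).comp hlim)
    fun n => ?_
  rw [ENNReal.le_rpow_inv_iff two_pos]
  refine (weightedNorm_two_interpolation hρ hpos α h0 h1 hgeo hA hB hD hσ (hn n) (hg'0 n)).trans ?_
  gcongr <;> exact hmono _ _

end Interpolation

/-! ### Closing the doubling inequality: the weighted L₁ → L₂ bound -/

section Iteration

/-- The supremum s of y over (0, t] is finite and satisfies s ≤ L s^σ, because every r in (0, t] is
twice a point of the same interval. As σ < 1, this bounds s. -/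
theorem le_rpow_of_doubling {y : ℝ≥0 → ℝ} {L σ : ℝ} (hL : 0 ≤ L) (h0 : 0 ≤ σ) (h1 : σ < 1)
    (hy : ∀ t, 0 ≤ y t) (hb : ∀ t₀ : ℝ≥0, ∃ B, ∀ t, 0 < t → t ≤ t₀ → y t ≤ B)
    (hstep : ∀ t, 0 < t → y (2 * t) ≤ L * y t ^ σ) {t : ℝ≥0} (ht : 0 < t) :
    y t ≤ L ^ (1 / (1 - σ)) := by
  have h1' : 0 < 1 - σ := by linarith
  obtain ⟨B, hB⟩ := hb t
  set s := sSup (y '' Set.Ioc 0 t) with hs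
  have hbdd : BddAbove (y '' Set.Ioc 0 t) := ⟨B, by rintro _ ⟨r, hr, rfl⟩; exact hB r hr.1 hr.2⟩
  have hle : ∀ r, 0 < r → r ≤ t → y r ≤ s := fun r hr hrt => le_csSup hbdd ⟨r, ⟨hr, hrt⟩, rfl⟩
  have hsL : s ≤ L * s ^ σ := by
    refine csSup_le ⟨y t, t, ⟨ht, le_rfl⟩, rfl⟩ ?_
    rintro _ ⟨r, hr, rfl⟩
    have h2 := hstep (r / 2) (half_pos hr.1)
    rw [mul_div_cancel₀ r two_ne_zero] at h2
    refine h2.trans (mul_le_mul_of_nonneg_left ?_ hL)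
    exact Real.rpow_le_rpow (hy _) (hle _ (half_pos hr.1) ((half_le_self zero_le).trans hr.2)) h0
  refine (hle t ht le_rfl).trans ?_
  rcases le_or_gt s 0 with h | h
  · exact h.trans (Real.rpow_nonneg hL _)
  · have h3 : s ^ (1 - σ) ≤ L := by
      refine le_of_mul_le_mul_right ?_ (Real.rpow_pos_of_pos h σ)
      rwa [← Real.rpow_add h, sub_add_cancel, Real.rpow_one]
    calc s = (s ^ (1 - σ)) ^ (1 / (1 - σ)) := by
          rw [← Real.rpow_mul h.le, mul_one_div_cancel h1'.ne', Real.rpow_one]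
      _ ≤ _ := Real.rpow_le_rpow (Real.rpow_nonneg h.le _) h3 (by positivity)

theorem rescaled_interpolation_eq {a E K n σ : ℝ} (ha : 0 < a) (hE : 0 < E) (hK : 0 ≤ K)
    (hn : 0 ≤ n) : a * (E ^ 2)⁻¹ * ((K * (a⁻¹ * E ^ 2)) ^ (1 - σ) * (E * n) ^ σ) =
      K ^ (1 - σ) * (a * E⁻¹ * n) ^ σ := by
  set b := a⁻¹ * E ^ 2 with hb
  have hb0 : 0 < b := by positivity
  have e1 : E * n = b * (a * E⁻¹ * n) := by rw [hb]; field_simp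
  have e2 : a * (E ^ 2)⁻¹ = b⁻¹ := by rw [hb]; field_simp
  have e3 : b ^ (1 - σ) * b ^ σ = b := by rw [← Real.rpow_add hb0, sub_add_cancel, Real.rpow_one]
  rw [e2, e1, Real.mul_rpow hK hb0.le, Real.mul_rpow hb0.le (by positivity)]
  calc _ = b⁻¹ * (b ^ (1 - σ) * b ^ σ) * (K ^ (1 - σ) * (a * E⁻¹ * n) ^ σ) := by ring
    _ = _ := by rw [e3, inv_mul_cancel₀ hb0.ne', one_mul]

variable {Ω : Type*} [MeasurableSpace Ω] {μ : Measure Ω} {ρ : Ω → ℝ}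
  {T S U : ℝ≥0 → Lp ℂ 2 μ →L[ℂ] Lp ℂ 2 μ}

theorem IsNice.weightedNorm_ne_top {g : Lp ℂ 2 μ} (hg : IsNice ρ g) (hρ : Measurable ρ)
    (hpos : ∀ x, 0 < ρ x) (α : ℝ) (q : ℝ≥0∞) : weightedNorm (fun x => ρ x ^ α) q g ≠ ∞ := by
  obtain ⟨E, R, hE, hfin, hR, hlog, h⟩ := hg
  refine (memLp_of_bound_of_support (C := Real.exp (|-α| * R) * R)
    (aestronglyMeasurable_weight_mul (hρ.pow_const α) g) hE hfin ?_ q).2.ne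
  filter_upwards [h] with x hx
  by_cases hxE : x ∈ E
  · refine ⟨?_, fun h => absurd hxE h⟩
    rw [norm_mul, norm_inv, Complex.norm_real,
      Real.norm_of_nonneg (Real.rpow_nonneg (hpos x).le α), ← Real.rpow_neg (hpos x).le,
      Real.rpow_def_of_pos (hpos x), mul_comm (Real.log _)]
    refine mul_le_mul (Real.exp_le_exp.2 ((le_abs_self _).trans ?_)) hx.1 (norm_nonneg _)
      (Real.exp_pos _).le
    rw [abs_mul]
    gcongr
    exact hlog x hxE
  · rw [hx.2 hxE, mul_zero, norm_zero]
    exact ⟨by positivity, fun _ => rfl⟩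

theorem IsNice.absLp {g : Lp ℂ 2 μ} (hg : IsNice ρ g) : IsNice ρ (absLp g) := by
  obtain ⟨E, R, hE, hfin, hR, hlog, h⟩ := hg
  refine ⟨E, R, hE, hfin, hR, hlog, ?_⟩
  filter_upwards [h, absLp_ae g] with x h1 h2
  rw [h2, Complex.norm_real, norm_norm]
  exact ⟨h1.1, fun hx => by rw [h1.2 hx]; simp⟩

/-- The weighted `L₁ → L₂` bound, obtained by iterating the interpolation step. -/
theorem weightedNorm_one_two_le (hρ : Measurable ρ) (hpos : ∀ x, 0 < ρ x) (α : ℝ) {θ : ℝ}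
    (h0 : 0 < θ) (h1 : θ < 1) (hS : IsPositiveSymmetricSemigroup S)
    (hgeo : ∀ t, ∀ f ∈ geomMeanSet μ θ, ![S t (f 0), U t (f 1), T t (f 2)] ∈ geomMeanSet μ θ)
    {c ν M ω : ℝ} (hc : 0 < c) (hν : 0 < ν) (hM : 1 ≤ M) (hω : 0 ≤ ω)
    (hT : ∀ t, 0 < t → ∀ g, weightedNorm (fun x => ρ x ^ α) ∞ (T t g) ≤
      ENNReal.ofReal (c * (t : ℝ) ^ (-ν) * Real.exp (α ^ 2 * t)) *
        weightedNorm (fun x => ρ x ^ α) 1 g)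
    (hS1 : ∀ t, 0 < t → ∀ g, weightedNorm (fun x => ρ x ^ α) 1 (S t g) ≤
      ENNReal.ofReal (M * Real.exp (α ^ 2 * t)) * weightedNorm (fun x => ρ x ^ α) 1 g)
    (hU : ∀ t, 0 < t → ∀ g, weightedNorm (fun x => ρ x ^ α) 2 (U t g) ≤
      ENNReal.ofReal (Real.exp (α ^ 2 * t)) * weightedNorm (fun x => ρ x ^ α) 2 g)
    (hS2 : ∀ t, 0 < t → ∀ g, weightedNorm (fun x => ρ x ^ α) 2 (S t g) ≤
      ENNReal.ofReal (Real.exp ((ω + α ^ 2) * t)) * weightedNorm (fun x => ρ x ^ α) 2 g)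
    {σ : ℝ} (hσ : σ = θ / (2 - θ)) {t : ℝ≥0} (ht : 0 < t) (g : Lp ℂ 2 μ) :
    weightedNorm (fun x => ρ x ^ α) 2 (S t g) ≤
      ENNReal.ofReal (√((2 ^ ν) ^ (1 / (1 - σ)) * (c * M ^ 3) * (t : ℝ) ^ (-ν)) *
        Real.exp (α ^ 2 * t)) * weightedNorm (fun x => ρ x ^ α) 1 g := by
  have h2θ : 0 < 2 - θ := by linarith
  have hσ0 : 0 < σ := by rw [hσ]; positivity
  have hσ1 : σ < 1 := by rw [hσ, div_lt_one h2θ]; linarith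
  have hσ1' : 0 < 1 - σ := by linarith
  refine weightedNorm_apply_le_of_isNice hρ (hρ.pow_const α) (fun g hg => ?_) g
  wlog hg0 : 0 ≤ g generalizing g
  · have := this (absLp g) hg.absLp (absLp_nonneg g)
    rw [weightedNorm_absLp] at this
    exact (weightedNorm_mono ((hS.pos t).norm_apply_le_absLp g)).trans this
  set N : ℝ≥0∞ → Lp ℂ 2 μ → ℝ≥0∞ := weightedNorm (fun x => ρ x ^ α) with hN
  have hfin : ∀ q, N q g ≠ ∞ := fun q => hg.weightedNorm_ne_top hρ hpos α q
  set m : ℝ := (N 1 g).toReal with hm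
  have hm0 : 0 ≤ m := ENNReal.toReal_nonneg
  have hmN : N 1 g = ENNReal.ofReal m := (ENNReal.ofReal_toReal (hfin 1)).symm
  set m₂ : ℝ := (N 2 g).toReal with hm₂
  have hm₂0 : 0 ≤ m₂ := ENNReal.toReal_nonneg
  have hm₂N : N 2 g = ENNReal.ofReal m₂ := (ENNReal.ofReal_toReal (hfin 2)).symm
  set n : ℝ≥0 → ℝ := fun t => (N 2 (S t g)).toReal with hn
  have hn0 : ∀ t, 0 ≤ n t := fun t => ENNReal.toReal_nonneg
  have hSle : ∀ t, 0 < t → N 2 (S t g) ≤ ENNReal.ofReal (Real.exp ((ω + α ^ 2) * t) * m₂) :=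
    fun t ht => (hS2 t ht g).trans (by
      rw [ENNReal.ofReal_mul (Real.exp_pos _).le, ← hm₂N])
  have hnN : ∀ t, 0 < t → N 2 (S t g) = ENNReal.ofReal (n t) := fun t ht =>
    (ENNReal.ofReal_toReal ((hSle t ht).trans_lt ENNReal.ofReal_lt_top).ne).symm
  have hnle : ∀ t, 0 < t → n t ≤ Real.exp ((ω + α ^ 2) * t) * m₂ := fun t ht =>
    ENNReal.toReal_le_of_le_ofReal (by positivity) (hSle t ht)
  have hstep : ∀ t : ℝ≥0, 0 < t → n (2 * t) ^ 2 ≤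
      (c * M ^ 3 * m ^ 2 * (((t : ℝ) ^ ν)⁻¹ * Real.exp (2 * (α ^ 2 * t)) ^ 2)) ^ (1 - σ) *
        (Real.exp (2 * (α ^ 2 * t)) * n t ^ 2) ^ σ := by
    intro t ht
    have ht' : 0 < (t : ℝ) := NNReal.coe_pos.2 ht
    -- Applied to S(t)g in place of g. The L₁ bound enters once as the constant of A and twice
    -- through the squared L₁ norm of S(t)g, whence M³.
    have h3 := weightedNorm_two_interpolation' hρ hpos α h0 h1 (hgeo t) (hS1 t ht) (hU t ht)
      (hT t ht) hσ ((hS.pos t).map_nonneg hg0)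
    have e : S t (S t g) = S (2 * t) g := by
      rw [two_mul, hS.isC0.map_add]; rfl
    rw [e] at h3
    change N 2 (S (2 * t) g) ^ (2 : ℝ) ≤ (_ * _ * N 1 (S t g) ^ (2 : ℝ)) ^ (1 - σ) *
      (_ * N 2 (S t g) ^ (2 : ℝ)) ^ σ at h3
    have h4 : N 1 (S t g) ≤ ENNReal.ofReal (M * Real.exp (α ^ 2 * t) * m) :=
      (hS1 t ht g).trans (by
        rw [ENNReal.ofReal_mul (by positivity : 0 ≤ M * Real.exp (α ^ 2 * t)), ← hmN])
    have h5 := h3.trans (mul_le_mul_left (ENNReal.rpow_le_rpow (mul_le_mul_right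
      (ENNReal.rpow_le_rpow h4 zero_le_two) _) hσ1'.le) _)
    rw [hnN _ (by positivity), hnN t ht] at h5
    have hτ : 0 ≤ (t : ℝ) ^ (-ν) := Real.rpow_nonneg ht'.le _
    have hM0 : 0 ≤ M := by linarith
    have hnt := hn0 t
    rw [ENNReal.ofReal_rpow_of_nonneg (hn0 _) zero_le_two,
      ENNReal.ofReal_rpow_of_nonneg (hn0 _) zero_le_two,
      ENNReal.ofReal_rpow_of_nonneg (by positivity) zero_le_two,
      ENNReal.ofReal_rpow_of_nonneg (by positivity) zero_le_two,
      ← ENNReal.ofReal_mul (by positivity), ← ENNReal.ofReal_mul (by positivity),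
      ← ENNReal.ofReal_mul (by positivity),
      ENNReal.ofReal_rpow_of_nonneg (by positivity) hσ1'.le,
      ENNReal.ofReal_rpow_of_nonneg (by positivity) hσ0.le,
      ← ENNReal.ofReal_mul (by positivity), ENNReal.ofReal_le_ofReal_iff (by positivity)] at h5
    simp only [Real.rpow_two] at h5
    refine h5.trans (le_of_eq ?_)
    have hexp : Real.exp (2 * (α ^ 2 * t)) = Real.exp (α ^ 2 * t) ^ 2 := by
      rw [← Real.exp_nat_mul]; norm_num
    rw [Real.rpow_neg ht'.le, hexp]
    congr 2
    ring
  -- The weight t^ν e^(-2α²t) turns the step into an autonomous one. The power 1/(1-σ) then restores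
  -- cM³m² to the first power, so the final bound is homogeneous in g.
  have hy := le_rpow_of_doubling (y := fun t => (t : ℝ) ^ ν * (Real.exp (2 * (α ^ 2 * t)))⁻¹ *
    n t ^ 2) (L := 2 ^ ν * (c * M ^ 3 * m ^ 2) ^ (1 - σ)) (σ := σ) (by positivity) hσ0.le hσ1
    (fun t => by positivity) (fun t₀ => ?_) (fun t ht => ?_) ht
  · rw [Real.mul_rpow (by positivity) (by positivity), 
      ← Real.rpow_mul (show 0 ≤ c * M ^ 3 * m ^ 2 by positivity),
      mul_one_div_cancel hσ1'.ne', Real.rpow_one] at hy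
    have ht' : 0 < (t : ℝ) := NNReal.coe_pos.2 ht
    have hexp : Real.exp (2 * (α ^ 2 * t)) = Real.exp (α ^ 2 * t) ^ 2 := by
      rw [← Real.exp_nat_mul]; norm_num
    set D : ℝ := (2 ^ ν) ^ (1 / (1 - σ)) * (c * M ^ 3) with hD
    have hD0 : 0 ≤ D := by positivity
    have hτ : 0 < (t : ℝ) ^ ν := Real.rpow_pos_of_pos ht' ν
    have h6 : n t ^ 2 ≤ (√(D * (t : ℝ) ^ (-ν)) * Real.exp (α ^ 2 * t) * m) ^ 2 := by
      rw [mul_pow, mul_pow, Real.sq_sqrt (by positivity), ← hexp, Real.rpow_neg ht'.le]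
      have hE := Real.exp_pos (2 * (α ^ 2 * t))
      calc n t ^ 2 = ((t : ℝ) ^ ν)⁻¹ * Real.exp (2 * (α ^ 2 * t)) *
            ((t : ℝ) ^ ν * (Real.exp (2 * (α ^ 2 * t)))⁻¹ * n t ^ 2) := by field_simp
        _ ≤ ((t : ℝ) ^ ν)⁻¹ * Real.exp (2 * (α ^ 2 * t)) *
            ((2 ^ ν) ^ (1 / (1 - σ)) * (c * M ^ 3 * m ^ 2)) := by gcongr
        _ = _ := by rw [hD]; ring
    have h7 := (sq_le_sq₀ (hn0 t) (by positivity)).1 h6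
    rw [hmN, ← ENNReal.ofReal_mul (by positivity), hnN t ht]
    exact ENNReal.ofReal_le_ofReal h7
  -- Only a priori finiteness is needed here, so the weighted L₂ bound with the factor e^(ωt) and a
  -- dependence on the L₂ norm of g is harmless.
  · refine ⟨(t₀ : ℝ) ^ ν * 1 * (Real.exp ((ω + α ^ 2) * t₀) * m₂) ^ 2, fun t ht htt => ?_⟩
    have htt' : (t : ℝ) ≤ t₀ := NNReal.coe_le_coe.2 htt
    have h8 : n t ≤ Real.exp ((ω + α ^ 2) * t₀) * m₂ := (hnle t ht).trans (by gcongr)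
    have h9 : (Real.exp (2 * (α ^ 2 * t)))⁻¹ ≤ 1 :=
      inv_le_one_of_one_le₀ (Real.one_le_exp (by positivity))
    gcongr
  · have ht' : 0 < (t : ℝ) := NNReal.coe_pos.2 ht
    have e4 : Real.exp (2 * (α ^ 2 * (2 * t : ℝ≥0))) = Real.exp (2 * (α ^ 2 * t)) ^ 2 := by
      rw [← Real.exp_nat_mul]; push_cast; ring_nf
    simp only [e4]
    push_cast
    rw [Real.mul_rpow zero_le_two ht'.le]
    have hτ : 0 < (t : ℝ) ^ ν := Real.rpow_pos_of_pos ht' ν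
    calc _ ≤ 2 ^ ν * (t : ℝ) ^ ν * (Real.exp (2 * (α ^ 2 * t)) ^ 2)⁻¹ *
          ((c * M ^ 3 * m ^ 2 * (((t : ℝ) ^ ν)⁻¹ * Real.exp (2 * (α ^ 2 * t)) ^ 2)) ^ (1 - σ) *
          (Real.exp (2 * (α ^ 2 * t)) * n t ^ 2) ^ σ) := by
          gcongr
          exact hstep t ht
      _ = 2 ^ ν * ((t : ℝ) ^ ν * (Real.exp (2 * (α ^ 2 * t)) ^ 2)⁻¹ *
          ((c * M ^ 3 * m ^ 2 * (((t : ℝ) ^ ν)⁻¹ * Real.exp (2 * (α ^ 2 * t)) ^ 2)) ^ (1 - σ) *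
          (Real.exp (2 * (α ^ 2 * t)) * n t ^ 2) ^ σ)) := by ring
      _ = _ := by
          rw [rescaled_interpolation_eq hτ (Real.exp_pos _) (by positivity) (by positivity)]
          ring

end Iteration

/-! ### From L₁ → L₂ to L₁ → L_∞ by duality -/

section Duality

variable {Ω : Type*} [MeasurableSpace Ω] {μ : Measure Ω} {ρ : Ω → ℝ}
  {S : ℝ≥0 → Lp ℂ 2 μ →L[ℂ] Lp ℂ 2 μ}

/-- A nonnegative `L₂`-function is bounded by `C ρ ^ α` if its pairings with nonnegative functions
are controlled by the dual weighted `L₁`-norm. -/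
theorem weightedNorm_top_le_of_inner (hρ : Measurable ρ) (hpos : ∀ x, 0 < ρ x) (α : ℝ)
    {G : Lp ℂ 2 μ} (hG : 0 ≤ G) {C : ℝ} (hC : 0 ≤ C)
    (h : ∀ v : Lp ℂ 2 μ, ‖inner ℂ v G‖ₑ ≤
      ENNReal.ofReal C * weightedNorm (fun x => ρ x ^ (-α)) 1 v) :
    weightedNorm (fun x => ρ x ^ α) ∞ G ≤ ENNReal.ofReal C := by
  set w : Ω → ℝ := fun x => ρ x ^ α with hw
  have hwpos : ∀ x, 0 < w x := fun x => Real.rpow_pos_of_pos (hpos x) α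
  have hwm : Measurable w := hρ.pow_const α
  have hGm : Measurable fun x => ‖G x‖ := (Lp.stronglyMeasurable G).measurable.norm
  -- These sets exhaust the points where |G| exceeds C w. The bound on |log ρ| and the finite
  -- measure make w⁻¹ times the indicator an admissible test function in L₂.
  set E : ℕ → Set Ω := fun n => {x | |Real.log (ρ x)| ≤ n} ∩
    ({x | (1 : ℝ) / (n + 1) ≤ ‖G x‖} ∩ {x | C + 1 / (n + 1) ≤ (w x)⁻¹ * ‖G x‖}) with hE
  have hEm : ∀ n, MeasurableSet (E n) := fun n =>
    (measurableSet_le (hρ.log.abs) measurable_const).inter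
      ((measurableSet_le measurable_const hGm).inter
        (measurableSet_le measurable_const (hwm.inv.mul hGm)))
  have hEfin : ∀ n, μ (E n) < ∞ := fun n => by
    have hpos : (0 : ℝ) < 1 / (n + 1) := by positivity
    refine (measure_mono ?_).trans_lt ((Lp.memLp G).meas_ge_lt_top' two_ne_zero
      ENNReal.ofNat_ne_top (ε := ENNReal.ofReal (1 / (n + 1))) (by simpa using hpos))
    intro x hx
    have := hx.2.1
    change ENNReal.ofReal (1 / (n + 1)) ≤ ‖G x‖ₑ
    rw [← ofReal_norm]
    exact ENNReal.ofReal_le_ofReal this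
  have hzero : ∀ n, μ (E n) = 0 := by
    intro n
    have hvm : MemLp ((E n).indicator fun x => (((w x)⁻¹ : ℝ) : ℂ)) 2 μ := by
      refine memLp_of_bound_of_support ((Complex.measurable_ofReal.comp
        hwm.inv).indicator (hEm n)).aestronglyMeasurable (hEm n) (hEfin n)
        (C := Real.exp (n * |-α|)) (Eventually.of_forall fun x => ?_) 2
      by_cases hx : x ∈ E n
      · refine ⟨?_, fun h => absurd hx h⟩
        rw [Set.indicator_of_mem hx]
        change ‖(((w x)⁻¹ : ℝ) : ℂ)‖ ≤ _
        rw [Complex.norm_real, Real.norm_of_nonneg (inv_pos.2 (hwpos x)).le, hw, ← Real.rpow_neg (hpos x).le,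
          Real.rpow_def_of_pos (hpos x)]
        refine Real.exp_le_exp.2 ((le_abs_self _).trans ?_)
        rw [abs_mul]
        gcongr
        exact hx.1
      · rw [Set.indicator_of_notMem hx, norm_zero]
        exact ⟨by positivity, fun _ => rfl⟩
    set v : Lp ℂ 2 μ := hvm.toLp _ with hv
    have hvae : v =ᵐ[μ] (E n).indicator fun x => (((w x)⁻¹ : ℝ) : ℂ) := hvm.coeFn_toLp
    have h1 : weightedNorm (fun x => ρ x ^ (-α)) 1 v = μ (E n) := by
      rw [weightedNorm_one_eq, ← lintegral_indicator_one (hEm n)]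
      refine lintegral_congr_ae ?_
      filter_upwards [hvae] with x hx
      rw [hx]
      by_cases hxE : x ∈ E n
      · rw [Set.indicator_of_mem hxE, Set.indicator_of_mem hxE, Real.rpow_neg (hpos x).le,
          ← Complex.ofReal_inv, ← Complex.ofReal_mul, inv_inv, hw,
          mul_inv_cancel₀ (hwpos x).ne']
        simp
      · rw [Set.indicator_of_notMem hxE, Set.indicator_of_notMem hxE, mul_zero, enorm_zero]
    have h2 : (C + 1 / (n + 1)) * μ.real (E n) ≤ (inner ℂ v G).re := by
      rw [L2.inner_def]
      have h3 := L2.integrable_inner (𝕜 := ℂ) v G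
      have h4 := integral_re (𝕜 := ℂ) h3
      change _ = (∫ a, inner ℂ (v a) (G a) ∂μ).re at h4
      rw [← h4, mul_comm, ← smul_eq_mul, ← integral_indicator_const _ (hEm n)]
      refine integral_mono_ae ((integrable_indicator_iff (hEm n)).2
        (integrableOn_const (hEfin n).ne)) h3.re ?_
      rw [Lp_nonneg_iff'] at hG
      filter_upwards [hvae, hG] with x h5 h6
      rw [h5, RCLike.inner_apply]
      by_cases hxE : x ∈ E n
      · rw [Set.indicator_of_mem hxE, Set.indicator_of_mem hxE, Complex.conj_ofReal]
        refine hxE.2.2.trans (le_of_eq ?_)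
        rw [norm_eq_re_of_nonneg h6]
        change _ = (G x * (((w x)⁻¹ : ℝ) : ℂ)).re
        rw [Complex.re_mul_ofReal, mul_comm]
      · rw [Set.indicator_of_notMem hxE, Set.indicator_of_notMem hxE]
        simp
    have h3 := h v
    rw [h1, ← ofReal_norm, ← ENNReal.ofReal_toReal (hEfin n).ne, ← ENNReal.ofReal_mul hC,
      ENNReal.ofReal_le_ofReal_iff (mul_nonneg hC ENNReal.toReal_nonneg)] at h3
    have h4 : (C + 1 / (n + 1)) * μ.real (E n) ≤ C * μ.real (E n) :=
      h2.trans ((Complex.re_le_norm _).trans h3)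
    have h5 : (0 : ℝ) < 1 / (n + 1) := by positivity
    have h6 : μ.real (E n) ≤ 0 := by nlinarith [measureReal_nonneg (μ := μ) (s := E n)]
    exact (measureReal_eq_zero_iff (hEfin n).ne).1 (le_antisymm h6 measureReal_nonneg)
  rw [weightedNorm, eLpNorm_exponent_top]
  refine eLpNormEssSup_le_of_ae_bound ?_
  have hall : ∀ᵐ x ∂μ, ∀ n, x ∉ E n := ae_all_iff.2 fun n => by
    rw [ae_iff]; simpa using hzero n
  filter_upwards [hall] with x hx
  by_contra! hlt
  rw [norm_mul, norm_inv, Complex.norm_real, Real.norm_of_nonneg (hwpos x).le] at hlt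
  have hGx : 0 < ‖G x‖ := by
    by_contra! h0
    rw [le_antisymm h0 (norm_nonneg _), mul_zero] at hlt
    linarith
  have h1 : ∀ δ : ℝ, 0 < δ → ∀ᶠ n : ℕ in atTop, (1 : ℝ) / (n + 1) < δ := fun δ hδ =>
    tendsto_one_div_add_atTop_nhds_zero_nat.eventually (gt_mem_nhds hδ)
  obtain ⟨n, h2, h3, h4⟩ := ((h1 _ hGx).and ((h1 _ (sub_pos.2 hlt)).and
    (tendsto_natCast_atTop_atTop.eventually_ge_atTop |Real.log (ρ x)|))).exists
  refine hx n ⟨h4, h2.le, ?_⟩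
  change C + 1 / ((n : ℝ) + 1) ≤ (w x)⁻¹ * ‖G x‖
  linarith

/-- Weighted `L₁ → L₂` bounds for a positive symmetric semigroup yield `L₁ → L_∞` bounds. -/
theorem weightedNorm_one_top_le (hρ : Measurable ρ) (hpos : ∀ x, 0 < ρ x)
    (hS : IsPositiveSymmetricSemigroup S) {K : ℝ} (hK : 0 ≤ K) {t : ℝ≥0} (α : ℝ)
    (h : ∀ g, weightedNorm (fun x => ρ x ^ α) 2 (S t g) ≤
      ENNReal.ofReal K * weightedNorm (fun x => ρ x ^ α) 1 g)
    (h' : ∀ g, weightedNorm (fun x => ρ x ^ (-α)) 2 (S t g) ≤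
      ENNReal.ofReal K * weightedNorm (fun x => ρ x ^ (-α)) 1 g) (g : Lp ℂ 2 μ) :
    weightedNorm (fun x => ρ x ^ α) ∞ (S (t + t) g) ≤
      ENNReal.ofReal (K ^ 2) * weightedNorm (fun x => ρ x ^ α) 1 g := by
  refine weightedNorm_apply_le_of_isNice hρ (hρ.pow_const α) (fun g hg => ?_) g
  wlog hg0 : 0 ≤ g generalizing g
  · have := this (absLp g) hg.absLp (absLp_nonneg g)
    rw [weightedNorm_absLp] at this
    exact (weightedNorm_mono ((hS.pos _).norm_apply_le_absLp g)).trans this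
  have hfin := hg.weightedNorm_ne_top hρ hpos α 1
  rw [← ENNReal.ofReal_toReal hfin, ← ENNReal.ofReal_mul (by positivity)]
  refine weightedNorm_top_le_of_inner hρ hpos α ((hS.pos _).map_nonneg hg0) (by positivity)
    fun v => ?_
  -- The adjoint carries the reciprocal weight ρ^(-α), hence the need for the bound at -α.
  have e : inner ℂ v (S (t + t) g) = inner ℂ (S t v) (S t g) := by
    rw [hS.isC0.map_add]
    exact ((ContinuousLinearMap.isSelfAdjoint_iff_isSymmetric.1 (hS.sa t)) v (S t g)).symm
  rw [e]
  refine (enorm_inner_le_weightedNorm (w := fun x => ρ x ^ α) (w' := fun x => ρ x ^ (-α))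
    (fun x => ?_) (hρ.pow_const _) (hρ.pow_const _) 2 2 _ _).trans
    ((mul_le_mul' (h' v) (h g)).trans (le_of_eq ?_))
  · rw [← Real.rpow_add (hpos x), neg_add_cancel, Real.rpow_zero]
  · rw [ENNReal.ofReal_mul (by positivity), ENNReal.ofReal_toReal hfin, ENNReal.ofReal_pow hK]
    ring

end Duality

end

/-! ### The main theorem -/

theorem mainTheorem5 {Ω : Type*} [MeasurableSpace Ω] (μ : Measure Ω)
    (ρ : Ω → ℝ) (hρ : Measurable ρ) (hρ_pos : ∀ x, 0 < ρ x)
    (T : ℝ≥0 → Lp ℂ 2 μ →L[ℂ] Lp ℂ 2 μ)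
    (hT : IsC0Semigroup T)
    (hT_pos : ∀ t, IsPositiveOperator (T t))
    (hT_sa : ∀ t, IsSelfAdjoint (T t))
    (c ν : ℝ) (hc : 0 < c) (hν : 0 < ν)
    (hT_ultra : ∀ t : ℝ≥0, 0 < t → ∀ α : ℝ,
      weightedOpNorm (T t) (fun x => ρ x ^ α) 1 ∞ ≤
        ENNReal.ofReal (c * (t : ℝ) ^ (-ν) * Real.exp (α ^ 2 * t)))
    (V : Ω → ℝ) (hV : Measurable V)
    (p M : ℝ) (hp : 1 < p) (hM : 1 ≤ M)
    (hpV : IsAdmissible T (fun x => p * V x))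
    (hpV_contr : ∀ t : ℝ≥0, 0 < t → ‖absorptionSemigroup T (fun x => p * V x) t‖ ≤ 1)
    (hV_L1 : ∀ t : ℝ≥0, 0 < t → ∀ α : ℝ,
      weightedOpNorm (absorptionSemigroup T V t) (fun x => ρ x ^ α) 1 1 ≤
        ENNReal.ofReal (M * Real.exp (α ^ 2 * t))) :
    IsAdmissible T V ∧
      ∃ c' : ℝ, 0 < c' ∧ ∀ t : ℝ≥0, 0 < t → ∀ α : ℝ,
        weightedOpNorm (absorptionSemigroup T V t) (fun x => ρ x ^ α) 1 ∞ ≤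
          ENNReal.ofReal (c' * (t : ℝ) ^ (-ν) * Real.exp (α ^ 2 * t)) := by
  have hT' : IsPositiveSymmetricSemigroup T := ⟨hT, hT_pos, hT_sa⟩
  have hVadm : IsAdmissible T V := hpV.of_const_mul hT' hV hp
  refine ⟨hVadm, ?_⟩
  obtain ⟨S, hS, hSlim, ω, hω, hSb⟩ := hVadm.exists_limit hT' hV
  obtain ⟨U, hU, hUlim, ω', hω', hUb⟩ := hpV.exists_limit hT' (hV.const_mul p)
  rw [absorptionSemigroup_eq hSlim] at hV_L1 ⊢
  rw [absorptionSemigroup_eq hUlim] at hpV_contr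
  have hw : ∀ α : ℝ, Measurable fun x => ρ x ^ α := fun α => hρ.pow_const α
  have hwpos : ∀ (α : ℝ) (x : Ω), 0 < ρ x ^ α := fun α x => Real.rpow_pos_of_pos (hρ_pos x) α
  have hTtop : ∀ t : ℝ≥0, 0 < t → ∀ (α : ℝ) (g : Lp ℂ 2 μ),
      weightedNorm (fun x => ρ x ^ α) ∞ (T t g) ≤
        ENNReal.ofReal (c * (t : ℝ) ^ (-ν) * Real.exp (α ^ 2 * t)) *
          weightedNorm (fun x => ρ x ^ α) 1 g := fun t ht α =>
    weightedNorm_le_of_weightedOpNorm_le (hw α) (hwpos α) (hT_ultra t ht α) (by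
      have := Real.rpow_pos_of_pos (NNReal.coe_pos.2 ht) (-ν)
      rw [Ne, ENNReal.ofReal_eq_zero, not_le]
      positivity)
  have hS1 : ∀ t : ℝ≥0, 0 < t → ∀ (α : ℝ) (g : Lp ℂ 2 μ),
      weightedNorm (fun x => ρ x ^ α) 1 (S t g) ≤
        ENNReal.ofReal (M * Real.exp (α ^ 2 * t)) * weightedNorm (fun x => ρ x ^ α) 1 g :=
    fun t ht α => weightedNorm_le_of_weightedOpNorm_le (hw α) (hwpos α) (hV_L1 t ht α) (by
      rw [Ne, ENNReal.ofReal_eq_zero, not_le]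
      positivity)
  have hS2 : ∀ t : ℝ≥0, 0 < t → ∀ (α : ℝ) (g : Lp ℂ 2 μ),
      weightedNorm (fun x => ρ x ^ α) 2 (S t g) ≤
        ENNReal.ofReal (Real.exp ((ω + α ^ 2) * t)) * weightedNorm (fun x => ρ x ^ α) 2 g :=
    fun t ht α g => weightedNorm_two_absorption_le hρ hρ_pos hT' hc hTtop hV hSlim hω hSb ht α g
  have hU2 : ∀ t : ℝ≥0, 0 < t → ∀ (α : ℝ) (g : Lp ℂ 2 μ),
      weightedNorm (fun x => ρ x ^ α) 2 (U t g) ≤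
        ENNReal.ofReal (Real.exp (α ^ 2 * t)) * weightedNorm (fun x => ρ x ^ α) 2 g :=
    fun t ht α g => weightedNorm_two_contraction_le hρ hρ_pos hU.isC0 hU.sa hpV_contr hω'
      (fun t ht α g => weightedNorm_two_absorption_le hρ hρ_pos hT' hc hTtop (hV.const_mul p) hUlim
        hω' hUb ht α g) ht α g
  set σ : ℝ := p⁻¹ / (2 - p⁻¹) with hσ
  set D : ℝ := (2 ^ ν) ^ (1 / (1 - σ)) * (c * M ^ 3) with hD
  have hD0 : 0 < D := by positivity
  have h12 : ∀ t : ℝ≥0, 0 < t → ∀ (α : ℝ) (g : Lp ℂ 2 μ),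
      weightedNorm (fun x => ρ x ^ α) 2 (S t g) ≤
        ENNReal.ofReal (√(D * (t : ℝ) ^ (-ν)) * Real.exp (α ^ 2 * t)) *
          weightedNorm (fun x => ρ x ^ α) 1 g := fun t ht α g =>
    weightedNorm_one_two_le hρ hρ_pos α (inv_pos.2 (by linarith)) (inv_lt_one_of_one_lt₀ hp) hS
      (fun t f hf => absorption_geomMean hT' hV hp hSlim hUlim t hf) hc hν hM hω
      (fun t ht => hTtop t ht α) (fun t ht => hS1 t ht α) (fun t ht => hU2 t ht α)
      (fun t ht => hS2 t ht α) hσ ht g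
  -- The 1→2 bound is squared at time t/2: the square root goes away, (t/2)^(-ν) supplies 2^ν, and
  -- the two factors e^(α²t/2) give e^(α²t).
  refine ⟨D * 2 ^ ν, by positivity, fun t ht α => ?_⟩
  refine weightedOpNorm_le_of_weightedNorm_le (hwpos α) fun g => ?_
  have ht2 : 0 < t / 2 := half_pos ht
  have h2 := weightedNorm_one_top_le hρ hρ_pos hS (by positivity) α (h12 (t / 2) ht2 α)
    (by simpa using h12 (t / 2) ht2 (-α)) g
  rw [add_halves] at h2
  refine h2.trans (le_of_eq ?_)
  have ht' : 0 < (t : ℝ) := NNReal.coe_pos.2 ht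
  congr 2
  have hE : Real.exp (α ^ 2 * (t / 2 : ℝ)) ^ 2 = Real.exp (α ^ 2 * t) := by
    rw [← Real.exp_nat_mul]; congr 1; push_cast; ring
  push_cast
  rw [mul_pow, hE, Real.sq_sqrt (by positivity), Real.div_rpow ht'.le zero_le_two,
    Real.rpow_neg zero_le_two, div_inv_eq_mul]
  ring
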